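/- **Setting.** There are $m>1$ agents; $\sigma>0$ and $c>0$ are known. A dataset is an element of $\bigcup_{n\ge 0}\mathbb{R}^n$. A mechanism is a space of allocations together with a (possibly randomized) procedure mapping the $m$ submitted datasets to $m$ allocations. A strategy of agent $i$ is a triple $s_i=(n_i,f_i,h_i)$: she collects a dataset $X_i$ of $n_i\in\mathbb{N}$ i.i.d. points from $\mathcal{N}(\mu,\sigma^2)$, submits the dataset $Y_i=f_i(X_i)$ with $f_i$ an arbitrary (measurable) map of datasets to datasets, receives the allocation $A_i$, and estimates $\mu$ by $h_i(X_i,Y_i,A_i)$. Data of different agents are independent. The penalty of agent $i$ under mechanism $M$ and profile $s$ is $$p_i(M,s)=\sup_{\mu\in\mathbb{R}}\mathbb{E}\big[(h_i(X_i,Y_i,A_i)-\mu)^2\,\big|\,\mu\big]+c\,n_i .$$ The profile $s$ is a *Nash equilibrium* of $M$ if $p_i(M,s)\le p_i(M,(t,s_{-i}))$ for every $i$ and every strategy $t$. The mechanism is *individually rational* at $s$ if for every $i$, $p_i(M,s)\le\inf_{n\in\mathbb{N},\,h}\{\sup_\mu\mathbb{E}[(h(X)-\mu)^2\mid\mu]+cn\}$,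 where $X$ is a dataset of $n$ i.i.d. points from $\mathcal N(\mu,\sigma^2)$ and $h$ ranges over all estimators based on $X$ alone. Finally $$\mathrm{PoS}(M,s)=\frac{\sum_i p_i(M,s)}{\inf_{M',s'}\sum_i p_i(M',s')},$$ the infimum being over all mechanisms and all strategy profiles. **The number $\alpha$.** For $m>4$, $\alpha$ is the smallest number larger than $\sqrt{\sigma}\,(cm)^{-1/4}$ with $G(\alpha)=0$, where $$G(\alpha)=\Big(\tfrac{m-4}{m-2}\,\tfrac{4\alpha^2}{\sigma/\sqrt{cm}}-1\Big)\frac{4\alpha}{\sqrt{\sigma}(m/c)^{1/4}}-\Big(4(m+1)\tfrac{\alpha^2}{\sigma\sqrt{m/c}}-1\Big)\sqrt{2\pi}\,\exp\Big(\tfrac{\sigma\sqrt{m/c}}{8\alpha^2}\Big)\operatorname{erfc}\Big(\tfrac{\sqrt{\sigma}(m/c)^{1/4}}{2\sqrt2\,\alpha}\Big).$$ **The mechanism CCCD.** For each agent $i$, let $Y_{-i}$ be the pooled submissions of the other agents. If $m\le4$, agent $i$ receives $(Y_{-i},\emptyset,0)$. If $m>4$, the mechanism draws $\min\{|Y_{-i}|,\sigma/\sqrt{cm}\}$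 points $Z_i$ from $Y_{-i}$ uniformly without replacement, sets $$\eta_i^2=\alpha^2\Big(\tfrac1{|Y_i|}\sum_{y\in Y_i}y-\tfrac1{|Z_i|}\sum_{z\in Z_i}z\Big)^2$$ (the mean of an empty dataset being $0$ by convention), adds independent $\mathcal{N}(0,\eta_i^2)$ noise to each point of $Y_{-i}\setminus Z_i$ to obtain $Z_i'$, and gives agent $i$ the allocation $(Z_i,Z_i',\eta_i^2)$. The random draws for different agents are independent. **The recommended profile $s^\star$.** Every agent collects $n^\star$ points, where $n^\star=\sigma/(m\sqrt c)$ if $m\le4$ and $n^\star=\sigma/\sqrt{cm}$ if $m>4$; she submits them unchanged; and she uses the estimator $$h^\star\big(X_i,Y_i,(Z_i,Z_i',\eta_i^2)\big)=\frac{\frac1{\sigma^2}\sum_{u\in X_i\cup Z_i}u+\frac1{\sigma^2+\eta_i^2}\sum_{u\in Z_i'}u}{\frac1{\sigma^2}\big(|X_i|+|Z_i|\big)+\frac1{\sigma^2+\eta_i^2}|Z_i'|}.$$ **Theorem.** Let $m>1$, $\sigma>0$, $c>0$, and suppose that $n^\star$ is an integer. Then $\alpha$ is well defined when $m>4$ (the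 set of roots of $G$ larger than $\sqrt{\sigma}(cm)^{-1/4}$ has a least element), and: (i) $s^\star$ is a Nash equilibrium of CCCD; (ii) CCCD is individually rational at $s^\star$; (iii) $\mathrm{PoS}(\mathrm{CCCD},s^\star)\le2$. -/

import Mathlib

open MeasureTheory ProbabilityTheory
open scoped ENNReal NNReal

universe u v

noncomputable section

namespace MeanEstimation

/-! ### Datasets -/

/-- A dataset: a finite tuple of reals of arbitrary length, i.e. an element of `⋃ₙ ℝⁿ`. -/
abbrev Dataset : Type := Σ n : ℕ, (Fin n → ℝ)

namespace Dataset

/-- The empty dataset. -/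
def empty : Dataset := ⟨0, Fin.elim0⟩

/-- The number of points. -/
def size (d : Dataset) : ℕ := d.1

/-- The sum of the points. -/
def total (d : Dataset) : ℝ := ∑ j, d.2 j

/-- The sample mean; the mean of the empty dataset is `0` by convention. -/
def mean (d : Dataset) : ℝ := d.total / d.size

/-- Pooling (concatenating) a finite family of datasets. -/
def concat {m : ℕ} (y : Fin m → Dataset) : Dataset :=
  ⟨∑ j, (y j).1, fun k =>
    (y (finSigmaFinEquiv.symm k).1).2 (finSigmaFinEquiv.symm k).2⟩

/-- The pooled data of all agents other than `i`. -/
def others {m : ℕ} (y : Fin m → Dataset) (i : Fin m) : Dataset :=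
  concat (Function.update y i empty)

/-- The `k`-th point of a dataset, with value `0` beyond its end. -/
def coord (k : ℕ) (d : Dataset) : ℝ := if h : k < d.1 then d.2 ⟨k, h⟩ else 0

lemma measurable_of_slices {γ : Type*} [MeasurableSpace γ] {f : Dataset → γ}
    (h : ∀ n, Measurable fun x : Fin n → ℝ => f ⟨n, x⟩) : Measurable f := by
  intro s hs
  rw [MeasurableSpace.measurableSet_iInf]
  intro n
  exact h n hs

lemma measurable_mk (n : ℕ) : Measurable fun x : Fin n → ℝ => (⟨n, x⟩ : Dataset) := by
  intro s hs
  exact (MeasurableSpace.measurableSet_iInf.1 hs) n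

lemma measurable_size : Measurable size :=
  measurable_of_slices fun _ => measurable_const

lemma measurable_total : Measurable total :=
  measurable_of_slices fun n => by
    simp only [total]
    refine Finset.measurable_sum Finset.univ (f := fun j (x : Fin n → ℝ) => x j) fun j _ => ?_
    exact measurable_pi_apply j

lemma measurable_mean : Measurable mean := by
  have h1 := measurable_total
  have h2 : Measurable fun d : Dataset => (d.size : ℝ) :=
    (measurable_from_top (f := fun n : ℕ => (n : ℝ))).comp measurable_size
  exact h1.div h2

lemma measurable_coord (k : ℕ) : Measurable (coord k) :=
  measurable_of_slices fun n => by
    unfold coord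
    by_cases h : k < n
    · simp only [h, dite_true]
      exact measurable_pi_apply (X := fun _ : Fin n => ℝ) ⟨k, h⟩
    · simp only [h, dite_false]
      exact measurable_const

/-- To prove a map measurable one may fix the value of a discrete statistic. -/
lemma measurable_of_discrete {Ω ι γ : Type*} [MeasurableSpace Ω] [MeasurableSpace γ]
    [Countable ι] [MeasurableSpace ι] [MeasurableSingletonClass ι] {φ : Ω → ι}
    (hφ : Measurable φ) {f : Ω → γ} (g : ι → Ω → γ) (hg : ∀ i, Measurable (g i))
    (h : ∀ ω, f ω = g (φ ω) ω) : Measurable f := by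
  have h1 : Measurable (Function.uncurry g) := measurable_from_prod_countable_right hg
  have h2 : Measurable fun ω => Function.uncurry g (φ ω, ω) :=
    h1.comp (hφ.prodMk measurable_id)
  have h3 : f = fun ω => Function.uncurry g (φ ω, ω) := funext h
  rw [h3]
  exact h2

lemma measurable_concat {m : ℕ} :
    Measurable (concat : (Fin m → Dataset) → Dataset) := by
  refine measurable_of_discrete (φ := fun y j => (y j).size)
    (measurable_pi_iff.2 fun j => measurable_size.comp (measurable_pi_apply j))
    (fun n y => ⟨∑ j, n j, fun k =>
      coord (finSigmaFinEquiv.symm k).2 (y (finSigmaFinEquiv.symm k).1)⟩) ?_ ?_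
  · intro n
    refine (measurable_mk _).comp (measurable_pi_iff.2 fun k => ?_)
    exact (measurable_coord _).comp (measurable_pi_apply _)
  · intro y
    simp only [concat, size]
    congr 1
    funext k
    simp only [coord, Fin.is_lt, dite_true]
    rfl

lemma measurable_others {m : ℕ} (i : Fin m) :
    Measurable fun y : Fin m → Dataset => others y i := by
  refine measurable_concat.comp (measurable_pi_iff.2 fun j => ?_)
  by_cases h : j = i
  · subst h
    simp
  · simp only [Function.update_of_ne h]
    exact measurable_pi_apply j

end Dataset

/-! ### Mechanisms, strategies, penalties -/

/-- A (possibly randomized) mechanism for `m` agents: a space of allocations and a procedure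
mapping the `m` submitted datasets to (a law on) the `m` allocations. -/
structure Mechanism (m : ℕ) where
  Alloc : Type u
  [measurableAlloc : MeasurableSpace Alloc]
  proc : Kernel (Fin m → Dataset) (Fin m → Alloc)
  [markov : IsMarkovKernel proc]

attribute [instance] Mechanism.measurableAlloc Mechanism.markov

/-- A strategy of an agent: how many points to collect, what to submit as a function of the
collected data, and how to estimate the mean from the collected data, the submitted data and the
allocation. -/
structure Strategy (A : Type u) [MeasurableSpace A] where
  n : ℕ
  submit : Dataset → Dataset
  measurable_submit : Measurable submit
  estimate : Dataset → Dataset → A → ℝ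
  measurable_estimate : Measurable fun p : Dataset × Dataset × A => estimate p.1 p.2.1 p.2.2

/-- The law of `n` i.i.d. points from `N(μ, σ²)`. -/
def sampleLaw (μ σ : ℝ) (n : ℕ) : Measure Dataset :=
  (Measure.pi fun _ : Fin n => gaussianReal μ (Real.toNNReal (σ ^ 2))).map (Sigma.mk n)

/-- The penalty of agent `i`: maximum risk over `μ` plus the cost of collecting the data. -/
def penalty (σ c : ℝ) {m : ℕ} (M : Mechanism.{u} m) (s : Fin m → Strategy M.Alloc)
    (i : Fin m) : ℝ≥0∞ :=
  (⨆ μ : ℝ, ∫⁻ X : Fin m → Dataset,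
      ∫⁻ A : Fin m → M.Alloc,
        ENNReal.ofReal (((s i).estimate (X i) ((s i).submit (X i)) (A i) - μ) ^ 2)
      ∂(M.proc fun j => (s j).submit (X j))
    ∂(Measure.pi fun j => sampleLaw μ σ (s j).n))
  + ENNReal.ofReal (c * (s i).n)

/-- The lowest penalty of an agent working on her own. -/
def soloPenalty (σ c : ℝ) : ℝ≥0∞ :=
  ⨅ (n : ℕ) (h : Dataset → ℝ) (_ : Measurable h),
    (⨆ μ : ℝ, ∫⁻ X, ENNReal.ofReal ((h X - μ) ^ 2) ∂(sampleLaw μ σ n))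
      + ENNReal.ofReal (c * n)

/-- `s` is a Nash equilibrium of `M`: no unilateral deviation lowers an agent's penalty. -/
def IsNashEquilibrium (σ c : ℝ) {m : ℕ} (M : Mechanism.{u} m)
    (s : Fin m → Strategy M.Alloc) : Prop :=
  ∀ (i : Fin m) (t : Strategy M.Alloc),
    penalty σ c M s i ≤ penalty σ c M (Function.update s i t) i

/-- `M` is individually rational at `s`. -/
def IsIndividuallyRational (σ c : ℝ) {m : ℕ} (M : Mechanism.{u} m)
    (s : Fin m → Strategy M.Alloc) : Prop :=
  ∀ i : Fin m, penalty σ c M s i ≤ soloPenalty σ c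

/-- The social penalty: the sum of the agents' penalties. -/
def socialPenalty (σ c : ℝ) {m : ℕ} (M : Mechanism.{u} m)
    (s : Fin m → Strategy M.Alloc) : ℝ≥0∞ :=
  ∑ i, penalty σ c M s i

/-- The lowest social penalty over all mechanisms and all strategy profiles. -/
def minSocialPenalty (σ c : ℝ) (m : ℕ) : ℝ≥0∞ :=
  ⨅ (M : Mechanism.{v} m) (s : Fin m → Strategy M.Alloc), socialPenalty σ c M s

/-- The ratio of the social penalty of `M` at `s` to the global minimum. -/
def PoS (σ c : ℝ) {m : ℕ} (M : Mechanism.{u} m) (s : Fin m → Strategy M.Alloc) : ℝ≥0∞ :=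
  socialPenalty σ c M s / minSocialPenalty.{v} σ c m

/-! ### The corruption level `α` -/

/-- The complementary error function. -/
def erfc (x : ℝ) : ℝ := 2 / √Real.pi * ∫ t in Set.Ioi x, Real.exp (-t ^ 2)

/-- The function `G` whose root determines `α`. -/
def G (σ c : ℝ) (m : ℕ) (a : ℝ) : ℝ :=
  (((m : ℝ) - 4) / ((m : ℝ) - 2) * (4 * a ^ 2 / (σ / √(c * m))) - 1)
      * (4 * a / (√σ * ((m : ℝ) / c) ^ (1 / 4 : ℝ)))
  - (4 * ((m : ℝ) + 1) * (a ^ 2 / (σ * √(m / c))) - 1)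
      * √(2 * Real.pi) * Real.exp (σ * √(m / c) / (8 * a ^ 2))
      * erfc (√σ * ((m : ℝ) / c) ^ (1 / 4 : ℝ) / (2 * √2 * a))

/-- The roots of `G` larger than `√σ (cm)^(-1/4)`. -/
def admissibleRoots (σ c : ℝ) (m : ℕ) : Set ℝ :=
  {a | √σ * (c * m) ^ (-(1 / 4) : ℝ) < a ∧ G σ c m a = 0}

/-- `α`, the smallest root of `G` larger than `√σ (cm)^(-1/4)`. -/
def alpha (σ c : ℝ) (m : ℕ) : ℝ := sInf (admissibleRoots σ c m)

/-! ### The mechanism -/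

/-- An allocation: an uncorrupted dataset, a corrupted dataset, and the variance of the noise. -/
abbrev Allocation : Type := Dataset × Dataset × ℝ≥0

/-- The variance of the noise: `α²` times the squared difference of the sample means. -/
def noiseVar (a : ℝ) (own clean : Dataset) : ℝ≥0 :=
  Real.toNNReal (a ^ 2 * (own.mean - clean.mean) ^ 2)

/-- The first `min n k` of the `n` pooled points after they were permuted by `π`. For a uniformly
random permutation this is a sample of `min n k` points without replacement. -/
def cleanPart (k : ℕ) {n : ℕ} (pool : Fin n → ℝ) (π : Equiv.Perm (Fin n)) : Dataset :=
  ⟨min n k, fun j => pool (π (Fin.castLE (min_le_left _ _) j))⟩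

/-- The remaining `n - min n k` points of the pool. -/
def restPart (k : ℕ) {n : ℕ} (pool : Fin n → ℝ) (π : Equiv.Perm (Fin n)) :
    Fin (n - min n k) → ℝ :=
  fun j => pool (π ⟨min n k + j, by omega⟩)

/-- The law of the allocation given the permutation `π`: independent Gaussian noise is added to
every point outside the clean part. -/
def corruptLaw (a : ℝ) (k : ℕ) (own : Dataset) {n : ℕ} (pool : Fin n → ℝ)
    (π : Equiv.Perm (Fin n)) : Measure Allocation :=
  (Measure.pi fun _ : Fin (n - min n k) =>
      gaussianReal 0 (noiseVar a own (cleanPart k pool π))).map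
    fun ε => (cleanPart k pool π, ⟨n - min n k, restPart k pool π + ε⟩,
      noiseVar a own (cleanPart k pool π))

/-- The law of the allocation: the average over all permutations of the pool. -/
def sampleCorruptLaw (a : ℝ) (k : ℕ) (own : Dataset) {n : ℕ} (pool : Fin n → ℝ) :
    Measure Allocation :=
  (n.factorial : ℝ≥0∞)⁻¹ • ∑ π : Equiv.Perm (Fin n), corruptLaw a k own pool π

/-- The law of the allocation of agent `i` in CCCD, given the submitted datasets. -/
def allocLaw (σ c : ℝ) (m : ℕ) (i : Fin m) (y : Fin m → Dataset) : Measure Allocation :=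
  if m ≤ 4 then Measure.dirac (Dataset.others y i, Dataset.empty, 0)
  else sampleCorruptLaw (alpha σ c m) ⌊σ / √(c * m)⌋₊ (y i) (Dataset.others y i).2

lemma measurable_pi_measure {Ω ι : Type*} [MeasurableSpace Ω] [Fintype ι] {E : ι → Type*}
    [∀ i, MeasurableSpace (E i)] (κ : ∀ i, Ω → Measure (E i))
    [∀ i ω, IsProbabilityMeasure (κ i ω)] (h : ∀ i, Measurable (κ i)) :
    Measurable fun ω => Measure.pi fun i => κ i ω := by
  refine Measurable.measure_of_isPiSystem_of_isProbabilityMeasure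
    generateFrom_pi.symm isPiSystem_pi ?_
  rintro _ ⟨s, hs, rfl⟩
  simp only [Measure.pi_pi]
  refine Finset.measurable_prod _ fun i _ => ?_
  exact (Measure.measurable_coe (hs i (Set.mem_univ i))).comp (h i)

instance (a : ℝ) (k : ℕ) (own : Dataset) {n : ℕ} (pool : Fin n → ℝ) (π : Equiv.Perm (Fin n)) :
    IsProbabilityMeasure (corruptLaw a k own pool π) := by
  refine Measure.isProbabilityMeasure_map (Measurable.aemeasurable ?_)
  refine measurable_const.prodMk (Measurable.prodMk ?_ measurable_const)
  have h : Measurable fun ε : Fin (n - min n k) → ℝ => restPart k pool π + ε :=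
    measurable_const_add _
  exact (Dataset.measurable_mk _).comp h

instance (a : ℝ) (k : ℕ) (own : Dataset) {n : ℕ} (pool : Fin n → ℝ) :
    IsProbabilityMeasure (sampleCorruptLaw a k own pool) := by
  constructor
  simp only [sampleCorruptLaw, Measure.smul_apply, Measure.finsetSum_apply, measure_univ,
    Finset.sum_const, Finset.card_univ, Fintype.card_perm, Fintype.card_fin, smul_eq_mul,
    nsmul_eq_mul, mul_one]
  exact ENNReal.inv_mul_cancel (by simp [Nat.factorial_ne_zero]) (by simp)

instance (σ c : ℝ) (m : ℕ) (i : Fin m) (y : Fin m → Dataset) :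
    IsProbabilityMeasure (allocLaw σ c m i y) := by
  unfold allocLaw
  split_ifs <;> infer_instance

lemma measurable_noiseVar {Ω : Type*} [MeasurableSpace Ω] (a : ℝ) {f g : Ω → Dataset}
    (hf : Measurable f) (hg : Measurable g) : Measurable fun ω => noiseVar a (f ω) (g ω) := by
  have h1 : Measurable fun ω => (f ω).mean := Dataset.measurable_mean.comp hf
  have h2 : Measurable fun ω => (g ω).mean := Dataset.measurable_mean.comp hg
  unfold noiseVar
  exact (((h1.sub h2).pow_const 2).const_mul _).real_toNNReal

lemma measurable_gaussian {Ω : Type*} [MeasurableSpace Ω] {f : Ω → ℝ≥0}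
    (hf : Measurable f) : Measurable fun ω => gaussianReal 0 (f ω) := by
  have h : Measurable fun ω => ((0 : ℝ), f ω) := measurable_const.prodMk hf
  exact measurable_gaussianReal.comp h

lemma measurable_map_measure {Ω E F : Type*} [MeasurableSpace Ω] [MeasurableSpace E]
    [MeasurableSpace F] (κ : Ω → Measure E) [∀ ω, IsProbabilityMeasure (κ ω)]
    (hκ : Measurable κ) (f : Ω → E → F) (hf : Measurable fun q : Ω × E => f q.1 q.2) :
    Measurable fun ω => (κ ω).map (f ω) := by
  let K : Kernel Ω E := ⟨κ, hκ⟩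
  have : IsMarkovKernel K := ⟨fun ω => (inferInstance : IsProbabilityMeasure (κ ω))⟩
  refine Measure.measurable_of_measurable_coe _ fun s hs => ?_
  have h1 : ∀ ω, (κ ω).map (f ω) s = K ω (Prod.mk ω ⁻¹' ((fun q : Ω × E => f q.1 q.2) ⁻¹' s)) :=
    fun ω => Measure.map_apply (hf.comp measurable_prodMk_left) hs
  simp only [h1]
  exact Kernel.measurable_kernel_prodMk_left (hf hs)

lemma measurable_noisy {Ω : Type*} [MeasurableSpace Ω] {N : ℕ} {z : Ω → Dataset}
    {r : Ω → Fin N → ℝ} {w : Ω → ℝ≥0} (hz : Measurable z) (hr : Measurable r)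
    (hw : Measurable w) :
    Measurable fun ω => (Measure.pi fun _ : Fin N => gaussianReal 0 (w ω)).map
      fun ε => ((z ω, ⟨N, r ω + ε⟩, w ω) : Allocation) := by
  have h1 : Measurable fun ω => Measure.pi fun _ : Fin N => gaussianReal 0 (w ω) :=
    measurable_pi_measure (fun _ : Fin N => fun ω => gaussianReal 0 (w ω))
      fun _ => measurable_gaussian hw
  have h2 : Measurable fun q : Ω × (Fin N → ℝ) => r q.1 + q.2 :=
    (hr.comp measurable_fst).add measurable_snd
  have h3 : Measurable fun q : Ω × (Fin N → ℝ) => (⟨N, r q.1 + q.2⟩ : Dataset) :=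
    (Dataset.measurable_mk N).comp h2
  exact measurable_map_measure _ h1 (fun ω ε => ((z ω, ⟨N, r ω + ε⟩, w ω) : Allocation))
    ((hz.comp measurable_fst).prodMk (h3.prodMk (hw.comp measurable_fst)))

lemma measurable_corruptLaw_slice (a : ℝ) (k n : ℕ) (π : Equiv.Perm (Fin n)) :
    Measurable fun p : Dataset × (Fin n → ℝ) => corruptLaw a k p.1 p.2 π := by
  have hclean : Measurable fun p : Dataset × (Fin n → ℝ) => cleanPart k p.2 π := by
    have h : Measurable fun p : Dataset × (Fin n → ℝ) =>
        fun j : Fin (min n k) => p.2 (π (Fin.castLE (min_le_left _ _) j)) := by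
      fun_prop
    exact (Dataset.measurable_mk _).comp h
  have hvar : Measurable fun p : Dataset × (Fin n → ℝ) =>
      noiseVar a p.1 (cleanPart k p.2 π) :=
    measurable_noiseVar a measurable_fst hclean
  have hrest : Measurable fun p : Dataset × (Fin n → ℝ) => restPart k p.2 π := by
    unfold restPart
    fun_prop
  exact measurable_noisy hclean hrest hvar

lemma measurable_sampleCorruptLaw {Ω : Type*} [MeasurableSpace Ω] (a : ℝ) (k : ℕ)
    {f g : Ω → Dataset} (hf : Measurable f) (hg : Measurable g) :
    Measurable fun ω => sampleCorruptLaw a k (f ω) (g ω).2 := by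
  have h : ∀ n, Measurable fun q : Dataset × (Fin n → ℝ) => sampleCorruptLaw a k q.1 q.2 := by
    intro n
    refine Measure.measurable_of_measurable_coe _ fun s hs => ?_
    simp only [sampleCorruptLaw, Measure.smul_apply, Measure.finsetSum_apply, smul_eq_mul]
    have h1 : ∀ π : Equiv.Perm (Fin n), Measurable fun q : Dataset × (Fin n → ℝ) =>
        corruptLaw a k q.1 q.2 π s := fun π =>
      (Measure.measurable_coe hs).comp (measurable_corruptLaw_slice a k n π)
    exact (Finset.measurable_sum Finset.univ fun π _ => h1 π).const_mul _
  have hq : ∀ n, Measurable fun ω =>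
      ((f ω, fun j : Fin n => Dataset.coord j (g ω)) : Dataset × (Fin n → ℝ)) := fun n =>
    hf.prodMk (measurable_pi_iff.2 fun j => (Dataset.measurable_coord _).comp hg)
  have hs : Measurable fun ω => (g ω).size := Dataset.measurable_size.comp hg
  refine Dataset.measurable_of_discrete hs _ (fun n => (h n).comp (hq n)) fun ω => ?_
  have h2 : (fun j : Fin (g ω).size => Dataset.coord j (g ω)) = (g ω).2 := by
    funext j
    simp only [Dataset.coord]
    exact dif_pos j.2
  simp only [Function.comp]
  rw [h2]
  rfl

lemma measurable_allocLaw (σ c : ℝ) (m : ℕ) (i : Fin m) : Measurable (allocLaw σ c m i) := by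
  unfold allocLaw
  split_ifs
  · exact Measure.measurable_dirac.comp
      ((Dataset.measurable_others i).prodMk measurable_const)
  · exact measurable_sampleCorruptLaw _ _ (measurable_pi_apply i) (Dataset.measurable_others i)

/-- The mechanism CCCD. The coins tossed for different agents are independent. -/
def CCCD (σ c : ℝ) (m : ℕ) : Mechanism.{0} m :=
  haveI : IsMarkovKernel (⟨fun y => Measure.pi fun i => allocLaw σ c m i y,
      measurable_pi_measure (fun i => allocLaw σ c m i) (measurable_allocLaw σ c m)⟩ :
      Kernel (Fin m → Dataset) (Fin m → Allocation)) :=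
    ⟨fun y => (inferInstance : IsProbabilityMeasure (Measure.pi fun i => allocLaw σ c m i y))⟩
  { Alloc := Allocation
    proc := ⟨fun y => Measure.pi fun i => allocLaw σ c m i y,
      measurable_pi_measure (fun i => allocLaw σ c m i) (measurable_allocLaw σ c m)⟩ }

/-! ### The recommended strategies -/

/-- The recommended number of points, as a real number. -/
def recommendedSize (σ c : ℝ) (m : ℕ) : ℝ :=
  if m ≤ 4 then σ / (m * √c) else σ / √(c * m)

/-- The average of all points weighted by their inverse variances. -/
def weightedAverage (σ : ℝ) (x clean noisy : Dataset) (v : ℝ≥0) : ℝ :=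
  (1 / σ ^ 2 * (x.total + clean.total) + 1 / (σ ^ 2 + v) * noisy.total)
    / (1 / σ ^ 2 * (x.size + clean.size) + 1 / (σ ^ 2 + v) * noisy.size)

lemma measurable_weightedAverage (σ : ℝ) :
    Measurable fun p : Dataset × Dataset × Allocation =>
      weightedAverage σ p.1 p.2.2.1 p.2.2.2.1 p.2.2.2.2 := by
  have h1 := Dataset.measurable_total
  have h2 : Measurable fun d : Dataset => (d.size : ℝ) :=
    (measurable_from_top (f := fun n : ℕ => (n : ℝ))).comp Dataset.measurable_size
  have h3 : Measurable fun p : Dataset × Dataset × Allocation => (p.2.2.1.size : ℝ) :=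
    h2.comp (by fun_prop)
  have h4 : Measurable fun p : Dataset × Dataset × Allocation => (p.2.2.2.1.size : ℝ) :=
    h2.comp (by fun_prop)
  have h5 : Measurable fun p : Dataset × Dataset × Allocation => (p.1.size : ℝ) :=
    h2.comp (by fun_prop)
  unfold weightedAverage
  fun_prop

/-- The recommended strategy: collect the recommended number of points, submit them as they are,
and estimate by the inverse-variance weighted average. -/
def recommendedStrategy (σ c : ℝ) (m : ℕ) : Strategy (CCCD σ c m).Alloc where
  n := ⌊recommendedSize σ c m⌋₊
  submit := id
  measurable_submit := measurable_id
  estimate := fun x _ A => weightedAverage σ x A.1 A.2.1 A.2.2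
  measurable_estimate := measurable_weightedAverage σ

/-- The recommended strategy profile. -/
def recommendedProfile (σ c : ℝ) (m : ℕ) : Fin m → Strategy (CCCD σ c m).Alloc :=
  fun _ => recommendedStrategy σ c m

end MeanEstimation

end

noncomputable section

namespace MeanEstimation

/-! ### Products of densities -/

/-! Lower bounds on the risk come from Gaussian priors. If the law at parameter μ has density exp(bμ
− aμ²/2) relative to the law at 0, the posterior under the prior N(0, L) is Gaussian with variance
1/(1/L + a). The average of this variance bounds the maximum risk from below, and L → ∞ removes the
prior. A mechanism sees μ only through the N points collected by all agents, so every risk is at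
least σ²/N (`risk_ge`). By AM-GM the social penalty is at least 2σ√(cm) and the penalty of a
solitary agent at least 2σ√c. For m ≤ 4 nothing is corrupted: the risk σ²/N is attained, and σ²/N +
cN is least when N is m times the recommended size, so no deviation pays.

For m > 4 let k be the recommended size. A deviator with n points submits f(X). Given X and the
clean sample Z, the corrupted part is Gaussian with variance σ² + α²u², where u is the difference of
the means of f(X) and Z; hence the posterior variance of μ increases with |u|. Given X and under a
flat prior, u is Gaussian with variance σ²/n + σ²/k, and the choice of f only moves its centre. By
the rearrangement inequality `lintegral_gaussianReal_center_le` the centre 0 is best, and truthful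
submission achieves it. So misreporting is useless and the risk is bounded by a function of n alone
(`risk_corrupted_ge_limit`), which the recommended estimator attains at n = k
(`risk_weightedAverage_corrupted`).

What remains is the choice of n. The bound is a Gaussian average of functions of n, each above its
tangent at n = k (`tangent_le_posterior`), and G(α) = 0 says exactly that the averaged tangent has
slope −c. To see this, erfc is recognised as the mean of 1/(1 + bx²), and integration by parts
yields the mean of its square (`G_eq`). Roots exist by the intermediate value theorem. The same
equation bounds the penalty by 4ck (`recommendedPenalty_le`), twice an agent's share 2ck of the
social lower bound. An agent with n = 0 is left with σ²/k = mck, which is already larger. -/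

lemma lintegral_pi_prod {ι : Type*} [Fintype ι] {E : ι → Type*} [∀ i, MeasurableSpace (E i)]
    (ν : ∀ i, Measure (E i)) [∀ i, IsProbabilityMeasure (ν i)] (f : ∀ i, E i → ℝ≥0∞)
    (hf : ∀ i, Measurable (f i)) :
    ∫⁻ x, ∏ i, f i (x i) ∂Measure.pi ν = ∏ i, ∫⁻ x, f i x ∂ν i := by
  have hind : iIndepFun (fun i (x : ∀ i, E i) => f i (x i)) (Measure.pi ν) :=
    iIndepFun_pi (X := f) fun i => (hf i).aemeasurable
  have h := lintegral_prod_eq_prod_lintegral_of_indepFun Finset.univ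
    (fun i (x : ∀ i, E i) => f i (x i)) hind
    fun i => (hf i).comp (measurable_pi_apply i)
  rw [h]
  refine Finset.prod_congr rfl fun i _ => ?_
  exact (measurePreserving_eval ν i).lintegral_comp (hf i)

lemma pi_withDensity {ι : Type*} [Fintype ι] {E : ι → Type*} [∀ i, MeasurableSpace (E i)]
    (ν : ∀ i, Measure (E i)) [∀ i, IsProbabilityMeasure (ν i)] (f : ∀ i, E i → ℝ≥0∞)
    (hf : ∀ i, Measurable (f i)) [∀ i, IsProbabilityMeasure ((ν i).withDensity (f i))] :
    Measure.pi (fun i => (ν i).withDensity (f i)) =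
      (Measure.pi ν).withDensity fun x => ∏ i, f i (x i) := by
  refine Measure.pi_eq fun s hs => ?_
  rw [withDensity_apply _ (MeasurableSet.univ_pi hs),
    ← lintegral_indicator (MeasurableSet.univ_pi hs)]
  have h1 : (Set.univ.pi s).indicator (fun x => ∏ i, f i (x i)) =
      fun x => ∏ i, (s i).indicator (f i) (x i) := by
    funext x
    by_cases hx : x ∈ Set.univ.pi s
    · rw [Set.indicator_of_mem hx]
      exact Finset.prod_congr rfl fun i _ =>
        (Set.indicator_of_mem (hx i (Set.mem_univ i)) _).symm
    · rw [Set.indicator_of_notMem hx]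
      simp only [Set.mem_pi, Set.mem_univ, true_implies, not_forall] at hx
      obtain ⟨i, hi⟩ := hx
      exact (Finset.prod_eq_zero (Finset.mem_univ i) (Set.indicator_of_notMem hi _)).symm
  rw [h1, lintegral_pi_prod ν _ fun i => (hf i).indicator (hs i)]
  refine Finset.prod_congr rfl fun i _ => ?_
  rw [lintegral_indicator (hs i), withDensity_apply _ (hs i)]

/-! ### Gaussian densities -/

/-- Fixing the law at 0 as reference turns the whole family into one measure and a likelihood whose
exponent is quadratic in μ, the shape on which Gaussian priors act by conjugacy. -/
lemma gaussianReal_eq_withDensity_center (μ : ℝ) {v : ℝ≥0} (hv : v ≠ 0) :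
    gaussianReal μ v = (gaussianReal 0 v).withDensity
      fun x => ENNReal.ofReal (Real.exp (μ * x / v - μ ^ 2 / (2 * v))) := by
  have hv' : (v : ℝ) ≠ 0 := by exact_mod_cast hv
  rw [gaussianReal_of_var_ne_zero _ hv, gaussianReal_of_var_ne_zero _ hv,
    ← withDensity_mul _ (measurable_gaussianPDF _ _) (by fun_prop)]
  congr 1
  funext x
  simp only [Pi.mul_apply, gaussianPDF, gaussianPDFReal]
  rw [← ENNReal.ofReal_mul (by positivity), mul_assoc (√(2 * Real.pi * v))⁻¹, ← Real.exp_add]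
  congr 3
  field_simp
  ring

/-- Multiplying a centered Gaussian density by `exp (b x - a x² / 2)` yields a multiple of a
Gaussian density. -/
lemma gaussianReal_withDensity_tilt {L : ℝ≥0} (hL : L ≠ 0) {a : ℝ} (ha : 0 ≤ a) (b : ℝ) :
    ∃ C : ℝ≥0∞, (gaussianReal 0 L).withDensity
        (fun x => ENNReal.ofReal (Real.exp (b * x - a * x ^ 2 / 2))) =
      C • gaussianReal (b * (1 / (1 / L + a))) (Real.toNNReal (1 / (1 / L + a))) := by
  have hL' : (0 : ℝ) < L := by positivity
  set V : ℝ := 1 / (1 / L + a) with hV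
  have hVpos : 0 < V := by positivity
  have hV0 : Real.toNNReal V ≠ 0 := by simpa using hVpos
  refine ⟨ENNReal.ofReal ((√(2 * Real.pi * L))⁻¹ * √(2 * Real.pi * V) *
    Real.exp (b ^ 2 * V / 2)), ?_⟩
  rw [gaussianReal_of_var_ne_zero _ hL, gaussianReal_of_var_ne_zero _ hV0,
    ← withDensity_mul _ (measurable_gaussianPDF _ _) (by fun_prop),
    ← withDensity_smul _ (measurable_gaussianPDF _ _)]
  congr 1
  funext x
  simp only [Pi.mul_apply, Pi.smul_apply, smul_eq_mul, gaussianPDF, gaussianPDFReal,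
    Real.coe_toNNReal _ hVpos.le]
  rw [← ENNReal.ofReal_mul (by positivity), ← ENNReal.ofReal_mul (by positivity)]
  congr 1
  have h1 : √(2 * Real.pi * V) ≠ 0 := by positivity
  have hVa : a = 1 / V - 1 / L := by rw [hV]; field_simp; ring
  -- Completing the square: precisions add to 1/V = 1/L + a, and the centre is bV.
  have h2 : -(x - 0) ^ 2 / (2 * (L : ℝ)) + (b * x - a * x ^ 2 / 2) =
      b ^ 2 * V / 2 + -(x - b * V) ^ 2 / (2 * V) := by
    rw [hVa]
    field_simp
    ring
  calc _ = (√(2 * Real.pi * L))⁻¹ *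
        Real.exp (-(x - 0) ^ 2 / (2 * (L : ℝ)) + (b * x - a * x ^ 2 / 2)) := by
        rw [mul_assoc, ← Real.exp_add]
    _ = _ := by
        rw [h2, Real.exp_add]
        field_simp

lemma lintegral_sq_sub_gaussianReal (d m : ℝ) (V : ℝ≥0) :
    ∫⁻ x, ENNReal.ofReal ((d - x) ^ 2) ∂gaussianReal m V =
      ENNReal.ofReal ((d - m) ^ 2 + V) := by
  have hi1 : Integrable (fun x : ℝ => x) (gaussianReal m V) :=
    (memLp_id_gaussianReal (μ := m) (v := V) 1).integrable le_rfl
  have hi2 : Integrable (fun x : ℝ => (x - m) ^ 2) (gaussianReal m V) :=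
    ((memLp_id_gaussianReal (μ := m) (v := V) 2).sub (memLp_const m)).integrable_sq
  have hvar : ∫ x, (x - m) ^ 2 ∂gaussianReal m V = V := by
    have h := variance_fun_id_gaussianReal (μ := m) (v := V)
    rw [variance_eq_integral measurable_id'.aemeasurable] at h
    simpa [integral_id_gaussianReal] using h
  have h1 : (fun x : ℝ => (d - x) ^ 2) =
      fun x => (d - m) ^ 2 + (-2 * (d - m)) * (x - m) + (x - m) ^ 2 := by
    funext x; ring
  have hi4 : Integrable (fun x : ℝ => (-2 * (d - m)) * (x - m)) (gaussianReal m V) :=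
    (hi1.sub (integrable_const m)).const_mul _
  have hi3 : Integrable (fun x : ℝ => (d - m) ^ 2 + (-2 * (d - m)) * (x - m))
      (gaussianReal m V) :=
    (integrable_const _).add hi4
  rw [← ofReal_integral_eq_lintegral_ofReal (by rw [h1]; exact hi3.add hi2)
    (Filter.Eventually.of_forall fun x => sq_nonneg _), h1, integral_add hi3 hi2, hvar,
    integral_add (integrable_const _) hi4, integral_const_mul,
    integral_sub hi1 (integrable_const m), integral_id_gaussianReal]
  simp

/-- The posterior variance bounds the posterior risk from below. -/
lemma lintegral_sq_tilt_ge {L : ℝ≥0} (hL : L ≠ 0) {a : ℝ} (ha : 0 ≤ a) (b d : ℝ) :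
    ENNReal.ofReal (1 / (1 / L + a)) *
        ∫⁻ x, ENNReal.ofReal (Real.exp (b * x - a * x ^ 2 / 2)) ∂gaussianReal 0 L ≤
      ∫⁻ x, ENNReal.ofReal (Real.exp (b * x - a * x ^ 2 / 2)) *
        ENNReal.ofReal ((d - x) ^ 2) ∂gaussianReal 0 L := by
  obtain ⟨C, hC⟩ := gaussianReal_withDensity_tilt hL ha b
  have hm : Measurable fun x : ℝ => ENNReal.ofReal (Real.exp (b * x - a * x ^ 2 / 2)) := by
    fun_prop
  have h1 : ∫⁻ x, ENNReal.ofReal (Real.exp (b * x - a * x ^ 2 / 2)) ∂gaussianReal 0 L = C := by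
    rw [← setLIntegral_univ, ← withDensity_apply _ MeasurableSet.univ, hC]
    simp
  have h2 := lintegral_withDensity_eq_lintegral_mul (gaussianReal 0 L) hm
    (g := fun x => ENNReal.ofReal ((d - x) ^ 2)) (by fun_prop)
  simp only [Pi.mul_apply] at h2
  rw [h1, ← h2, hC, lintegral_smul_measure, lintegral_sq_sub_gaussianReal, smul_eq_mul, mul_comm]
  gcongr
  have : (0 : ℝ) ≤ 1 / (1 / L + a) := by positivity
  rw [Real.coe_toNNReal _ this]
  -- The discarded term is the squared distance from `d` to the posterior mean.
  nlinarith [sq_nonneg (d - b * (1 / (1 / (L : ℝ) + a)))]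

/-- A lower bound for Bayes risks: `Q` is the law of the observation at parameter `0`, and the law
at `x` has density `exp (b x - a x² / 2)` with respect to it. -/
lemma bayes_risk_ge {Ω : Type*} [MeasurableSpace Ω] (Q : Measure Ω) [SFinite Q] {L : ℝ≥0}
    (hL : L ≠ 0) {a b δ : Ω → ℝ} (ha : Measurable a) (hb : Measurable b) (hδ : Measurable δ)
    (ha0 : ∀ ω, 0 ≤ a ω) :
    ∫⁻ x, ∫⁻ ω, ENNReal.ofReal (Real.exp (b ω * x - a ω * x ^ 2 / 2)) *
        ENNReal.ofReal (1 / (1 / L + a ω)) ∂Q ∂gaussianReal 0 L ≤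
      ∫⁻ x, ∫⁻ ω, ENNReal.ofReal (Real.exp (b ω * x - a ω * x ^ 2 / 2)) *
        ENNReal.ofReal ((δ ω - x) ^ 2) ∂Q ∂gaussianReal 0 L := by
  -- With the order exchanged, the parameter is averaged first and the posterior bound applies at
  -- each observation separately.
  rw [lintegral_lintegral_swap (μ := gaussianReal 0 L) (ν := Q),
    lintegral_lintegral_swap (μ := gaussianReal 0 L) (ν := Q)]
  rotate_left
  · exact Measurable.aemeasurable (by fun_prop)
  · exact Measurable.aemeasurable (by fun_prop)
  refine lintegral_mono fun ω => ?_
  rw [lintegral_mul_const _ (by fun_prop), mul_comm]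
  exact lintegral_sq_tilt_ge hL (ha0 ω) (b ω) (δ ω)

/-- Bounding a supremum over the reals from below by a Gaussian average. -/
lemma lintegral_gaussianReal_le_iSup (f : ℝ → ℝ≥0∞) (L : ℝ≥0) :
    ∫⁻ x, f x ∂gaussianReal 0 L ≤ ⨆ x, f x := by
  calc ∫⁻ x, f x ∂gaussianReal 0 L ≤ ∫⁻ _, (⨆ x, f x) ∂gaussianReal 0 L :=
        lintegral_mono fun x => le_iSup f x
    _ = _ := by simp

/-! ### Gaussian datasets -/

/-- The law of a dataset of `n` independent points from `N(μ, v)`. -/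
def gaussData (μ : ℝ) (v : ℝ≥0) (n : ℕ) : Measure Dataset :=
  (Measure.pi fun _ : Fin n => gaussianReal μ v).map (Sigma.mk n)

instance (μ : ℝ) (v : ℝ≥0) (n : ℕ) : IsProbabilityMeasure (gaussData μ v n) :=
  Measure.isProbabilityMeasure_map (Dataset.measurable_mk n).aemeasurable

lemma sampleLaw_eq_gaussData (μ σ : ℝ) (n : ℕ) :
    sampleLaw μ σ n = gaussData μ (Real.toNNReal (σ ^ 2)) n := rfl

instance (μ σ : ℝ) (n : ℕ) : IsProbabilityMeasure (sampleLaw μ σ n) := by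
  rw [sampleLaw_eq_gaussData]; infer_instance

lemma lintegral_gaussData (μ : ℝ) (v : ℝ≥0) (n : ℕ) {F : Dataset → ℝ≥0∞} (hF : Measurable F) :
    ∫⁻ d, F d ∂gaussData μ v n =
      ∫⁻ x : Fin n → ℝ, F ⟨n, x⟩ ∂Measure.pi fun _ => gaussianReal μ v :=
  lintegral_map hF (Dataset.measurable_mk n)

/-- The likelihood ratio of a Gaussian dataset with mean `μ` to one with mean `0`. -/
def likelihood (v : ℝ) (n : ℕ) (d : Dataset) (μ : ℝ) : ℝ≥0∞ :=
  ENNReal.ofReal (Real.exp (d.total / v * μ - n / v * μ ^ 2 / 2))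

lemma measurable_likelihood (v : ℝ) (n : ℕ) :
    Measurable fun p : Dataset × ℝ => likelihood v n p.1 p.2 := by
  have h := Dataset.measurable_total
  unfold likelihood
  fun_prop

lemma measurable_likelihood_left (v : ℝ) (n : ℕ) (μ : ℝ) :
    Measurable fun d => likelihood v n d μ := by
  have h := Dataset.measurable_total
  unfold likelihood
  fun_prop

lemma pi_gaussianReal_eq_withDensity (μ : ℝ) {v : ℝ≥0} (hv : v ≠ 0) (n : ℕ) :
    Measure.pi (fun _ : Fin n => gaussianReal μ v) =
      (Measure.pi fun _ : Fin n => gaussianReal 0 v).withDensity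
        fun x => likelihood v n ⟨n, x⟩ μ := by
  have hden := gaussianReal_eq_withDensity_center μ hv
  have hp : IsProbabilityMeasure ((gaussianReal 0 v).withDensity
      fun x => ENNReal.ofReal (Real.exp (μ * x / v - μ ^ 2 / (2 * v)))) := by
    rw [← hden]; infer_instance
  rw [hden, pi_withDensity (fun _ : Fin n => gaussianReal 0 v)
    (fun _ x => ENNReal.ofReal (Real.exp (μ * x / v - μ ^ 2 / (2 * v))))
    fun _ => by fun_prop]
  congr 1
  funext x
  rw [← ENNReal.ofReal_prod_of_nonneg fun _ _ => by positivity, ← Real.exp_sum, likelihood,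
    Finset.sum_sub_distrib, ← Finset.sum_div, ← Finset.mul_sum]
  simp only [Dataset.total, Finset.sum_const, Finset.card_univ, Fintype.card_fin, nsmul_eq_mul]
  congr 2
  have hv' : (v : ℝ) ≠ 0 := by exact_mod_cast hv
  field_simp

lemma lintegral_gaussData_eq (μ : ℝ) {v : ℝ≥0} (hv : v ≠ 0) (n : ℕ) {F : Dataset → ℝ≥0∞}
    (hF : Measurable F) :
    ∫⁻ d, F d ∂gaussData μ v n = ∫⁻ d, likelihood v n d μ * F d ∂gaussData 0 v n := by
  have hl := measurable_likelihood_left v n μ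
  rw [lintegral_gaussData μ v n hF,
    lintegral_gaussData 0 v n (F := fun d => likelihood v n d μ * F d) (hl.mul hF),
    pi_gaussianReal_eq_withDensity μ hv]
  exact lintegral_withDensity_eq_lintegral_mul _ (hl.comp (Dataset.measurable_mk n))
    (hF.comp (Dataset.measurable_mk n))

lemma map_sum_pi_gaussianReal (μ : ℝ) (v : ℝ≥0) (n : ℕ) :
    (Measure.pi fun _ : Fin n => gaussianReal μ v).map (fun x => ∑ j, x j) =
      gaussianReal (n * μ) (n * v) := by
  induction n with
  | zero =>
    simp only [Finset.univ_eq_empty, Finset.sum_empty, Measure.map_const, measure_univ, one_smul]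
    simp
  | succ n ih =>
    have h := measurePreserving_piFinSuccAbove (fun _ : Fin (n + 1) => gaussianReal μ v) 0
    have h1 : (fun x : Fin (n + 1) → ℝ => ∑ j, x j) =
        (fun p : ℝ × ℝ => p.1 + p.2) ∘ (Prod.map id fun y : Fin n → ℝ => ∑ j, y j) ∘
          MeasurableEquiv.piFinSuccAbove (fun _ => ℝ) 0 := by
      funext x
      simp [Fin.sum_univ_succ, MeasurableEquiv.piFinSuccAbove, Fin.insertNthEquiv, Fin.tail]
    have hs : Measurable fun y : Fin n → ℝ => ∑ j, y j := by fun_prop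
    rw [h1, ← Measure.map_map (by fun_prop) (by fun_prop),
      ← Measure.map_map (measurable_id.prodMap hs) (by fun_prop), h.map_eq,
      ← Measure.map_prod_map _ _ measurable_id hs, Measure.map_id, ih]
    have h2 := gaussianReal_conv_gaussianReal (m₁ := μ) (m₂ := n * μ) (v₁ := v) (v₂ := n * v)
    rw [Measure.conv] at h2
    rw [h2]
    push_cast
    congr 1 <;> ring

lemma lintegral_total_gaussData (μ : ℝ) (v : ℝ≥0) (n : ℕ) {F : ℝ → ℝ≥0∞} (hF : Measurable F) :
    ∫⁻ d, F d.total ∂gaussData μ v n = ∫⁻ x, F x ∂gaussianReal (n * μ) (n * v) := by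
  rw [lintegral_gaussData μ v n (F := fun d => F d.total) (hF.comp Dataset.measurable_total),
    ← map_sum_pi_gaussianReal, lintegral_map hF (by fun_prop)]
  rfl

lemma ae_size_gaussData (μ : ℝ) (v : ℝ≥0) (n : ℕ) : ∀ᵐ d ∂gaussData μ v n, d.size = n := by
  have hm : MeasurableSet {d : Dataset | d.size = n} :=
    Dataset.measurable_size (measurableSet_singleton n)
  rw [gaussData, ae_map_iff (Dataset.measurable_mk n).aemeasurable hm]
  exact Filter.Eventually.of_forall fun x => rfl

lemma lintegral_mean_gaussData (μ : ℝ) (v : ℝ≥0) {n : ℕ} (hn : n ≠ 0) {F : ℝ → ℝ≥0∞}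
    (hF : Measurable F) :
    ∫⁻ d, F d.mean ∂gaussData μ v n = ∫⁻ x, F x ∂gaussianReal μ (v / n) := by
  have h1 : ∫⁻ d, F d.mean ∂gaussData μ v n = ∫⁻ d, F (d.total / n) ∂gaussData μ v n := by
    refine lintegral_congr_ae ?_
    filter_upwards [ae_size_gaussData μ v n] with d hd
    rw [Dataset.mean, hd]
  have hn' : (n : ℝ) ≠ 0 := by exact_mod_cast hn
  rw [h1, lintegral_total_gaussData μ v n (F := fun x => F (x / n)) (by fun_prop),
    ← lintegral_map (f := F) (g := fun x : ℝ => x / n) hF (by fun_prop),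
    gaussianReal_map_div_const]
  congr 2
  · field_simp
  · ext
    simp only [NNReal.coe_div, NNReal.coe_mul, NNReal.coe_natCast, NNReal.coe_mk]
    field_simp

lemma measurable_gaussData {Ω : Type*} [MeasurableSpace Ω] {μ : Ω → ℝ} {v : Ω → ℝ≥0}
    (hμ : Measurable μ) (hv : Measurable v) (n : ℕ) :
    Measurable fun ω => gaussData (μ ω) (v ω) n := by
  have h := measurable_pi_measure (fun (_ : Fin n) ω => gaussianReal (μ ω) (v ω))
    fun _ => measurable_gaussianReal.comp (hμ.prodMk hv)
  exact (Measure.measurable_map _ (Dataset.measurable_mk n)).comp h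

/-! ### Independent sums -/

lemma map_add_pi_prod_pi {ι : Type*} [Fintype ι] (α β : ι → Measure ℝ)
    [∀ i, IsProbabilityMeasure (α i)] [∀ i, IsProbabilityMeasure (β i)] :
    ((Measure.pi α).prod (Measure.pi β)).map (fun p => p.1 + p.2) =
      Measure.pi fun i => (α i).conv (β i) := by
  refine (Measure.pi_eq fun s hs => ?_).symm
  have hadd : Measurable fun p : (ι → ℝ) × (ι → ℝ) => p.1 + p.2 := by fun_prop
  rw [Measure.map_apply hadd (MeasurableSet.univ_pi hs),
    Measure.prod_apply (hadd (MeasurableSet.univ_pi hs))]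
  have h1 : ∀ x : ι → ℝ, Measure.pi β (Prod.mk x ⁻¹' ((fun p : (ι → ℝ) × (ι → ℝ) =>
      p.1 + p.2) ⁻¹' Set.univ.pi s)) = ∏ i, β i ((fun y => x i + y) ⁻¹' s i) := by
    intro x
    rw [← Measure.pi_pi]
    congr 1
  simp only [h1]
  have hm : ∀ i, MeasurableSet ((fun p : ℝ × ℝ => p.1 + p.2) ⁻¹' s i) := fun i =>
    (by fun_prop : Measurable fun p : ℝ × ℝ => p.1 + p.2) (hs i)
  rw [lintegral_pi_prod α (fun i x => β i ((fun y => x + y) ⁻¹' s i))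
    fun i => measurable_measure_prodMk_left (hm i)]
  refine Finset.prod_congr rfl fun i _ => ?_
  rw [Measure.conv, Measure.map_apply (by fun_prop) (hs i), Measure.prod_apply (hm i)]
  rfl

/-- Adding independent centered Gaussian noise to Gaussian data. -/
lemma lintegral_gaussian_add_noise (μ : ℝ) (v w : ℝ≥0) (n : ℕ) {F : Dataset → ℝ≥0∞}
    (hF : Measurable F) :
    ∫⁻ r : Fin n → ℝ, ∫⁻ ε : Fin n → ℝ, F ⟨n, r + ε⟩ ∂(Measure.pi fun _ => gaussianReal 0 w)
      ∂(Measure.pi fun _ => gaussianReal μ v) = ∫⁻ d, F d ∂gaussData μ (v + w) n := by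
  have hm : Measurable fun x : Fin n → ℝ => F ⟨n, x⟩ := hF.comp (Dataset.measurable_mk n)
  have hm2 : Measurable fun p : (Fin n → ℝ) × (Fin n → ℝ) => F ⟨n, p.1 + p.2⟩ :=
    hm.comp (by fun_prop : Measurable fun p : (Fin n → ℝ) × (Fin n → ℝ) => p.1 + p.2)
  have h := map_add_pi_prod_pi (fun _ : Fin n => gaussianReal μ v) fun _ => gaussianReal 0 w
  simp only [gaussianReal_conv_gaussianReal, add_zero] at h
  rw [lintegral_gaussData _ _ _ hF, ← h, lintegral_map hm (by fun_prop),
    lintegral_prod _ hm2.aemeasurable]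

/-! ### A rearrangement inequality -/

/-- A function that increases with the distance to the origin has the smallest mean under the
centered Gaussian law. -/
lemma lintegral_gaussianReal_center_le {φ : ℝ → ℝ≥0∞} (hφ : Measurable φ)
    (hmono : ∀ x y, |x| ≤ |y| → φ x ≤ φ y) (m : ℝ) (V : ℝ≥0) :
    ∫⁻ x, φ x ∂gaussianReal 0 V ≤ ∫⁻ x, φ x ∂gaussianReal m V := by
  by_cases hV : V = 0
  · subst hV
    simp only [gaussianReal_zero_var]
    rw [lintegral_dirac' _ hφ, lintegral_dirac' _ hφ]
    exact hmono _ _ (by simp)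
  have hg : Measurable (gaussianPDF 0 V) := measurable_gaussianPDF _ _
  have hdens : ∀ ψ : ℝ → ℝ≥0∞, Measurable ψ →
      ∫⁻ x, ψ x ∂gaussianReal 0 V = ∫⁻ x, gaussianPDF 0 V x * ψ x := by
    intro ψ hψ
    rw [gaussianReal_of_var_ne_zero _ hV, lintegral_withDensity_eq_lintegral_mul _ hg hψ]
    rfl
  have hsub : ∀ ψ : ℝ → ℝ≥0∞, Measurable ψ → ∫⁻ x, ψ (m - x) = ∫⁻ x, ψ x := fun ψ hψ =>
    (Measure.measurePreserving_sub_left volume m).lintegral_comp hψ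
  have h1 : ∫⁻ x, φ x ∂gaussianReal m V = ∫⁻ x, gaussianPDF 0 V x * φ (m - x) := by
    have h := gaussianReal_map_const_sub (μ := 0) (v := V) m
    rw [sub_zero] at h
    rw [← h, lintegral_map hφ (by fun_prop), hdens (fun x => φ (m - x)) (by fun_prop)]
  have h2 : ∫⁻ x, gaussianPDF 0 V x * φ (m - x) = ∫⁻ x, gaussianPDF 0 V (m - x) * φ x := by
    rw [← hsub _ (by fun_prop)]
    simp
  have h3 : ∫⁻ x, gaussianPDF 0 V x * φ x = ∫⁻ x, gaussianPDF 0 V (m - x) * φ (m - x) :=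
    (hsub (fun x => gaussianPDF 0 V x * φ x) (by fun_prop)).symm
  have hpdf : ∀ x y : ℝ, |x| ≤ |y| → gaussianPDF 0 V y ≤ gaussianPDF 0 V x := by
    intro x y hxy
    simp only [gaussianPDF, gaussianPDFReal, sub_zero]
    gcongr ENNReal.ofReal (_ * Real.exp (-?_ / _))
    exact sq_le_sq.2 hxy
  -- The rearrangement inequality for two pairs; there is no subtraction, so the differences are
  -- named and the product of the two is dropped.
  have key : ∀ {a b c d : ℝ≥0∞}, a ≤ b → c ≤ d → b * c + a * d ≤ b * d + a * c := by
    intro a b c d hab hcd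
    obtain ⟨b', rfl⟩ := exists_add_of_le hab
    obtain ⟨d', rfl⟩ := exists_add_of_le hcd
    have : (a + b') * (c + d') + a * c = (a + b') * c + a * (c + d') + b' * d' := by ring
    rw [this]
    exact le_self_add
  -- Of the two points x and m − x the one nearer to 0 has the larger density and the smaller φ, so
  -- matching density and φ at the same point gives the smaller sum. Integrating over x counts each
  -- side of the claim twice, by the reflection x ↦ m − x.
  have hpt : ∀ x : ℝ, gaussianPDF 0 V x * φ x + gaussianPDF 0 V (m - x) * φ (m - x) ≤
      gaussianPDF 0 V x * φ (m - x) + gaussianPDF 0 V (m - x) * φ x := by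
    intro x
    rcases le_total |x| |m - x| with h | h
    · exact key (hpdf _ _ h) (hmono _ _ h)
    · have := key (hpdf _ _ h) (hmono _ _ h)
      rw [add_comm, add_comm (gaussianPDF 0 V x * _)]
      exact this
  have hsum : ∫⁻ x, φ x ∂gaussianReal 0 V + ∫⁻ x, φ x ∂gaussianReal 0 V ≤
      ∫⁻ x, φ x ∂gaussianReal m V + ∫⁻ x, φ x ∂gaussianReal m V := by
    calc _ = ∫⁻ x, (gaussianPDF 0 V x * φ x + gaussianPDF 0 V (m - x) * φ (m - x)) := by
          rw [lintegral_add_left (by fun_prop), ← h3, hdens φ hφ]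
      _ ≤ ∫⁻ x, (gaussianPDF 0 V x * φ (m - x) + gaussianPDF 0 V (m - x) * φ x) :=
          lintegral_mono hpt
      _ = _ := by rw [lintegral_add_left (by fun_prop), ← h2, h1]
  rw [← two_mul, ← two_mul] at hsum
  exact (ENNReal.mul_le_mul_iff_right (by simp) (by simp)).1 hsum

/-! ### The minimax risk of Gaussian location experiments -/

/-- If the law at parameter `μ` has density `exp (b μ - a μ² / 2)` with respect to the law at `0`,
then the minimax risk is at least `1 / (1 / L + a)` for every `L`. -/
lemma minimax_risk_ge {Ω : Type*} [MeasurableSpace Ω] {P : ℝ → Measure Ω}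
    [∀ μ, IsProbabilityMeasure (P μ)] {a : ℝ} (ha : 0 ≤ a) {b δ : Ω → ℝ} (hb : Measurable b)
    (hδ : Measurable δ)
    (hP : ∀ μ, ∀ F : Ω → ℝ≥0∞, Measurable F → ∫⁻ ω, F ω ∂P μ =
      ∫⁻ ω, ENNReal.ofReal (Real.exp (b ω * μ - a * μ ^ 2 / 2)) * F ω ∂P 0)
    {L : ℝ≥0} (hL : L ≠ 0) :
    ENNReal.ofReal (1 / (1 / L + a)) ≤ ⨆ μ, ∫⁻ ω, ENNReal.ofReal ((δ ω - μ) ^ 2) ∂P μ := by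
  refine le_trans ?_ (lintegral_gaussianReal_le_iSup _ L)
  have h := bayes_risk_ge (P 0) hL (a := fun _ => a) measurable_const hb hδ fun _ => ha
  have h1 : ∀ μ, ∫⁻ ω, ENNReal.ofReal ((δ ω - μ) ^ 2) ∂P μ = ∫⁻ ω,
      ENNReal.ofReal (Real.exp (b ω * μ - a * μ ^ 2 / 2)) *
        ENNReal.ofReal ((δ ω - μ) ^ 2) ∂P 0 := fun μ => hP μ _ (by fun_prop)
  -- The posterior variance is the same for every observation, so its average is itself.
  have h2 : ∀ μ, ∫⁻ ω, ENNReal.ofReal (Real.exp (b ω * μ - a * μ ^ 2 / 2)) *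
        ENNReal.ofReal (1 / (1 / L + a)) ∂P 0 = ENNReal.ofReal (1 / (1 / L + a)) := by
    intro μ
    rw [← hP μ (fun _ => ENNReal.ofReal (1 / (1 / L + a))) measurable_const]
    simp
  simp only [h1]
  refine le_trans (le_of_eq ?_) h
  simp only [h2]
  simp

lemma tendsto_inv_add_atTop (a : ℝ) (ha : 0 < a) :
    Filter.Tendsto (fun j : ℕ => 1 / (1 / (j + 1 : ℝ) + a)) Filter.atTop (nhds (1 / a)) := by
  have h := (tendsto_one_div_add_atTop_nhds_zero_nat (𝕜 := ℝ)).add_const a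
  rw [zero_add] at h
  exact tendsto_const_nhds.div h ha.ne'

/-- A bound for all finite prior variances passes to the limit. -/
lemma ofReal_one_div_le_of_forall {R : ℝ≥0∞} {a : ℝ} (ha : 0 < a)
    (h : ∀ L : ℝ≥0, L ≠ 0 → ENNReal.ofReal (1 / (1 / L + a)) ≤ R) :
    ENNReal.ofReal (1 / a) ≤ R := by
  refine le_of_tendsto (ENNReal.tendsto_ofReal (tendsto_inv_add_atTop a ha))
    (Filter.Eventually.of_forall fun j => ?_)
  have := h (j + 1) (by positivity)
  simpa using this

/-- Without data the bound is the prior variance L, which is arbitrary. -/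
lemma eq_top_of_forall {R : ℝ≥0∞}
    (h : ∀ L : ℝ≥0, L ≠ 0 → ENNReal.ofReal (1 / (1 / L + 0)) ≤ R) : R = ⊤ := by
  refine ENNReal.eq_top_of_forall_nnreal_le fun r => ?_
  -- `r + 1` instead of `r`, because the prior variance must not vanish.
  have h1 := h (r + 1) (by positivity)
  refine le_trans ?_ h1
  rw [add_zero, one_div_one_div, ENNReal.ofReal_coe_nnreal]
  exact_mod_cast (le_add_of_nonneg_right zero_le_one : r ≤ r + 1)

lemma lintegral_pi_gaussData_eq {m : ℕ} (μ : ℝ) {v : ℝ≥0} (hv : v ≠ 0) (n : Fin m → ℕ)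
    {F : (Fin m → Dataset) → ℝ≥0∞} (hF : Measurable F) :
    ∫⁻ X, F X ∂(Measure.pi fun j => gaussData μ v (n j)) =
      ∫⁻ X, ENNReal.ofReal (Real.exp ((∑ j, (X j).total / v) * μ -
        (∑ j, n j : ℕ) / v * μ ^ 2 / 2)) * F X ∂(Measure.pi fun j => gaussData 0 v (n j)) := by
  have hl : ∀ j, Measurable fun d => likelihood v (n j) d μ := fun j =>
    measurable_likelihood_left v (n j) μ
  have hden : ∀ j, gaussData μ v (n j) =
      (gaussData 0 v (n j)).withDensity fun d => likelihood v (n j) d μ := by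
    intro j
    refine Measure.ext_of_lintegral _ fun f hf => ?_
    rw [lintegral_withDensity_eq_lintegral_mul _ (hl j) hf, lintegral_gaussData_eq μ hv _ hf]
    rfl
  have hp : ∀ j, IsProbabilityMeasure
      ((gaussData 0 v (n j)).withDensity fun d => likelihood v (n j) d μ) := by
    intro j; rw [← hden]; infer_instance
  have hprod : Measurable fun X : Fin m → Dataset => ∏ j, likelihood v (n j) (X j) μ :=
    Finset.measurable_prod _ fun j _ => (hl j).comp (measurable_pi_apply j)
  simp only [hden]
  rw [pi_withDensity _ _ hl, lintegral_withDensity_eq_lintegral_mul _ hprod hF]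
  refine lintegral_congr fun X => ?_
  simp only [Pi.mul_apply, likelihood]
  rw [← ENNReal.ofReal_prod_of_nonneg fun _ _ => by positivity, ← Real.exp_sum,
    Finset.sum_sub_distrib, ← Finset.sum_mul, ← Finset.sum_div, ← Finset.sum_div,
    ← Finset.sum_mul, ← Finset.sum_div, Nat.cast_sum]

/-- Whatever the mechanism and the strategies, an agent's maximum risk is at least that of the
sample mean of all collected data. -/
lemma risk_ge {σ : ℝ} (hσ : 0 < σ) {m : ℕ} (M : Mechanism.{u} m) (s : Fin m → Strategy M.Alloc)
    (i : Fin m) {L : ℝ≥0} (hL : L ≠ 0) :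
    ENNReal.ofReal (1 / (1 / L + (∑ j, (s j).n : ℕ) / σ ^ 2)) ≤
      ⨆ μ : ℝ, ∫⁻ X : Fin m → Dataset, ∫⁻ A : Fin m → M.Alloc,
        ENNReal.ofReal (((s i).estimate (X i) ((s i).submit (X i)) (A i) - μ) ^ 2)
        ∂(M.proc fun j => (s j).submit (X j)) ∂(Measure.pi fun j => sampleLaw μ σ (s j).n) := by
  have hsub : Measurable fun (X : Fin m → Dataset) j => (s j).submit (X j) :=
    measurable_pi_iff.2 fun j => (s j).measurable_submit.comp (measurable_pi_apply j)
  -- Submission followed by the mechanism is a kernel that does not involve μ, so the joint law of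
  -- data and allocations has the likelihood ratio of the data alone.
  let K : Kernel (Fin m → Dataset) (Fin m → M.Alloc) := M.proc.comap _ hsub
  have hv : Real.toNNReal (σ ^ 2) ≠ 0 := by simpa using hσ.ne'
  have hvv : (Real.toNNReal (σ ^ 2) : ℝ) = σ ^ 2 := Real.coe_toNNReal _ (sq_nonneg σ)
  let P : ℝ → Measure ((Fin m → Dataset) × (Fin m → M.Alloc)) := fun μ =>
    (Measure.pi fun j => gaussData μ (Real.toNNReal (σ ^ 2)) (s j).n) ⊗ₘ K
  let δ : (Fin m → Dataset) × (Fin m → M.Alloc) → ℝ := fun ω =>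
    (s i).estimate (ω.1 i) ((s i).submit (ω.1 i)) (ω.2 i)
  let b : (Fin m → Dataset) × (Fin m → M.Alloc) → ℝ := fun ω => ∑ j, (ω.1 j).total / σ ^ 2
  have hb : Measurable b := Finset.measurable_sum _ fun j _ => Measurable.div_const
    (Dataset.measurable_total.comp ((measurable_pi_apply j).comp measurable_fst)) _
  have hδ : Measurable δ := by
    have h1 : Measurable fun ω : (Fin m → Dataset) × (Fin m → M.Alloc) => ω.1 i :=
      (measurable_pi_apply i).comp measurable_fst
    exact (s i).measurable_estimate.comp
      (h1.prodMk (((s i).measurable_submit.comp h1).prodMk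
        ((measurable_pi_apply i).comp measurable_snd)))
  have h := minimax_risk_ge (P := P) (a := (∑ j, (s j).n : ℕ) / σ ^ 2) (by positivity) hb hδ
    ?_ hL
  · refine h.trans (iSup_mono fun μ => ?_)
    rw [Measure.lintegral_compProd (by fun_prop)]
    rfl
  · intro μ F hF
    rw [Measure.lintegral_compProd hF, Measure.lintegral_compProd (by fun_prop),
      lintegral_pi_gaussData_eq μ hv _ (hF.lintegral_kernel_prod_right' (κ := K))]
    refine lintegral_congr fun X => ?_
    rw [← lintegral_const_mul _ (by fun_prop), hvv]

lemma penalty_ge {σ c : ℝ} (hσ : 0 < σ) (hc : 0 ≤ c) {m : ℕ} (M : Mechanism.{u} m)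
    (s : Fin m → Strategy M.Alloc) (i : Fin m) (hN : 0 < ∑ j, (s j).n) :
    ENNReal.ofReal (σ ^ 2 / (∑ j, (s j).n : ℕ) + c * (s i).n) ≤ penalty σ c M s i := by
  have hN' : (0 : ℝ) < (∑ j, (s j).n : ℕ) := by exact_mod_cast hN
  rw [ENNReal.ofReal_add (by positivity) (by positivity), penalty]
  gcongr
  have h := ofReal_one_div_le_of_forall (by positivity)
    fun (L : ℝ≥0) (hL : L ≠ 0) => risk_ge hσ M s i hL
  rwa [one_div_div] at h

lemma penalty_eq_top {σ c : ℝ} (hσ : 0 < σ) {m : ℕ} (M : Mechanism.{u} m)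
    (s : Fin m → Strategy M.Alloc) (i : Fin m) (hN : ∑ j, (s j).n = 0) :
    penalty σ c M s i = ⊤ := by
  have h := eq_top_of_forall fun (L : ℝ≥0) (hL : L ≠ 0) => by
    have h := risk_ge hσ M s i hL
    rwa [hN, Nat.cast_zero, zero_div] at h
  rw [penalty, h, top_add]

lemma two_mul_sqrt_mul_le {a b x : ℝ} (ha : 0 ≤ a) (hb : 0 ≤ b) (hx : 0 < x) :
    2 * (√a * √b) ≤ a / x + b * x := by
  have h1 : a / x + b * x = (√a ^ 2 + (√b * x) ^ 2) / x := by
    rw [mul_pow, Real.sq_sqrt ha, Real.sq_sqrt hb]; field_simp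
  rw [h1, le_div_iff₀ hx]
  nlinarith [sq_nonneg (√a - √b * x)]

/-- With N points in total, the sum of the individual bounds is mσ²/N + cN, and AM-GM applies. If N
= 0, a single infinite penalty suffices. -/
lemma minSocialPenalty_ge {σ c : ℝ} (hσ : 0 < σ) (hc : 0 ≤ c) {m : ℕ} (hm : 0 < m) :
    ENNReal.ofReal (2 * (σ * √(c * m))) ≤ minSocialPenalty.{u} σ c m := by
  refine le_iInf fun M => le_iInf fun s => ?_
  rcases Nat.eq_zero_or_pos (∑ j, (s j).n) with hN | hN
  · have h : penalty σ c M s ⟨0, hm⟩ ≤ socialPenalty σ c M s :=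
      Finset.single_le_sum (f := fun i => penalty σ c M s i) (fun _ _ => zero_le)
        (Finset.mem_univ _)
    rw [penalty_eq_top hσ M s _ hN, top_le_iff] at h
    rw [h]
    exact le_top
  · have hN' : (0 : ℝ) < (∑ j, (s j).n : ℕ) := by exact_mod_cast hN
    calc ENNReal.ofReal (2 * (σ * √(c * m)))
        ≤ ENNReal.ofReal (∑ i, (σ ^ 2 / (∑ j, (s j).n : ℕ) + c * (s i).n)) := by
          refine ENNReal.ofReal_le_ofReal ?_
          have h := two_mul_sqrt_mul_le (a := m * σ ^ 2) (b := c) (by positivity) hc hN'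
          rw [Finset.sum_add_distrib, ← Finset.mul_sum, Finset.sum_const, Finset.card_univ,
            Fintype.card_fin, nsmul_eq_mul, ← Nat.cast_sum]
          rw [Real.sqrt_mul (by positivity), Real.sqrt_sq hσ.le] at h
          rw [Real.sqrt_mul hc]
          calc _ = 2 * (√m * σ * √c) := by ring
            _ ≤ _ := h
            _ = _ := by ring
      _ = ∑ i, ENNReal.ofReal (σ ^ 2 / (∑ j, (s j).n : ℕ) + c * (s i).n) :=
          ENNReal.ofReal_sum_of_nonneg fun i _ => by positivity
      _ ≤ _ := Finset.sum_le_sum fun i _ => penalty_ge hσ hc M s i hN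

lemma soloPenalty_ge {σ c : ℝ} (hσ : 0 < σ) (hc : 0 ≤ c) :
    ENNReal.ofReal (2 * (σ * √c)) ≤ soloPenalty σ c := by
  have hv : Real.toNNReal (σ ^ 2) ≠ 0 := by simpa using hσ.ne'
  have hvv : (Real.toNNReal (σ ^ 2) : ℝ) = σ ^ 2 := Real.coe_toNNReal _ (sq_nonneg σ)
  refine le_iInf fun n => le_iInf fun h => le_iInf fun hh => ?_
  have hrisk : ∀ L : ℝ≥0, L ≠ 0 → ENNReal.ofReal (1 / (1 / L + n / σ ^ 2)) ≤
      ⨆ μ : ℝ, ∫⁻ X, ENNReal.ofReal ((h X - μ) ^ 2) ∂sampleLaw μ σ n := by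
    intro L hL
    refine minimax_risk_ge (P := fun μ => sampleLaw μ σ n) (b := fun d => d.total / σ ^ 2)
      (by positivity) (Dataset.measurable_total.div_const _) hh (fun μ F hF => ?_) hL
    simp only [sampleLaw_eq_gaussData]
    rw [lintegral_gaussData_eq μ hv n hF, hvv]
    rfl
  rcases Nat.eq_zero_or_pos n with hn | hn
  · subst hn
    have h := eq_top_of_forall fun (L : ℝ≥0) (hL : L ≠ 0) => by
      have h := hrisk L hL
      rwa [Nat.cast_zero, zero_div] at h
    rw [h, top_add]
    exact le_top
  · have hn' : (0 : ℝ) < n := by exact_mod_cast hn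
    have h1 := ofReal_one_div_le_of_forall (by positivity) hrisk
    rw [one_div_div] at h1
    refine le_trans ?_ (add_le_add_left h1 _)
    rw [← ENNReal.ofReal_add (by positivity) (by positivity)]
    refine ENNReal.ofReal_le_ofReal ?_
    have h := two_mul_sqrt_mul_le (a := σ ^ 2) (b := c) (by positivity) hc hn'
    rwa [Real.sqrt_sq hσ.le] at h

/-! ### Pooled Gaussian data -/

lemma map_concat_pi_gaussData {m : ℕ} (μ : ℝ) (v : ℝ≥0) (n : Fin m → ℕ) :
    (Measure.pi fun j => gaussData μ v (n j)).map Dataset.concat =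
      gaussData μ v (∑ j, n j) := by
  have hmk : ∀ j, Measurable fun x : Fin (n j) → ℝ => (⟨n j, x⟩ : Dataset) := fun j =>
    Dataset.measurable_mk (n j)
  have h1 : (Measure.pi fun j => gaussData μ v (n j)) =
      (Measure.pi fun j => Measure.pi fun _ : Fin (n j) => gaussianReal μ v).map
        fun x j => (⟨n j, x j⟩ : Dataset) :=
    (Measure.pi_map_pi fun j => (hmk j).aemeasurable).symm
  let R : (∀ j, Fin (n j) → ℝ) → Fin (∑ j, n j) → ℝ := fun x k =>
    x (finSigmaFinEquiv.symm k).1 (finSigmaFinEquiv.symm k).2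
  have hR : Measurable R := by
    refine measurable_pi_iff.2 fun k => ?_
    exact (measurable_pi_apply _).comp (measurable_pi_apply _)
  have h2 : (Measure.pi fun _ : Fin (∑ j, n j) => gaussianReal μ v) =
      (Measure.pi fun j => Measure.pi fun _ : Fin (n j) => gaussianReal μ v).map R := by
    refine Measure.pi_eq fun s hs => ?_
    rw [Measure.map_apply hR (MeasurableSet.univ_pi hs)]
    have h3 : R ⁻¹' Set.univ.pi s = Set.univ.pi fun j => Set.univ.pi fun l : Fin (n j) =>
        s (finSigmaFinEquiv ⟨j, l⟩) := by
      ext x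
      simp only [Set.mem_preimage, Set.mem_pi, Set.mem_univ, true_implies, R]
      constructor
      · intro h j l
        have := h (finSigmaFinEquiv ⟨j, l⟩)
        rwa [Equiv.symm_apply_apply] at this
      · intro h k
        have := h (finSigmaFinEquiv.symm k).1 (finSigmaFinEquiv.symm k).2
        rwa [Sigma.eta, Equiv.apply_symm_apply] at this
    rw [h3]
    simp only [Measure.pi_pi]
    rw [← Fintype.prod_sigma' (fun j (l : Fin (n j)) =>
      gaussianReal μ v (s (finSigmaFinEquiv ⟨j, l⟩)))]
    exact Equiv.prod_comp finSigmaFinEquiv fun k => gaussianReal μ v (s k)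
  have hpi : Measurable fun (x : ∀ j, Fin (n j) → ℝ) j => (⟨n j, x j⟩ : Dataset) :=
    measurable_pi_iff.2 fun j => (hmk j).comp (measurable_pi_apply j)
  rw [h1, gaussData, h2, Measure.map_map Dataset.measurable_concat hpi,
    Measure.map_map (Dataset.measurable_mk _) hR]
  rfl

lemma gaussData_zero (μ : ℝ) (v : ℝ≥0) : gaussData μ v 0 = Measure.dirac Dataset.empty := by
  rw [gaussData, Measure.pi_of_empty (x := Fin.elim0), Measure.map_dirac' (Dataset.measurable_mk 0)]
  rfl

/-- Replacing the agent's dataset by the empty one acts coordinate by coordinate, so the law remains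
a product, with size 0 in coordinate `i`; pooling then adds the sizes. -/
lemma map_others_pi_gaussData {m : ℕ} (μ : ℝ) (v : ℝ≥0) (n : Fin m → ℕ) (i : Fin m) :
    (Measure.pi fun j => gaussData μ v (n j)).map (fun X => Dataset.others X i) =
      gaussData μ v (∑ j, Function.update n i 0 j) := by
  let f : Fin m → Dataset → Dataset := fun j d => if j = i then Dataset.empty else d
  have hf : ∀ j, Measurable (f j) := by
    intro j
    by_cases h : j = i
    · simp [f, h]
    · simpa [f, h] using measurable_id'
  have h1 : ∀ j, gaussData μ v (Function.update n i 0 j) = (gaussData μ v (n j)).map (f j) := by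
    intro j
    by_cases h : j = i
    · subst h
      simp [f, gaussData_zero, Measure.map_const]
    · have hid : f j = id := by funext d; simp [f, h]
      rw [hid, Measure.map_id, Function.update_of_ne h]
  have hp : ∀ j, IsProbabilityMeasure ((gaussData μ v (n j)).map (f j)) := by
    intro j; rw [← h1]; infer_instance
  have h2 : (fun X : Fin m → Dataset => Dataset.others X i) =
      Dataset.concat ∘ fun X j => f j (X j) := by
    funext X
    simp only [Function.comp, Dataset.others]
    congr 1
    funext j
    by_cases h : j = i
    · subst h; simp [f]
    · simp [f, h]
  have hfm : Measurable fun (X : Fin m → Dataset) j => f j (X j) :=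
    measurable_pi_iff.2 fun j => (hf j).comp (measurable_pi_apply j)
  rw [h2, ← Measure.map_map Dataset.measurable_concat hfm,
    Measure.pi_map_pi fun j => (hf j).aemeasurable]
  simp only [← h1]
  exact map_concat_pi_gaussData μ v _

lemma measurable_update_pair {m : ℕ} {E : Type*} [MeasurableSpace E] (i : Fin m) :
    Measurable fun p : E × (Fin m → E) => Function.update p.2 i p.1 := by
  refine measurable_pi_iff.2 fun j => ?_
  by_cases h : j = i
  · subst h; simpa using measurable_fst
  · simp only [Function.update_of_ne h]
    exact (measurable_pi_apply j).comp measurable_snd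

/-- Resampling one coordinate of a product measure. -/
lemma map_update_prod_pi {m : ℕ} {E : Type*} [MeasurableSpace E] (ν : Fin m → Measure E)
    [∀ j, IsProbabilityMeasure (ν j)] (i : Fin m) :
    ((ν i).prod (Measure.pi ν)).map (fun p => Function.update p.2 i p.1) = Measure.pi ν := by
  have hm := measurable_update_pair (E := E) i
  refine (Measure.pi_eq fun s hs => ?_).symm
  rw [Measure.map_apply hm (MeasurableSet.univ_pi hs)]
  have h1 : (fun p : E × (Fin m → E) => Function.update p.2 i p.1) ⁻¹' Set.univ.pi s =
      s i ×ˢ Set.univ.pi (Function.update s i Set.univ) := by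
    ext ⟨a, y⟩
    simp only [Set.mem_preimage, Set.mem_pi, Set.mem_univ, true_implies, Set.mem_prod]
    constructor
    · intro h
      refine ⟨by simpa using h i, fun j => ?_⟩
      by_cases hj : j = i
      · subst hj; simp
      · simpa [hj] using h j
    · rintro ⟨h, h'⟩ j
      by_cases hj : j = i
      · subst hj; simpa using h
      · simpa [hj] using h' j
  rw [h1, Measure.prod_prod, Measure.pi_pi, ← Finset.mul_prod_erase _ _ (Finset.mem_univ i),
    ← Finset.mul_prod_erase Finset.univ (fun j => ν j (s j)) (Finset.mem_univ i)]
  simp only [Function.update_self, measure_univ, one_mul]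
  congr 1
  refine Finset.prod_congr rfl fun j hj => ?_
  rw [Function.update_of_ne (Finset.ne_of_mem_erase hj)]

lemma others_congr {m : ℕ} {X Y : Fin m → Dataset} {i : Fin m} (h : ∀ j, j ≠ i → X j = Y j) :
    Dataset.others X i = Dataset.others Y i := by
  unfold Dataset.others
  congr 1
  funext j
  by_cases hj : j = i
  · subst hj; simp
  · simp [hj, h j hj]

/-- An agent's own data and the pooled data of the others are independent Gaussian datasets. -/
lemma lintegral_own_others {m : ℕ} (μ : ℝ) (v : ℝ≥0) (n : Fin m → ℕ) (i : Fin m)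
    {F : Dataset → Dataset → ℝ≥0∞} (hF : Measurable fun p : Dataset × Dataset => F p.1 p.2) :
    ∫⁻ X, F (X i) (Dataset.others X i) ∂(Measure.pi fun j => gaussData μ v (n j)) =
      ∫⁻ x, ∫⁻ y, F x y ∂gaussData μ v (∑ j, Function.update n i 0 j)
        ∂gaussData μ v (n i) := by
  have hm := measurable_update_pair (E := Dataset) i
  have hG : Measurable fun X : Fin m → Dataset => F (X i) (Dataset.others X i) :=
    hF.comp ((measurable_pi_apply i).prodMk (Dataset.measurable_others i))
  -- A fresh copy is placed in coordinate `i`. The pooled data of the others ignore that coordinate,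
  -- so the integral splits into two independent ones.
  rw [← map_update_prod_pi (fun j => gaussData μ v (n j)) i, lintegral_map hG hm]
  refine (lintegral_prod _ (hG.comp hm).aemeasurable).trans ?_
  refine lintegral_congr fun x => ?_
  have hFx : Measurable (F x) := hF.comp (measurable_prodMk_left (x := x))
  rw [← map_others_pi_gaussData, lintegral_map hFx (Dataset.measurable_others i)]
  refine lintegral_congr fun y => ?_
  simp only [Function.comp, Function.update_self]
  congr 1
  exact others_congr fun j hj => Function.update_of_ne hj _ _

/-! ### Sampling and corruption -/

/-- A permutation only relabels i.i.d. coordinates, so for every fixed `π` the drawn points and the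
remaining ones are independent i.i.d. blocks. -/
lemma map_split_pi (ν : Measure ℝ) [IsProbabilityMeasure ν] (k n : ℕ) (π : Equiv.Perm (Fin n)) :
    (Measure.pi fun _ : Fin n => ν).map (fun pool =>
      ((fun j : Fin (min n k) => pool (π (Fin.castLE (min_le_left _ _) j))),
        restPart k pool π)) =
      (Measure.pi fun _ : Fin (min n k) => ν).prod (Measure.pi fun _ : Fin (n - min n k) => ν) := by
  let e : Fin (min n k) ⊕ Fin (n - min n k) ≃ Fin n :=
    (finSumFinEquiv.trans (finCongr (by omega))).trans π
  have h1 := (measurePreserving_piCongrLeft (α := fun _ : Fin n => ℝ) (fun _ => ν) e).symm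
  have h2 := measurePreserving_sumPiEquivProdPi
    (X := fun _ : Fin (min n k) ⊕ Fin (n - min n k) => ℝ) fun _ => ν
  exact (h2.comp h1).map_eq

/-- The law of an allocation computed from a Gaussian pool: the clean part is a Gaussian dataset
and, given the clean part, the noisy part is a Gaussian dataset with inflated variance. -/
lemma lintegral_sampleCorruptLaw_gaussData (a : ℝ) (k : ℕ) (own : Dataset) (μ : ℝ) (v : ℝ≥0)
    (n : ℕ) {F : Allocation → ℝ≥0∞} (hF : Measurable F) :
    ∫⁻ d, ∫⁻ A, F A ∂sampleCorruptLaw a k own d.2 ∂gaussData μ v n =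
      ∫⁻ z, ∫⁻ z', F (z, z', noiseVar a own z)
        ∂gaussData μ (v + noiseVar a own z) (n - min n k) ∂gaussData μ v (min n k) := by
  have hmeas : ∀ π : Equiv.Perm (Fin n), Measurable fun pool : Fin n → ℝ =>
      ∫⁻ A, F A ∂corruptLaw a k own pool π := fun π =>
    (Measure.measurable_lintegral hF).comp
      ((measurable_corruptLaw_slice a k n π).comp measurable_prodMk_left)
  have hinner : ∀ (z : Fin (min n k) → ℝ), Measurable fun d : Dataset =>
      F (⟨min n k, z⟩, d, noiseVar a own ⟨min n k, z⟩) := fun z =>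
    hF.comp (measurable_const.prodMk (measurable_id.prodMk measurable_const))
  have hperm : ∀ π : Equiv.Perm (Fin n), ∫⁻ pool : Fin n → ℝ, ∫⁻ A, F A ∂corruptLaw a k own pool π
      ∂(Measure.pi fun _ => gaussianReal μ v) =
      ∫⁻ z, ∫⁻ z', F (z, z', noiseVar a own z)
        ∂gaussData μ (v + noiseVar a own z) (n - min n k) ∂gaussData μ v (min n k) := by
    intro π
    let H : (Fin (min n k) → ℝ) × (Fin (n - min n k) → ℝ) → ℝ≥0∞ := fun q =>
      ∫⁻ A, F A ∂((Measure.pi fun _ : Fin (n - min n k) =>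
        gaussianReal 0 (noiseVar a own ⟨min n k, q.1⟩)).map
        fun ε => ((⟨min n k, q.1⟩, ⟨n - min n k, q.2 + ε⟩,
          noiseVar a own ⟨min n k, q.1⟩) : Allocation))
    have hclean : Measurable fun q : (Fin (min n k) → ℝ) × (Fin (n - min n k) → ℝ) =>
        (⟨min n k, q.1⟩ : Dataset) := (Dataset.measurable_mk _).comp measurable_fst
    have hH : Measurable H := (Measure.measurable_lintegral hF).comp
      (measurable_noisy hclean measurable_snd (measurable_noiseVar a measurable_const hclean))
    have hsplit : Measurable fun pool : Fin n → ℝ =>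
        ((fun j : Fin (min n k) => pool (π (Fin.castLE (min_le_left _ _) j))),
          restPart k pool π) := by
      unfold restPart
      fun_prop
    have hz : Measurable fun z : Dataset => ∫⁻ z', F (z, z', noiseVar a own z)
        ∂gaussData μ (v + noiseVar a own z) (n - min n k) := by
      have hw : Measurable fun z : Dataset => noiseVar a own z :=
        measurable_noiseVar a measurable_const measurable_id
      let K : Kernel Dataset Dataset :=
        ⟨fun z => gaussData μ (v + noiseVar a own z) (n - min n k),
          measurable_gaussData measurable_const (measurable_const.add hw) _⟩
      have : IsMarkovKernel K := ⟨fun z => (inferInstance :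
        IsProbabilityMeasure (gaussData μ (v + noiseVar a own z) (n - min n k)))⟩
      exact Measurable.lintegral_kernel_prod_right' (κ := K)
        (f := fun p : Dataset × Dataset => F (p.1, p.2, noiseVar a own p.1))
        (hF.comp (measurable_fst.prodMk (measurable_snd.prodMk (hw.comp measurable_fst))))
    calc _ = ∫⁻ pool : Fin n → ℝ, H ((fun j : Fin (min n k) =>
            pool (π (Fin.castLE (min_le_left _ _) j))), restPart k pool π)
            ∂(Measure.pi fun _ => gaussianReal μ v) := rfl
      _ = ∫⁻ z : Fin (min n k) → ℝ, ∫⁻ r : Fin (n - min n k) → ℝ, H (z, r)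
            ∂(Measure.pi fun _ => gaussianReal μ v) ∂(Measure.pi fun _ => gaussianReal μ v) := by
          rw [← lintegral_map hH hsplit, map_split_pi, lintegral_prod _ hH.aemeasurable]
      _ = _ := by
          rw [lintegral_gaussData _ _ _ hz]
          refine lintegral_congr fun z => ?_
          -- Once `z` is fixed, so is the noise variance; the remaining points are independent of
          -- `z`, and the variances of points and noise add.
          rw [← lintegral_gaussian_add_noise _ _ _ _ (hinner z)]
          refine lintegral_congr fun r => ?_
          refine lintegral_map hF ?_
          refine measurable_const.prodMk (Measurable.prodMk ?_ measurable_const)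
          exact (Dataset.measurable_mk _).comp (measurable_const_add r)
  have hd : Measurable fun d : Dataset => ∫⁻ A, F A ∂sampleCorruptLaw a k own d.2 :=
    (Measure.measurable_lintegral hF).comp
      (measurable_sampleCorruptLaw a k measurable_const measurable_id)
  rw [lintegral_gaussData _ _ _ hd]
  simp only [sampleCorruptLaw, lintegral_smul_measure, lintegral_finsetSum_measure, smul_eq_mul]
  have hsum : Measurable fun pool : Fin n → ℝ => ∑ π, ∫⁻ A, F A ∂corruptLaw a k own pool π :=
    Finset.measurable_sum Finset.univ fun π _ => hmeas π
  have hswap : ∫⁻ pool : Fin n → ℝ, ∑ π, ∫⁻ A, F A ∂corruptLaw a k own pool π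
      ∂(Measure.pi fun _ => gaussianReal μ v) = ∑ π, ∫⁻ pool : Fin n → ℝ,
        ∫⁻ A, F A ∂corruptLaw a k own pool π ∂(Measure.pi fun _ => gaussianReal μ v) :=
    lintegral_finsetSum Finset.univ fun π _ => hmeas π
  rw [lintegral_const_mul _ hsum, hswap]
  simp only [hperm, Finset.sum_const, Finset.card_univ, Fintype.card_perm, Fintype.card_fin,
    nsmul_eq_mul]
  rw [← mul_assoc, ENNReal.inv_mul_cancel (by simp [Nat.factorial_ne_zero]) (by simp), one_mul]

/-! ### The risk of an agent in CCCD -/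

/-- The law of an allocation in CCCD, given the agent's submission and the pooled submissions of
the others. -/
def poolLaw (σ c : ℝ) (m : ℕ) (own pool : Dataset) : Measure Allocation :=
  if m ≤ 4 then Measure.dirac (pool, Dataset.empty, 0)
  else sampleCorruptLaw (alpha σ c m) ⌊σ / √(c * m)⌋₊ own pool.2

lemma measurable_poolLaw (σ c : ℝ) (m : ℕ) :
    Measurable fun p : Dataset × Dataset => poolLaw σ c m p.1 p.2 := by
  unfold poolLaw
  split_ifs
  · exact Measure.measurable_dirac.comp (measurable_snd.prodMk measurable_const)
  · exact measurable_sampleCorruptLaw _ _ measurable_fst measurable_snd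

instance (σ c : ℝ) (m : ℕ) (own pool : Dataset) :
    IsProbabilityMeasure (poolLaw σ c m own pool) := by
  unfold poolLaw
  split_ifs <;> infer_instance

/-- The risk of agent `i` in CCCD when she plays `t` and the others play the recommended
strategy. -/
lemma lintegral_CCCD_update (σ c : ℝ) (m : ℕ) (i : Fin m)
    (t : Strategy (CCCD σ c m).Alloc) (μ : ℝ) :
    ∫⁻ X : Fin m → Dataset, ∫⁻ A : Fin m → (CCCD σ c m).Alloc,
        ENNReal.ofReal (((Function.update (recommendedProfile σ c m) i t i).estimate (X i)
          ((Function.update (recommendedProfile σ c m) i t i).submit (X i)) (A i) - μ) ^ 2)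
        ∂((CCCD σ c m).proc fun j =>
          (Function.update (recommendedProfile σ c m) i t j).submit (X j))
        ∂(Measure.pi fun j =>
          sampleLaw μ σ (Function.update (recommendedProfile σ c m) i t j).n) =
      ∫⁻ x, ∫⁻ y, ∫⁻ A : Allocation, ENNReal.ofReal ((t.estimate x (t.submit x) A - μ) ^ 2)
        ∂poolLaw σ c m (t.submit x) y
        ∂gaussData μ (Real.toNNReal (σ ^ 2)) ((m - 1) * ⌊recommendedSize σ c m⌋₊)
        ∂gaussData μ (Real.toNNReal (σ ^ 2)) t.n := by
  set s := Function.update (recommendedProfile σ c m) i t with hs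
  have hsi : s i = t := Function.update_self _ _ _
  have hsj : ∀ j, j ≠ i → s j = recommendedStrategy σ c m := fun j hj =>
    Function.update_of_ne hj _ _
  have hest : ∀ x, Measurable fun A : Allocation =>
      ENNReal.ofReal ((t.estimate x (t.submit x) A - μ) ^ 2) := by
    intro x
    have h : Measurable fun A : Allocation => t.estimate x (t.submit x) A :=
      t.measurable_estimate.comp (measurable_const.prodMk (measurable_const.prodMk measurable_id))
    fun_prop
  have hinner : ∀ X : Fin m → Dataset, ∫⁻ A : Fin m → (CCCD σ c m).Alloc,
      ENNReal.ofReal (((s i).estimate (X i) ((s i).submit (X i)) (A i) - μ) ^ 2)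
        ∂((CCCD σ c m).proc fun j => (s j).submit (X j)) =
      ∫⁻ A : Allocation, ENNReal.ofReal ((t.estimate (X i) (t.submit (X i)) A - μ) ^ 2)
        ∂poolLaw σ c m (t.submit (X i)) (Dataset.others X i) := by
    intro X
    have h1 : poolLaw σ c m (t.submit (X i)) (Dataset.others X i) =
        allocLaw σ c m i fun j => (s j).submit (X j) := by
      -- The other agents submit what they collect, so the mechanism pools their raw data; the
      -- deviator's own submission does not enter her pool.
      have h2 : Dataset.others (fun j => (s j).submit (X j)) i = Dataset.others X i :=
        others_congr fun j hj => by rw [hsj j hj]; rfl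
      rw [poolLaw, allocLaw, h2, hsi]
    rw [h1, hsi]
    -- The allocations are drawn independently, so only the marginal law of coordinate `i` matters.
    exact (measurePreserving_eval (fun j => allocLaw σ c m j fun l => (s l).submit (X l))
      i).lintegral_comp (hest (X i))
  have hsum : ∑ j, Function.update (fun j => (s j).n) i 0 j =
      (m - 1) * ⌊recommendedSize σ c m⌋₊ := by
    rw [← Finset.add_sum_erase _ _ (Finset.mem_univ i), Function.update_self, zero_add,
      Finset.sum_congr rfl fun j hj => ?_]
    · rw [Finset.sum_const, Finset.card_erase_of_mem (Finset.mem_univ i), Finset.card_univ,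
        Fintype.card_fin, smul_eq_mul]
    · rw [Function.update_of_ne (Finset.ne_of_mem_erase hj), hsj j (Finset.ne_of_mem_erase hj)]
      rfl
  have hF : Measurable fun p : Dataset × Dataset =>
      ∫⁻ A : Allocation, ENNReal.ofReal ((t.estimate p.1 (t.submit p.1) A - μ) ^ 2)
        ∂poolLaw σ c m (t.submit p.1) p.2 := by
    have hsub : Measurable fun p : Dataset × Dataset => t.submit p.1 :=
      t.measurable_submit.comp measurable_fst
    let K : Kernel (Dataset × Dataset) Allocation :=
      ⟨fun p => poolLaw σ c m (t.submit p.1) p.2,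
        (measurable_poolLaw σ c m).comp (hsub.prodMk measurable_snd)⟩
    have : IsMarkovKernel K := ⟨fun p => (inferInstance :
      IsProbabilityMeasure (poolLaw σ c m (t.submit p.1) p.2))⟩
    have h : Measurable fun q : (Dataset × Dataset) × Allocation =>
        t.estimate q.1.1 (t.submit q.1.1) q.2 :=
      t.measurable_estimate.comp ((measurable_fst.comp measurable_fst).prodMk
        ((hsub.comp measurable_fst).prodMk measurable_snd))
    exact Measurable.lintegral_kernel_prod_right' (κ := K)
      (f := fun q : (Dataset × Dataset) × Allocation =>
        ENNReal.ofReal ((t.estimate q.1.1 (t.submit q.1.1) q.2 - μ) ^ 2)) (by fun_prop)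
  simp only [hinner, sampleLaw_eq_gaussData]
  refine (lintegral_own_others μ (Real.toNNReal (σ ^ 2)) (fun j => (s j).n) i
    (F := fun x y => ∫⁻ A : Allocation, ENNReal.ofReal ((t.estimate x (t.submit x) A - μ) ^ 2)
      ∂poolLaw σ c m (t.submit x) y) hF).trans ?_
  rw [hsum, hsi]

/-! ### Bayes risk under corrupted data -/

lemma lintegral_gaussianReal_gaussianReal (m : ℝ) (V s : ℝ≥0) {g : ℝ → ℝ≥0∞}
    (hg : Measurable g) :
    ∫⁻ μ, ∫⁻ z, g z ∂gaussianReal μ s ∂gaussianReal m V = ∫⁻ z, g z ∂gaussianReal m (V + s) := by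
  have h1 : ∀ μ, ∫⁻ z, g z ∂gaussianReal μ s = ∫⁻ z, g (μ + z) ∂gaussianReal 0 s := by
    intro μ
    have h := gaussianReal_map_const_add (μ := 0) (v := s) μ
    rw [zero_add] at h
    rw [← h, lintegral_map hg (by fun_prop)]
  have h2 := gaussianReal_conv_gaussianReal (m₁ := m) (m₂ := 0) (v₁ := V) (v₂ := s)
  rw [add_zero] at h2
  simp only [h1]
  rw [← h2, Measure.lintegral_conv hg]

lemma coe_noiseVar (a : ℝ) (own clean : Dataset) :
    (noiseVar a own clean : ℝ) = a ^ 2 * (own.mean - clean.mean) ^ 2 :=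
  Real.coe_toNNReal _ (by positivity)

/-- The kernel generating the corrupted part of the data. -/
def noisyKernel (μ : ℝ) (v : ℝ≥0) (q : ℕ) (w : Dataset × Dataset → ℝ≥0) (hw : Measurable w) :
    Kernel (Dataset × Dataset) Dataset :=
  ⟨fun p => gaussData μ (v + w p) q,
    measurable_gaussData measurable_const (measurable_const.add hw) q⟩

instance (μ : ℝ) (v : ℝ≥0) (q : ℕ) (w : Dataset × Dataset → ℝ≥0) (hw : Measurable w) :
    IsMarkovKernel (noisyKernel μ v q w hw) :=
  ⟨fun p => (inferInstance : IsProbabilityMeasure (gaussData μ (v + w p) q))⟩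

/-- The law of all data that an agent may see: her own, the clean and the corrupted part. -/
def dataLaw (μ : ℝ) (v : ℝ≥0) (n p q : ℕ) (w : Dataset × Dataset → ℝ≥0) (hw : Measurable w) :
    Measure ((Dataset × Dataset) × Dataset) :=
  ((gaussData μ v n).prod (gaussData μ v p)) ⊗ₘ noisyKernel μ v q w hw

instance (μ : ℝ) (v : ℝ≥0) (n p q : ℕ) (w : Dataset × Dataset → ℝ≥0) (hw : Measurable w) :
    IsProbabilityMeasure (dataLaw μ v n p q w hw) := by
  unfold dataLaw; infer_instance

lemma lintegral_dataLaw (μ : ℝ) (v : ℝ≥0) (n p q : ℕ) {w : Dataset × Dataset → ℝ≥0}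
    (hw : Measurable w) {F : (Dataset × Dataset) × Dataset → ℝ≥0∞} (hF : Measurable F) :
    ∫⁻ ω, F ω ∂dataLaw μ v n p q w hw = ∫⁻ x, ∫⁻ z, ∫⁻ z', F ((x, z), z')
      ∂gaussData μ (v + w (x, z)) q ∂gaussData μ v p ∂gaussData μ v n := by
  rw [dataLaw, Measure.lintegral_compProd hF, lintegral_prod _
    (hF.lintegral_kernel_prod_right' (κ := noisyKernel μ v q w hw)).aemeasurable]
  rfl

/-- The variance of the corrupted part depends on the other two datasets but not on μ. The three
likelihood ratios therefore multiply, and the total precision is a function of the observed data. -/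
lemma lintegral_dataLaw_eq (μ : ℝ) {v : ℝ≥0} (hv : v ≠ 0) (n p q : ℕ)
    {w : Dataset × Dataset → ℝ≥0} (hw : Measurable w)
    {F : (Dataset × Dataset) × Dataset → ℝ≥0∞} (hF : Measurable F) :
    ∫⁻ ω, F ω ∂dataLaw μ v n p q w hw = ∫⁻ ω, ENNReal.ofReal (Real.exp
      ((ω.1.1.total / v + ω.1.2.total / v + ω.2.total / (v + w ω.1)) * μ -
        (n / v + p / v + q / (v + w ω.1)) * μ ^ 2 / 2)) * F ω ∂dataLaw 0 v n p q w hw := by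
  have hT := Dataset.measurable_total
  have hker : ∀ (ν : ℝ) {H : (Dataset × Dataset) × Dataset → ℝ≥0∞}, Measurable H →
      Measurable fun d : Dataset × Dataset => ∫⁻ z', H (d, z') ∂gaussData ν (v + w d) q :=
    fun ν H hH => hH.lintegral_kernel_prod_right' (κ := noisyKernel ν v q w hw)
  have hH : Measurable fun d : Dataset × Dataset =>
      ∫⁻ z', F (d, z') ∂gaussData μ (v + w d) q := hker μ hF
  have hlik := measurable_likelihood_left
  rw [lintegral_dataLaw _ _ _ _ _ _ hF, lintegral_dataLaw _ _ _ _ _ _ (by fun_prop),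
    lintegral_gaussData_eq μ hv n hH.lintegral_prod_right']
  refine lintegral_congr fun x => ?_
  have hHx : Measurable fun z => ∫⁻ z', F ((x, z), z') ∂gaussData μ (v + w (x, z)) q :=
    hH.comp (measurable_prodMk_left (x := x))
  have hl1 : Measurable fun z => likelihood v p z μ := hlik v p μ
  rw [lintegral_gaussData_eq μ hv p hHx, ← lintegral_const_mul _ (by fun_prop)]
  refine lintegral_congr fun z => ?_
  have hFz : Measurable fun z' => F ((x, z), z') := hF.comp (measurable_prodMk_left (x := (x, z)))
  have hvw : v + w (x, z) ≠ 0 := by positivity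
  have hl2 : Measurable fun z' => likelihood (v + w (x, z) : ℝ≥0) q z' μ := hlik _ q μ
  rw [lintegral_gaussData_eq μ hvw q hFz, ← mul_assoc, ← lintegral_const_mul _ (by fun_prop)]
  refine lintegral_congr fun z' => ?_
  rw [← mul_assoc]
  congr 1
  simp only [likelihood]
  rw [← ENNReal.ofReal_mul (by positivity), ← ENNReal.ofReal_mul (by positivity),
    ← Real.exp_add, ← Real.exp_add]
  congr 2
  push_cast
  ring

/-- The posterior variance as a function of the difference `u` of the reported and the clean
sample mean, when the prior variance is `1 / e`. -/
def postVar (e v a : ℝ) (n p q : ℕ) (u : ℝ) : ℝ :=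
  1 / (e + (n / v + p / v + q / (v + a ^ 2 * u ^ 2)))

lemma measurable_postVar (e v a : ℝ) (n p q : ℕ) : Measurable (postVar e v a n p q) := by
  unfold postVar
  fun_prop

/-- A larger discrepancy means more noise and a less precise posterior. This is the monotonicity
required by the rearrangement inequality. -/
lemma postVar_mono {e v : ℝ} (he : 0 < e) (hv : 0 < v) (a : ℝ) (n p q : ℕ) {u u' : ℝ}
    (h : |u| ≤ |u'|) : postVar e v a n p q u ≤ postVar e v a n p q u' := by
  have h2 : u ^ 2 ≤ u' ^ 2 := sq_le_sq.2 h
  unfold postVar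
  gcongr

lemma measurable_gaussian_average {Ω : Type*} [MeasurableSpace Ω] {g : Ω → ℝ} (hg : Measurable g)
    (s : ℝ≥0) {Φ : ℝ → ℝ≥0∞} (hΦ : Measurable Φ) :
    Measurable fun r : Ω × ℝ => ∫⁻ z, Φ (g r.1 - z) ∂gaussianReal r.2 s := by
  let κ : Kernel (Ω × ℝ) ℝ := ⟨fun r => gaussianReal r.2 s,
    measurable_gaussianReal.comp (measurable_snd.prodMk measurable_const)⟩
  have : IsMarkovKernel κ := ⟨fun r =>
    (inferInstance : IsProbabilityMeasure (gaussianReal r.2 s))⟩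
  have h1 : Measurable fun s : (Ω × ℝ) × ℝ => Φ (g s.1.1 - s.2) :=
    hΦ.comp ((hg.comp (measurable_fst.comp measurable_fst)).sub measurable_snd)
  exact h1.lintegral_kernel_prod_right' (κ := κ)

/-- Given the data, the mean loss is smallest if the guess is the posterior mean. -/
lemma lintegral_likelihood_mul_ge {v : ℝ≥0} (n : ℕ) (s : ℝ≥0) {L : ℝ≥0} (hL : L ≠ 0)
    {Φ : ℝ → ℝ≥0∞} (hΦ : Measurable Φ) (hmono : ∀ x y, |x| ≤ |y| → Φ x ≤ Φ y)
    (x : Dataset) (y : ℝ) :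
    (∫⁻ u, Φ u ∂gaussianReal 0 (Real.toNNReal (1 / (1 / L + n / v)) + s)) *
        ∫⁻ μ, likelihood v n x μ ∂gaussianReal 0 L ≤
      ∫⁻ μ, likelihood v n x μ * ∫⁻ z, Φ (y - z) ∂gaussianReal μ s ∂gaussianReal 0 L := by
  obtain ⟨C, hC⟩ := gaussianReal_withDensity_tilt hL (a := n / v) (by positivity) (x.total / v)
  change (gaussianReal 0 L).withDensity (likelihood v n x) = _ at hC
  have hlx : Measurable (likelihood v n x) := by
    unfold likelihood
    fun_prop
  have hψ : Measurable fun μ => ∫⁻ z, Φ (y - z) ∂gaussianReal μ s := by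
    have h := (measurable_gaussian_average (g := fun _ : ℝ => y) measurable_const s hΦ).comp
      (measurable_prodMk_left (x := (0 : ℝ)))
    simpa only [Function.comp_def] using h
  have h1 : ∫⁻ μ, likelihood v n x μ ∂gaussianReal 0 L = C := by
    rw [← setLIntegral_univ, ← withDensity_apply _ MeasurableSet.univ, hC]
    simp
  have h2 := lintegral_withDensity_eq_lintegral_mul (gaussianReal 0 L) hlx hψ
  simp only [Pi.mul_apply] at h2
  have hsub : Measurable fun z => Φ (y - z) := hΦ.comp (measurable_const.sub measurable_id)
  -- Given the data, z is Gaussian around the posterior mean, with variance the posterior variance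
  -- plus `s`. The guess `y` only shifts the centre of y − z, and centring it lowers the mean of Φ.
  rw [h1, ← h2, hC, lintegral_smul_measure, smul_eq_mul, mul_comm,
    lintegral_gaussianReal_gaussianReal _ _ _ hsub,
    ← lintegral_map (f := Φ) (g := fun z => y - z) hΦ (by fun_prop),
    gaussianReal_map_const_sub]
  gcongr C * ?_
  exact lintegral_gaussianReal_center_le hΦ hmono _ _

/-- Given the agent's data, the discrepancy g − z is Gaussian with a variance that depends neither
on the data nor on `g`. One bound therefore covers every way of turning the data into a submitted
mean. -/
lemma lintegral_prior_mean_ge {v : ℝ≥0} (hv : v ≠ 0) (n : ℕ) (s : ℝ≥0) {L : ℝ≥0} (hL : L ≠ 0)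
    {Φ : ℝ → ℝ≥0∞} (hΦ : Measurable Φ) (hmono : ∀ x y, |x| ≤ |y| → Φ x ≤ Φ y)
    {g : Dataset → ℝ} (hg : Measurable g) :
    ∫⁻ u, Φ u ∂gaussianReal 0 (Real.toNNReal (1 / (1 / L + n / v)) + s) ≤
      ∫⁻ μ, ∫⁻ x, ∫⁻ z, Φ (g x - z) ∂gaussianReal μ s ∂gaussData μ v n ∂gaussianReal 0 L := by
  set K := ∫⁻ u, Φ u ∂gaussianReal 0 (Real.toNNReal (1 / (1 / L + n / v)) + s)
  have hlik : Measurable fun p : Dataset × ℝ => likelihood v n p.1 p.2 := measurable_likelihood v n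
  have hlik' : Measurable fun p : ℝ × Dataset => likelihood v n p.2 p.1 := by
    have h := hlik.comp (measurable_swap (α := ℝ) (β := Dataset))
    simpa only [Function.comp_def, Prod.fst_swap, Prod.snd_swap] using h
  have hΨ := measurable_gaussian_average hg s hΦ
  have hΨμ : ∀ μ, Measurable fun x : Dataset => ∫⁻ z, Φ (g x - z) ∂gaussianReal μ s := by
    intro μ
    have h := hΨ.comp (measurable_prodMk_right (y := μ))
    simpa only [Function.comp_def] using h
  have hm1 : Measurable fun μ => ∫⁻ x, likelihood v n x μ ∂gaussData 0 v n :=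
    hlik'.lintegral_prod_right'
  have hm2 : Measurable fun x => ∫⁻ μ, likelihood v n x μ ∂gaussianReal 0 L :=
    hlik.lintegral_prod_right'
  calc K = ∫⁻ _, K ∂gaussianReal 0 L := by simp
    -- The likelihood has total mass 1 for every μ; inserting it prepares the exchange that
    -- conditions on the data.
    _ = ∫⁻ μ, K * ∫⁻ x, likelihood v n x μ ∂gaussData 0 v n ∂gaussianReal 0 L := by
        refine lintegral_congr fun μ => ?_
        have h := lintegral_gaussData_eq μ hv n (F := fun _ => 1) measurable_const
        simp only [mul_one, lintegral_const, measure_univ] at h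
        rw [← h, mul_one]
    _ = K * ∫⁻ x, ∫⁻ μ, likelihood v n x μ ∂gaussianReal 0 L ∂gaussData 0 v n := by
        rw [lintegral_const_mul _ hm1,
          lintegral_lintegral_swap (μ := gaussianReal 0 L) (ν := gaussData 0 v n)
            (f := fun μ x => likelihood v n x μ) hlik'.aemeasurable]
    _ = ∫⁻ x, K * ∫⁻ μ, likelihood v n x μ ∂gaussianReal 0 L ∂gaussData 0 v n :=
        (lintegral_const_mul _ hm2).symm
    _ ≤ ∫⁻ x, ∫⁻ μ, likelihood v n x μ * ∫⁻ z, Φ (g x - z) ∂gaussianReal μ s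
        ∂gaussianReal 0 L ∂gaussData 0 v n :=
        lintegral_mono fun x => lintegral_likelihood_mul_ge n s hL hΦ hmono x (g x)
    _ = ∫⁻ μ, ∫⁻ x, likelihood v n x μ * ∫⁻ z, Φ (g x - z) ∂gaussianReal μ s
        ∂gaussData 0 v n ∂gaussianReal 0 L :=
        lintegral_lintegral_swap (μ := gaussData 0 v n) (ν := gaussianReal 0 L)
          (hlik.mul hΨ).aemeasurable
    _ = _ := lintegral_congr fun μ => (lintegral_gaussData_eq μ hv n (hΨμ μ)).symm

/-- The average of the posterior variance bounds the Bayes risk of an agent who submits `f x`. -/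
lemma bayes_risk_dataLaw_ge {v : ℝ≥0} (hv : v ≠ 0) (n p q : ℕ) {w : Dataset × Dataset → ℝ≥0}
    (hw : Measurable w) {δ : (Dataset × Dataset) × Dataset → ℝ} (hδ : Measurable δ)
    {L : ℝ≥0} (hL : L ≠ 0) :
    ∫⁻ μ, ∫⁻ ω, ENNReal.ofReal (1 / (1 / L + (n / v + p / v + q / (v + w ω.1))))
        ∂dataLaw μ v n p q w hw ∂gaussianReal 0 L ≤
      ∫⁻ μ, ∫⁻ ω, ENNReal.ofReal ((δ ω - μ) ^ 2) ∂dataLaw μ v n p q w hw ∂gaussianReal 0 L := by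
  have hT := Dataset.measurable_total
  have hbayes := bayes_risk_ge (dataLaw 0 v n p q w hw) hL
    (a := fun ω => n / v + p / v + q / (v + w ω.1))
    (b := fun ω => ω.1.1.total / v + ω.1.2.total / v + ω.2.total / (v + w ω.1)) (δ := δ)
    (by fun_prop) (by fun_prop) hδ fun ω => by positivity
  refine le_trans (le_of_eq ?_) (hbayes.trans (le_of_eq ?_))
  · refine lintegral_congr fun μ => lintegral_dataLaw_eq μ hv n p q hw ?_
    fun_prop
  · refine lintegral_congr fun μ => (lintegral_dataLaw_eq μ hv n p q hw ?_).symm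
    fun_prop

/-- The maximum risk of an agent who submits `f x` is at least the Bayes risk of an agent whose
submission has the posterior mean as its sample mean. -/
lemma risk_corrupted_ge {v : ℝ≥0} (hv : v ≠ 0) (a : ℝ) (n : ℕ) {p : ℕ} (hp : p ≠ 0) (q : ℕ)
    {f : Dataset → Dataset} (hf : Measurable f) {h : Dataset → Dataset → Allocation → ℝ}
    (hh : Measurable fun p : Dataset × Dataset × Allocation => h p.1 p.2.1 p.2.2)
    {L : ℝ≥0} (hL : L ≠ 0) :
    ∫⁻ u, ENNReal.ofReal (postVar (1 / L) v a n p q u)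
        ∂gaussianReal 0 (Real.toNNReal (1 / (1 / L + n / v)) + v / p) ≤
      ⨆ μ, ∫⁻ x, ∫⁻ z, ∫⁻ z', ENNReal.ofReal ((h x (f x) (z, z', noiseVar a (f x) z) - μ) ^ 2)
        ∂gaussData μ (v + noiseVar a (f x) z) q ∂gaussData μ v p ∂gaussData μ v n := by
  have hv' : (0 : ℝ) < v := by positivity
  have hL' : (0 : ℝ) < L := by positivity
  have hM := Dataset.measurable_mean
  have hw : Measurable fun d : Dataset × Dataset => noiseVar a (f d.1) d.2 :=
    measurable_noiseVar a (hf.comp measurable_fst) measurable_snd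
  have hδ : Measurable fun ω : (Dataset × Dataset) × Dataset =>
      h ω.1.1 (f ω.1.1) (ω.1.2, ω.2, noiseVar a (f ω.1.1) ω.1.2) := by
    have h1 : Measurable fun ω : (Dataset × Dataset) × Dataset =>
        (ω.1.1, f ω.1.1, ((ω.1.2, ω.2, noiseVar a (f ω.1.1) ω.1.2) : Allocation)) :=
      (measurable_fst.comp measurable_fst).prodMk
        ((hf.comp (measurable_fst.comp measurable_fst)).prodMk
        ((measurable_snd.comp measurable_fst).prodMk (measurable_snd.prodMk
          (hw.comp measurable_fst))))
    exact hh.comp h1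
  have hΦ : Measurable fun u => ENNReal.ofReal (postVar (1 / L) v a n p q u) :=
    (measurable_postVar _ _ _ _ _ _).ennreal_ofReal
  refine le_trans ?_ (lintegral_gaussianReal_le_iSup _ L)
  refine (lintegral_prior_mean_ge hv n (v / p) hL hΦ
    (fun x y hxy => ENNReal.ofReal_le_ofReal (postVar_mono (by positivity) hv' a n p q hxy))
    (hM.comp hf)).trans ?_
  refine le_trans (le_of_eq ?_) ((bayes_risk_dataLaw_ge hv n p q hw hδ hL).trans (le_of_eq ?_))
  -- The posterior variance does not involve the corrupted points and depends on `z` only through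
  -- its mean, which has law N(μ, v/p).
  · refine lintegral_congr fun μ => ?_
    have hm : Measurable fun ω : (Dataset × Dataset) × Dataset => ENNReal.ofReal
        (1 / (1 / L + (n / v + p / v + q / (v + noiseVar a (f ω.1.1) ω.1.2)))) := by
      have h1 : Measurable fun ω : (Dataset × Dataset) × Dataset =>
          (noiseVar a (f ω.1.1) ω.1.2 : ℝ) := (hw.comp measurable_fst).coe_nnreal_real
      fun_prop
    rw [lintegral_dataLaw _ _ _ _ _ hw hm]
    refine lintegral_congr fun x => ?_
    simp only [Function.comp_apply]
    rw [← lintegral_mean_gaussData μ v hp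
      (F := fun z => ENNReal.ofReal (postVar (1 / L) v a n p q ((f x).mean - z)))
      (hΦ.comp (measurable_const.sub measurable_id))]
    refine lintegral_congr fun z => ?_
    simp only [lintegral_const, measure_univ, mul_one, coe_noiseVar]
    rfl
  · refine lintegral_congr fun μ => ?_
    rw [lintegral_dataLaw _ _ _ _ _ hw ((hδ.sub_const μ).pow_const 2).ennreal_ofReal]

/-! ### The limit of flat priors -/

/-- Fatou's lemma: a bound common to all prior variances survives the limit. -/
lemma lintegral_le_of_tendsto_of_forall_le {Ω : Type*} [MeasurableSpace Ω] {ν : Measure Ω}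
    {f : ℕ → Ω → ℝ≥0∞} {g : Ω → ℝ≥0∞} (hf : ∀ j, Measurable (f j))
    (h : ∀ᵐ x ∂ν, Filter.Tendsto (fun j => f j x) Filter.atTop (nhds (g x))) {R : ℝ≥0∞}
    (hR : ∀ j, ∫⁻ x, f j x ∂ν ≤ R) : ∫⁻ x, g x ∂ν ≤ R := by
  calc ∫⁻ x, g x ∂ν = ∫⁻ x, Filter.liminf (fun j => f j x) Filter.atTop ∂ν := by
        refine lintegral_congr_ae ?_
        filter_upwards [h] with x hx
        exact hx.liminf_eq.symm
    _ ≤ Filter.liminf (fun j => ∫⁻ x, f j x ∂ν) Filter.atTop := lintegral_liminf_le hf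
    _ ≤ R := Filter.liminf_le_of_frequently_le' (Filter.Frequently.of_forall hR)

/-- A centered Gaussian is a scaled standard Gaussian. -/
lemma lintegral_gaussianReal_zero_eq (S : ℝ≥0) {F : ℝ → ℝ≥0∞} (hF : Measurable F) :
    ∫⁻ u, F u ∂gaussianReal 0 S = ∫⁻ x, F (√S * x) ∂gaussianReal 0 1 := by
  have h := gaussianReal_map_const_mul (μ := 0) (v := 1) √(S : ℝ)
  have hS : (NNReal.mk (√(S : ℝ) ^ 2) (sq_nonneg _) : ℝ≥0) * 1 = S := by
    rw [mul_one]
    exact NNReal.eq (Real.sq_sqrt S.coe_nonneg)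
  rw [mul_zero, hS] at h
  rw [← h, lintegral_map hF (by fun_prop)]

/-- Scaling to a standard Gaussian moves the prior variance L = j + 1 from the measure into the
integrand, so that j → ∞ can be taken under a fixed law. -/
lemma risk_corrupted_ge_std {v : ℝ≥0} (hv : v ≠ 0) (a : ℝ) (n : ℕ) {p : ℕ} (hp : p ≠ 0) (q : ℕ)
    {f : Dataset → Dataset} (hf : Measurable f) {h : Dataset → Dataset → Allocation → ℝ}
    (hh : Measurable fun p : Dataset × Dataset × Allocation => h p.1 p.2.1 p.2.2) (j : ℕ) :
    ∫⁻ x, ENNReal.ofReal (1 / (1 / (j + 1 : ℝ) + (n / v + p / v + q / (v + a ^ 2 *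
        ((1 / (1 / (j + 1 : ℝ) + n / v) + v / p) * x ^ 2))))) ∂gaussianReal 0 1 ≤
      ⨆ μ, ∫⁻ x, ∫⁻ z, ∫⁻ z', ENNReal.ofReal ((h x (f x) (z, z', noiseVar a (f x) z) - μ) ^ 2)
        ∂gaussData μ (v + noiseVar a (f x) z) q ∂gaussData μ v p ∂gaussData μ v n := by
  refine le_trans (le_of_eq ?_)
    (risk_corrupted_ge hv a n hp q hf hh (L := (j + 1 : ℝ≥0)) (by positivity))
  rw [lintegral_gaussianReal_zero_eq _ (measurable_postVar _ _ _ _ _ _).ennreal_ofReal]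
  refine lintegral_congr fun x => ?_
  rw [postVar, mul_pow, Real.sq_sqrt (NNReal.coe_nonneg _)]
  push_cast
  rw [Real.coe_toNNReal _ (by positivity)]

lemma risk_corrupted_ge_limit {v : ℝ≥0} (hv : v ≠ 0) (a : ℝ) {n : ℕ} (hn : n ≠ 0) {p : ℕ}
    (hp : p ≠ 0) (q : ℕ) {f : Dataset → Dataset} (hf : Measurable f)
    {h : Dataset → Dataset → Allocation → ℝ}
    (hh : Measurable fun p : Dataset × Dataset × Allocation => h p.1 p.2.1 p.2.2) :
    ∫⁻ x, ENNReal.ofReal (1 / (n / v + p / v + q / (v + a ^ 2 *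
        ((v / n + v / p) * x ^ 2)))) ∂gaussianReal 0 1 ≤
      ⨆ μ, ∫⁻ x, ∫⁻ z, ∫⁻ z', ENNReal.ofReal ((h x (f x) (z, z', noiseVar a (f x) z) - μ) ^ 2)
        ∂gaussData μ (v + noiseVar a (f x) z) q ∂gaussData μ v p ∂gaussData μ v n := by
  have hv' : (0 : ℝ) < v := by positivity
  have hn' : (0 : ℝ) < n := by positivity
  have hp' : (0 : ℝ) < p := by positivity
  refine lintegral_le_of_tendsto_of_forall_le (fun j => by fun_prop)
    (Filter.Eventually.of_forall fun x => ?_) (risk_corrupted_ge_std hv a n hp q hf hh)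
  refine ENNReal.tendsto_ofReal ?_
  have h0 := tendsto_one_div_add_atTop_nhds_zero_nat (𝕜 := ℝ)
  have h1 := tendsto_inv_add_atTop ((n : ℝ) / v) (by positivity)
  rw [one_div_div] at h1
  have h2 : Filter.Tendsto (fun j : ℕ => v + a ^ 2 *
      ((1 / (1 / (j + 1 : ℝ) + n / v) + v / p) * x ^ 2)) Filter.atTop
      (nhds (v + a ^ 2 * ((v / n + v / p) * x ^ 2))) :=
    ((((h1.add_const _).mul_const _).const_mul _).const_add _)
  have h3 := (tendsto_const_nhds (x := (q : ℝ))).div h2 (by positivity)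
  have h4 := h0.add (h3.const_add ((n : ℝ) / v + p / v))
  rw [zero_add] at h4
  exact tendsto_const_nhds.div h4 (by positivity)

/-- Without own data an agent cannot benefit from the corrupted part. -/
lemma risk_corrupted_ge_no_data {v : ℝ≥0} (hv : v ≠ 0) {a : ℝ} (ha : a ≠ 0) {p : ℕ}
    (hp : p ≠ 0) (q : ℕ) {f : Dataset → Dataset} (hf : Measurable f)
    {h : Dataset → Dataset → Allocation → ℝ}
    (hh : Measurable fun p : Dataset × Dataset × Allocation => h p.1 p.2.1 p.2.2) :
    ENNReal.ofReal (v / p) ≤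
      ⨆ μ, ∫⁻ x, ∫⁻ z, ∫⁻ z', ENNReal.ofReal ((h x (f x) (z, z', noiseVar a (f x) z) - μ) ^ 2)
        ∂gaussData μ (v + noiseVar a (f x) z) q ∂gaussData μ v p ∂gaussData μ v 0 := by
  have hv' : (0 : ℝ) < v := by positivity
  have hp' : (0 : ℝ) < p := by positivity
  have hconst : ∫⁻ _, ENNReal.ofReal (v / p) ∂gaussianReal 0 1 = ENNReal.ofReal (v / p) := by simp
  rw [← hconst]
  have hne : ∀ᵐ x ∂gaussianReal 0 1, x ≠ 0 := by
    have := nullSingletonClass_gaussianReal (μ := 0) (v := 1) one_ne_zero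
    simp [ae_iff]
  refine lintegral_le_of_tendsto_of_forall_le (fun j => by fun_prop) ?_
    (risk_corrupted_ge_std hv a 0 hp q hf hh)
  filter_upwards [hne] with x hx
  refine ENNReal.tendsto_ofReal ?_
  have h0 := tendsto_one_div_add_atTop_nhds_zero_nat (𝕜 := ℝ)
  have hx2 : 0 < a ^ 2 * x ^ 2 := by positivity
  -- Without own data the discrepancy inherits the whole prior variance j + 1. For x ≠ 0 the noise
  -- variance diverges, and the corrupted points lose all their weight in the limit.
  have h2 : Filter.Tendsto (fun j : ℕ => v + a ^ 2 *
      ((1 / (1 / (j + 1 : ℝ) + (0 : ℕ) / v) + v / p) * x ^ 2)) Filter.atTop Filter.atTop := by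
    have h3 : Filter.Tendsto (fun j : ℕ => (j : ℝ)) Filter.atTop Filter.atTop :=
      tendsto_natCast_atTop_atTop
    have h4 := (h3.const_mul_atTop hx2)
    refine Filter.tendsto_atTop_mono (fun j => ?_) h4
    have h5 : (1 / (1 / (j + 1 : ℝ) + (0 : ℕ) / v) + v / p : ℝ) = j + (1 + v / p) := by
      rw [Nat.cast_zero, zero_div, add_zero, one_div_one_div, add_assoc]
    rw [h5]
    have h6 : (0 : ℝ) ≤ v + a ^ 2 * x ^ 2 * (1 + v / p) := by positivity
    nlinarith
  have h3 := (tendsto_const_nhds (x := (q : ℝ))).div_atTop h2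
  have h4 := h0.add (h3.const_add (((0 : ℕ) : ℝ) / v + p / v))
  have hlim : (0 : ℝ) + (((0 : ℕ) : ℝ) / v + p / v + 0) = p / v := by simp
  have h5 := tendsto_const_nhds.div h4 (by rw [hlim]; positivity) (a := (1 : ℝ))
  rw [hlim, one_div_div] at h5
  exact h5

/-! ### The risk of the recommended estimator -/

lemma lintegral_sq_affine_total (μ : ℝ) (v : ℝ≥0) (n : ℕ) (A B : ℝ) :
    ∫⁻ d, ENNReal.ofReal ((A + B * d.total) ^ 2) ∂gaussData μ v n =
      ENNReal.ofReal ((A + B * (n * μ)) ^ 2 + B ^ 2 * (n * v)) := by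
  rw [lintegral_total_gaussData μ v n (F := fun x => ENNReal.ofReal ((A + B * x) ^ 2))
    (by fun_prop)]
  have h1 : (gaussianReal (n * μ) (n * v)).map (fun x => A + B * x) =
      gaussianReal (A + B * (n * μ)) (NNReal.mk (B ^ 2) (sq_nonneg _) * (n * v)) := by
    have h := gaussianReal_map_const_mul (μ := n * μ) (v := n * v) B
    have h2 := gaussianReal_map_const_add (μ := B * (n * μ))
      (v := NNReal.mk (B ^ 2) (sq_nonneg _) * (n * v)) A
    rw [← h, Measure.map_map (by fun_prop) (by fun_prop), add_comm] at h2
    exact h2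
  have h3 := lintegral_sq_sub_gaussianReal 0 (A + B * (n * μ))
    (NNReal.mk (B ^ 2) (sq_nonneg _) * (n * v))
  rw [← h1, lintegral_map (by fun_prop) (by fun_prop)] at h3
  simp only [zero_sub, neg_sq] at h3
  rw [h3]
  push_cast
  rfl

/-- The risk of the average of all data when nothing is corrupted. -/
lemma risk_weightedAverage_pooled {σ : ℝ} (hσ : 0 < σ) (μ : ℝ) {n N : ℕ} (hn : 0 < n) :
    ∫⁻ x, ∫⁻ y, ENNReal.ofReal ((weightedAverage σ x y Dataset.empty 0 - μ) ^ 2)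
        ∂gaussData μ (Real.toNNReal (σ ^ 2)) N ∂gaussData μ (Real.toNNReal (σ ^ 2)) n =
      ENNReal.ofReal (σ ^ 2 / (n + N)) := by
  have hvv : (Real.toNNReal (σ ^ 2) : ℝ) = σ ^ 2 := Real.coe_toNNReal _ (sq_nonneg σ)
  have hM : (0 : ℝ) < n + N := by positivity
  have hinner : ∀ x : Dataset, x.size = n →
      ∫⁻ y, ENNReal.ofReal ((weightedAverage σ x y Dataset.empty 0 - μ) ^ 2)
        ∂gaussData μ (Real.toNNReal (σ ^ 2)) N =
      ENNReal.ofReal (((N * μ / (n + N) - μ) + 1 / (n + N) * x.total) ^ 2) +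
        ENNReal.ofReal (N * σ ^ 2 / (n + N) ^ 2) := by
    intro x hx
    have h1 : ∫⁻ y, ENNReal.ofReal ((weightedAverage σ x y Dataset.empty 0 - μ) ^ 2)
        ∂gaussData μ (Real.toNNReal (σ ^ 2)) N =
        ∫⁻ y, ENNReal.ofReal (((x.total / (n + N) - μ) + 1 / (n + N) * y.total) ^ 2)
        ∂gaussData μ (Real.toNNReal (σ ^ 2)) N := by
      refine lintegral_congr_ae ?_
      filter_upwards [ae_size_gaussData μ (Real.toNNReal (σ ^ 2)) N] with y hy
      have e1 : Dataset.empty.total = 0 := Fin.sum_univ_zero _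
      have e2 : Dataset.empty.size = 0 := rfl
      congr 2
      rw [weightedAverage, hx, hy, e1, e2]
      push_cast
      field_simp
      ring
    rw [h1, lintegral_sq_affine_total, ← ENNReal.ofReal_add (by positivity) (by positivity), hvv]
    congr 1
    field_simp
    ring
  rw [lintegral_congr_ae ((ae_size_gaussData μ (Real.toNNReal (σ ^ 2)) n).mono hinner),
    lintegral_add_right _ measurable_const, lintegral_sq_affine_total, lintegral_const,
    measure_univ, mul_one, ← ENNReal.ofReal_add (by positivity) (by positivity), hvv]
  congr 1
  field_simp
  ring

/-- The sum and the difference of two independent centered Gaussians of equal variance are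
independent. -/
lemma lintegral_sum_diff_gaussian (s : ℝ≥0) {F : ℝ → ℝ → ℝ≥0∞}
    (hF : Measurable fun p : ℝ × ℝ => F p.1 p.2) :
    ∫⁻ x, ∫⁻ y, F (x + y) (x - y) ∂gaussianReal 0 s ∂gaussianReal 0 s =
      ∫⁻ d, ∫⁻ e, F (√2 * e) (√2 * d) ∂gaussianReal 0 s ∂gaussianReal 0 s := by
  -- The rotation by −π/4 sends (x, y) to ((x − y)/√2, (x + y)/√2), which is why `d` stands for the
  -- difference and `e` for the sum.
  have hrot := IsGaussian.map_rotation_eq_self (μ := gaussianReal 0 s)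
    (by simp [integral_id_gaussianReal]) (-(Real.pi / 4))
  have hm : Measurable fun p : ℝ × ℝ => F (√2 * p.2) (√2 * p.1) :=
    hF.comp (by fun_prop : Measurable fun p : ℝ × ℝ => (√2 * p.2, √2 * p.1))
  have hm' : Measurable fun p : ℝ × ℝ => F (p.1 + p.2) (p.1 - p.2) :=
    hF.comp (by fun_prop : Measurable fun p : ℝ × ℝ => (p.1 + p.2, p.1 - p.2))
  rw [← lintegral_prod (fun p : ℝ × ℝ => F (√2 * p.2) (√2 * p.1)) hm.aemeasurable,
    ← lintegral_prod (fun p : ℝ × ℝ => F (p.1 + p.2) (p.1 - p.2)) hm'.aemeasurable]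
  nth_rw 2 [← hrot]
  rw [lintegral_map hm (by fun_prop)]
  refine lintegral_congr fun p => ?_
  have h2 : √2 * (√2 / 2) = 1 := by
    rw [← mul_div_assoc, Real.mul_self_sqrt (by norm_num)]; norm_num
  simp only [ContinuousLinearMap.rotation_apply, Real.cos_neg, Real.sin_neg,
    Real.cos_pi_div_four, Real.sin_pi_div_four, smul_eq_mul]
  congr 1
  · linear_combination (-p.1 - p.2) * h2
  · linear_combination (-p.1 + p.2) * h2

/-- The risk of the recommended estimator given the agent's own and the clean data. -/
lemma risk_weightedAverage_inner {σ : ℝ} (hσ : 0 < σ) (μ : ℝ) {k : ℕ} (hk : 0 < k) (q : ℕ)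
    (w : ℝ≥0) {x z : Dataset} (hx : x.size = k) (hz : z.size = k) :
    ∫⁻ z', ENNReal.ofReal ((weightedAverage σ x z z' w - μ) ^ 2)
        ∂gaussData μ (Real.toNNReal (σ ^ 2) + w) q =
      ENNReal.ofReal ((k ^ 2 * ((x.mean - μ) + (z.mean - μ)) ^ 2 / σ ^ 4 + q / (σ ^ 2 + w)) /
        (2 * k / σ ^ 2 + q / (σ ^ 2 + w)) ^ 2) := by
  have hvv : (Real.toNNReal (σ ^ 2) : ℝ) = σ ^ 2 := Real.coe_toNNReal _ (sq_nonneg σ)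
  have hk' : (0 : ℝ) < k := by exact_mod_cast hk
  have hw : (0 : ℝ) < σ ^ 2 + w := by positivity
  set D : ℝ := 2 * k / σ ^ 2 + q / (σ ^ 2 + w) with hD
  have hDpos : 0 < D := by positivity
  have h1 : ∫⁻ z', ENNReal.ofReal ((weightedAverage σ x z z' w - μ) ^ 2)
        ∂gaussData μ (Real.toNNReal (σ ^ 2) + w) q =
      ∫⁻ z', ENNReal.ofReal (((1 / σ ^ 2 * (x.total + z.total) / D - μ) +
        1 / (σ ^ 2 + w) / D * z'.total) ^ 2) ∂gaussData μ (Real.toNNReal (σ ^ 2) + w) q := by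
    refine lintegral_congr_ae ?_
    filter_upwards [ae_size_gaussData μ (Real.toNNReal (σ ^ 2) + w) q] with y hy
    have e1 : 1 / σ ^ 2 * ((k : ℝ) + k) + 1 / (σ ^ 2 + w) * q = D := by rw [hD]; ring
    congr 2
    rw [weightedAverage, hx, hz, hy, e1]
    ring
  have hxm : x.total = k * x.mean := by
    rw [Dataset.mean, hx]; field_simp
  have hzm : z.total = k * z.mean := by
    rw [Dataset.mean, hz]; field_simp
  rw [h1, lintegral_sq_affine_total]
  congr 1
  push_cast
  rw [hvv, hxm, hzm]
  -- The weights sum to one, so μ cancels and the conditional bias is carried by the sum of the two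
  -- centred means.
  have e2 : 1 / σ ^ 2 * (k * x.mean + k * z.mean) / D - μ + 1 / (σ ^ 2 + w) / D * (q * μ) =
      (k * ((x.mean - μ) + (z.mean - μ)) / σ ^ 2) / D := by
    have e3 : ∀ A B : ℝ, (A / D - μ + B / D * (q * μ)) * D = A - μ * D + B * (q * μ) := by
      intro A B
      field_simp
    rw [eq_div_iff hDpos.ne', e3, hD]
    field_simp
    ring
  rw [e2, div_pow, div_pow, mul_pow, ← pow_mul]
  field_simp

lemma lintegral_shift_gaussianReal (μ : ℝ) (s : ℝ≥0) {F : ℝ → ℝ≥0∞} (hF : Measurable F) :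
    ∫⁻ x, F (x - μ) ∂gaussianReal μ s = ∫⁻ x, F x ∂gaussianReal 0 s := by
  have h := gaussianReal_map_sub_const (μ := μ) (v := s) μ
  rw [sub_self] at h
  rw [← h, lintegral_map hF (by fun_prop)]

lemma lintegral_mean_mean_gaussData (μ : ℝ) (v : ℝ≥0) {k : ℕ} (hk : k ≠ 0)
    {F : ℝ → ℝ → ℝ≥0∞} (hF : Measurable fun p : ℝ × ℝ => F p.1 p.2) :
    ∫⁻ x, ∫⁻ z, F (x.mean - μ) (z.mean - μ) ∂gaussData μ v k ∂gaussData μ v k =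
      ∫⁻ x, ∫⁻ y, F x y ∂gaussianReal 0 (v / k) ∂gaussianReal 0 (v / k) := by
  have h1 : ∀ x : ℝ, ∫⁻ z, F x (z.mean - μ) ∂gaussData μ v k =
      ∫⁻ y, F x y ∂gaussianReal 0 (v / k) := by
    intro x
    have hx : Measurable (F x) := hF.comp (measurable_prodMk_left (x := x))
    have hx' : Measurable fun y => F x (y - μ) := hx.comp (measurable_id.sub_const μ)
    rw [lintegral_mean_gaussData μ v hk (F := fun y => F x (y - μ)) hx',
      lintegral_shift_gaussianReal μ _ hx]
  have hG : Measurable fun x => ∫⁻ y, F x y ∂gaussianReal 0 (v / k) := hF.lintegral_prod_right'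
  have hG' : Measurable fun x => ∫⁻ y, F (x - μ) y ∂gaussianReal 0 (v / k) := by
    have h := hG.comp (by fun_prop : Measurable fun x : ℝ => x - μ)
    simpa only [Function.comp_def] using h
  simp only [h1]
  rw [lintegral_mean_gaussData μ v hk
    (F := fun x => ∫⁻ y, F (x - μ) y ∂gaussianReal 0 (v / k)) hG',
    lintegral_shift_gaussianReal μ _ hG]

/-- The weights depend on the data only through the difference of the two clean means, while the
error involves these means only through their sum, which is independent of the difference. Given the
difference, the estimator is an optimally weighted average and its variance is the inverse of the
total precision. This is the lower bound for deviations at n = p = k. -/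
lemma risk_weightedAverage_corrupted {σ : ℝ} (hσ : 0 < σ) (a μ : ℝ) {k : ℕ} (hk : 0 < k) (q : ℕ) :
    ∫⁻ x, ∫⁻ z, ∫⁻ z', ENNReal.ofReal ((weightedAverage σ x z z' (noiseVar a x z) - μ) ^ 2)
        ∂gaussData μ (Real.toNNReal (σ ^ 2) + noiseVar a x z) q
        ∂gaussData μ (Real.toNNReal (σ ^ 2)) k ∂gaussData μ (Real.toNNReal (σ ^ 2)) k =
      ∫⁻ x, ENNReal.ofReal (1 / (2 * k / σ ^ 2 + q / (σ ^ 2 + a ^ 2 *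
        ((2 * σ ^ 2 / k) * x ^ 2)))) ∂gaussianReal 0 1 := by
  set v := Real.toNNReal (σ ^ 2) with hv
  have hvv : (v : ℝ) = σ ^ 2 := Real.coe_toNNReal _ (sq_nonneg σ)
  have hk' : (0 : ℝ) < k := by exact_mod_cast hk
  let F : ℝ → ℝ → ℝ≥0∞ := fun s d =>
    ENNReal.ofReal ((k ^ 2 * s ^ 2 / σ ^ 4 + q / (σ ^ 2 + a ^ 2 * d ^ 2)) /
        (2 * k / σ ^ 2 + q / (σ ^ 2 + a ^ 2 * d ^ 2)) ^ 2)
  have hF : Measurable fun p : ℝ × ℝ => F p.1 p.2 := by fun_prop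
  have hF' : Measurable fun p : ℝ × ℝ => F (p.1 + p.2) (p.1 - p.2) := by fun_prop
  have hinner : ∀ x : Dataset, x.size = k → ∫⁻ z, ∫⁻ z',
      ENNReal.ofReal ((weightedAverage σ x z z' (noiseVar a x z) - μ) ^ 2)
        ∂gaussData μ (v + noiseVar a x z) q ∂gaussData μ v k =
      ∫⁻ z, F ((x.mean - μ) + (z.mean - μ)) ((x.mean - μ) - (z.mean - μ)) ∂gaussData μ v k := by
    intro x hx
    refine lintegral_congr_ae ?_
    filter_upwards [ae_size_gaussData μ v k] with z hz
    rw [risk_weightedAverage_inner hσ μ hk q _ hx hz, coe_noiseVar, sub_sub_sub_cancel_right]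
  rw [lintegral_congr_ae ((ae_size_gaussData μ v k).mono hinner),
    lintegral_mean_mean_gaussData μ v hk.ne' (F := fun x y => F (x + y) (x - y)) hF',
    lintegral_sum_diff_gaussian _ hF]
  -- For fixed `d`, the variance σ²/k of `e` turns the numerator into 2k/σ² + E, which cancels one
  -- of the two factors in the denominator.
  have hin2 : ∀ d : ℝ, ∫⁻ e, F (√2 * e) (√2 * d) ∂gaussianReal 0 (v / k) =
      ENNReal.ofReal (1 / (2 * k / σ ^ 2 + q / (σ ^ 2 + a ^ 2 * (2 * d ^ 2)))) := by
    intro d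
    have hE : (0 : ℝ) ≤ q / (σ ^ 2 + a ^ 2 * (2 * d ^ 2)) := by positivity
    set E : ℝ := q / (σ ^ 2 + a ^ 2 * (2 * d ^ 2)) with hEdef
    have hDpos : 0 < 2 * k / σ ^ 2 + E := by positivity
    have e1 : ∀ e : ℝ, F (√2 * e) (√2 * d) =
        ENNReal.ofReal (2 * k ^ 2 / (σ ^ 4 * (2 * k / σ ^ 2 + E) ^ 2)) *
          ENNReal.ofReal ((0 - e) ^ 2) + ENNReal.ofReal (E / (2 * k / σ ^ 2 + E) ^ 2) := by
      intro e
      simp only [F]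
      rw [mul_pow, mul_pow, Real.sq_sqrt (by norm_num), ← hEdef,
        ← ENNReal.ofReal_mul (by positivity), ← ENNReal.ofReal_add (by positivity) (by positivity)]
      congr 1
      field_simp
      ring
    simp only [e1]
    rw [lintegral_add_right _ measurable_const, lintegral_const_mul _ (by fun_prop),
      lintegral_sq_sub_gaussianReal, lintegral_const, measure_univ, mul_one,
      ← ENNReal.ofReal_mul (by positivity), ← ENNReal.ofReal_add (by positivity) (by positivity)]
    congr 1
    push_cast
    rw [hvv]
    field_simp
    ring
  simp only [hin2]
  rw [lintegral_gaussianReal_zero_eq _ (by fun_prop)]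
  refine lintegral_congr fun x => ?_
  rw [mul_pow, Real.sq_sqrt (NNReal.coe_nonneg _)]
  push_cast
  rw [hvv, ← mul_assoc 2, mul_div_assoc 2 (σ ^ 2)]

/-! ### Gaussian averages of `1 / (1 + b x²)` -/

/-- The mean of `1 / (1 + b x²)` for standard Gaussian `x`. -/
def meanInv (b : ℝ) : ℝ := ∫ x, 1 / (1 + b * x ^ 2) ∂gaussianReal 0 1

/-- The mean of `1 / (1 + b x²)²` for standard Gaussian `x`. -/
def meanInvSq (b : ℝ) : ℝ := ∫ x, (1 / (1 + b * x ^ 2)) ^ 2 ∂gaussianReal 0 1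

lemma inv_one_add_mem {b : ℝ} (hb : 0 ≤ b) (x : ℝ) :
    0 < 1 / (1 + b * x ^ 2) ∧ 1 / (1 + b * x ^ 2) ≤ 1 := by
  have h : 0 ≤ b * x ^ 2 := by positivity
  exact ⟨by positivity, (div_le_one (by positivity)).2 (by linarith)⟩

lemma integrable_of_bounded {f : ℝ → ℝ} (hf : Measurable f) {C : ℝ} (h : ∀ x, |f x| ≤ C) :
    Integrable f (gaussianReal 0 1) :=
  Integrable.of_bound hf.aestronglyMeasurable C (Filter.Eventually.of_forall h)

lemma integrable_meanInv {b : ℝ} (hb : 0 ≤ b) :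
    Integrable (fun x : ℝ => 1 / (1 + b * x ^ 2)) (gaussianReal 0 1) := by
  refine integrable_of_bounded (by fun_prop) (C := 1) fun x => ?_
  rw [abs_of_pos (inv_one_add_mem hb x).1]
  exact (inv_one_add_mem hb x).2

lemma integrable_meanInvSq {b : ℝ} (hb : 0 ≤ b) :
    Integrable (fun x : ℝ => (1 / (1 + b * x ^ 2)) ^ 2) (gaussianReal 0 1) := by
  refine integrable_of_bounded (by fun_prop) (C := 1) fun x => ?_
  rw [abs_of_nonneg (sq_nonneg _)]
  exact pow_le_one₀ (inv_one_add_mem hb x).1.le (inv_one_add_mem hb x).2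

lemma integral_sq_gaussianReal : ∫ x, x ^ 2 ∂gaussianReal 0 1 = 1 := by
  have h := variance_fun_id_gaussianReal (μ := 0) (v := 1)
  rw [variance_eq_integral measurable_id'.aemeasurable] at h
  simpa [integral_id_gaussianReal] using h

lemma integrable_sq_gaussianReal : Integrable (fun x : ℝ => x ^ 2) (gaussianReal 0 1) :=
  (memLp_id_gaussianReal (μ := 0) (v := 1) 2).integrable_sq

lemma integral_exp_neg_sq_gaussianReal {s : ℝ} (hs : 0 ≤ s) :
    ∫ x, Real.exp (-(s * x ^ 2 / 2)) ∂gaussianReal 0 1 = 1 / √(1 + s) := by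
  rw [integral_gaussianReal_eq_integral_smul one_ne_zero]
  have h1 : (fun x : ℝ => gaussianPDFReal 0 1 x • Real.exp (-(s * x ^ 2 / 2))) =
      fun x => (√(2 * Real.pi))⁻¹ * Real.exp (-((1 + s) / 2) * x ^ 2) := by
    funext x
    simp only [gaussianPDFReal, smul_eq_mul, NNReal.coe_one, mul_one, sub_zero]
    rw [mul_assoc, ← Real.exp_add]
    congr 2
    ring
  rw [h1, integral_const_mul, integral_gaussian]
  have h2 : Real.pi / ((1 + s) / 2) = 2 * Real.pi / (1 + s) := by field_simp
  rw [h2, Real.sqrt_div (by positivity)]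
  have : √(2 * Real.pi) ≠ 0 := by positivity
  field_simp

/-- Represents 1/A as a mixture of exponentials. With A = 1 + bx² these become Gaussian in x, and
the parametrisation by t² − y² leaves the integrand of erfc once x is averaged out. -/
lemma lintegral_Ioi_exp_sq {y A : ℝ} (hy : 0 ≤ y) (hA : 0 < A) :
    ∫⁻ t in Set.Ioi y, ENNReal.ofReal (2 * t * Real.exp (-((t ^ 2 - y ^ 2) * A))) =
      ENNReal.ofReal (1 / A) := by
  have hderiv : ∀ t ∈ Set.Ici y, HasDerivAt (fun t => -(1 / A) * Real.exp (-((t ^ 2 - y ^ 2) * A)))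
      (2 * t * Real.exp (-((t ^ 2 - y ^ 2) * A))) t := by
    intro t _
    have h1 : HasDerivAt (fun t : ℝ => -((t ^ 2 - y ^ 2) * A)) (-((2 * t) * A)) t := by
      convert! (((hasDerivAt_pow 2 t).sub_const (y ^ 2)).mul_const A).neg using 1
      simp
    convert! (h1.exp.const_mul (-(1 / A))) using 1
    field_simp
  have hpos : ∀ t ∈ Set.Ioi y, 0 ≤ 2 * t * Real.exp (-((t ^ 2 - y ^ 2) * A)) := by
    intro t ht
    have : 0 < t := lt_of_le_of_lt hy ht
    positivity
  have hlim : Filter.Tendsto (fun t => -(1 / A) * Real.exp (-((t ^ 2 - y ^ 2) * A)))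
      Filter.atTop (nhds 0) := by
    have h1 : Filter.Tendsto (fun t : ℝ => (t ^ 2 - y ^ 2) * A) Filter.atTop Filter.atTop :=
      (Filter.tendsto_atTop_add_const_right _ _
        (Filter.tendsto_pow_atTop two_ne_zero)).atTop_mul_const hA
    have h2 := (Real.tendsto_exp_neg_atTop_nhds_zero.comp h1).const_mul (-(1 / A))
    rw [mul_zero] at h2
    exact h2
  have hint := integrableOn_Ioi_deriv_of_nonneg' hderiv hpos hlim
  have hval := integral_Ioi_of_hasDerivAt_of_nonneg' hderiv hpos hlim
  rw [← ofReal_integral_eq_lintegral_ofReal hint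
    ((ae_restrict_iff' measurableSet_Ioi).2 (Filter.Eventually.of_forall hpos)), hval]
  congr 1
  simp

/-- The mean of `1 / (1 + x² / (2 y²))` in terms of the complementary error function. -/
lemma meanInv_eq_erfc {y : ℝ} (hy : 0 < y) :
    meanInv (1 / (2 * y ^ 2)) = √Real.pi * y * Real.exp (y ^ 2) * erfc y := by
  have hb : 0 ≤ 1 / (2 * y ^ 2) := by positivity
  have hexp : Integrable (fun t : ℝ => Real.exp (-t ^ 2)) := by
    simpa using integrable_exp_neg_mul_sq (b := 1) one_pos
  have hR : 0 ≤ 2 * y * Real.exp (y ^ 2) * ∫ t in Set.Ioi y, Real.exp (-t ^ 2) := by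
    have : 0 ≤ ∫ t in Set.Ioi y, Real.exp (-t ^ 2) := integral_nonneg fun t => by positivity
    positivity
  -- Everything is nonnegative, so the exchange of integrals is made in `ℝ≥0∞`, where no
  -- integrability is needed.
  have key : ENNReal.ofReal (meanInv (1 / (2 * y ^ 2))) =
      ENNReal.ofReal (2 * y * Real.exp (y ^ 2) * ∫ t in Set.Ioi y, Real.exp (-t ^ 2)) := by
    calc ENNReal.ofReal (meanInv (1 / (2 * y ^ 2)))
        = ∫⁻ x, ENNReal.ofReal (1 / (1 + 1 / (2 * y ^ 2) * x ^ 2)) ∂gaussianReal 0 1 :=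
          ofReal_integral_eq_lintegral_ofReal (integrable_meanInv hb)
            (Filter.Eventually.of_forall fun x => (inv_one_add_mem hb x).1.le)
      _ = ∫⁻ x, (∫⁻ t in Set.Ioi y, ENNReal.ofReal (2 * t *
            Real.exp (-((t ^ 2 - y ^ 2) * (1 + 1 / (2 * y ^ 2) * x ^ 2))))) ∂gaussianReal 0 1 :=
          lintegral_congr fun x => (lintegral_Ioi_exp_sq hy.le (by positivity)).symm
      _ = ∫⁻ t in Set.Ioi y, ∫⁻ x, ENNReal.ofReal (2 * t *
            Real.exp (-((t ^ 2 - y ^ 2) * (1 + 1 / (2 * y ^ 2) * x ^ 2)))) ∂gaussianReal 0 1 :=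
          lintegral_lintegral_swap (f := fun x t => ENNReal.ofReal (2 * t *
            Real.exp (-((t ^ 2 - y ^ 2) * (1 + 1 / (2 * y ^ 2) * x ^ 2)))))
            (Measurable.aemeasurable (by fun_prop))
      _ = ∫⁻ t in Set.Ioi y, ENNReal.ofReal (2 * y * Real.exp (y ^ 2) * Real.exp (-t ^ 2)) := by
          refine setLIntegral_congr_fun measurableSet_Ioi fun t ht => ?_
          have ht0 : 0 < t := hy.trans ht
          -- With this s one has 1 + s = (t/y)², so the Gaussian average contributes y/t and cancels
          -- the factor t.
          have hs : 0 ≤ (t ^ 2 - y ^ 2) / y ^ 2 :=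
            div_nonneg (by nlinarith [Set.mem_Ioi.1 ht]) (by positivity)
          have h1 : (fun x : ℝ => 2 * t *
              Real.exp (-((t ^ 2 - y ^ 2) * (1 + 1 / (2 * y ^ 2) * x ^ 2)))) = fun x =>
              2 * t * Real.exp (y ^ 2 - t ^ 2) *
                Real.exp (-((t ^ 2 - y ^ 2) / y ^ 2 * x ^ 2 / 2)) := by
            funext x
            rw [mul_assoc (2 * t), ← Real.exp_add]
            congr 2
            field_simp
            ring
          have h2 : Integrable (fun x : ℝ => Real.exp (-((t ^ 2 - y ^ 2) / y ^ 2 * x ^ 2 / 2)))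
              (gaussianReal 0 1) := by
            refine integrable_of_bounded (by fun_prop) (C := 1) fun x => ?_
            rw [abs_of_pos (Real.exp_pos _), Real.exp_le_one_iff]
            have : 0 ≤ (t ^ 2 - y ^ 2) / y ^ 2 * x ^ 2 / 2 := by positivity
            linarith
          have h3 : √(1 + (t ^ 2 - y ^ 2) / y ^ 2) = t / y := by
            rw [← Real.sqrt_sq (by positivity : 0 ≤ t / y)]
            congr 1
            field_simp
            ring
          rw [← ofReal_integral_eq_lintegral_ofReal (by rw [h1]; exact h2.const_mul _)
            (Filter.Eventually.of_forall fun x => by positivity), h1, integral_const_mul,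
            integral_exp_neg_sq_gaussianReal hs, h3, sub_eq_add_neg, Real.exp_add]
          congr 1
          field_simp
      _ = _ := by
          rw [← integral_const_mul, ← ofReal_integral_eq_lintegral_ofReal
            (hexp.restrict.const_mul _) (Filter.Eventually.of_forall fun t => by positivity)]
  have hI : 0 ≤ meanInv (1 / (2 * y ^ 2)) := integral_nonneg fun x => (inv_one_add_mem hb x).1.le
  rw [(ENNReal.ofReal_eq_ofReal_iff hI hR).1 key, erfc]
  have : √Real.pi ≠ 0 := by positivity
  field_simp

/-- Integration by parts: the relation between the two averages. -/
lemma meanInvSq_eq {b : ℝ} (hb : 0 < b) :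
    2 * meanInvSq b - meanInv b = (1 - meanInv b) / b := by
  have hφ : ∀ x, HasDerivAt (gaussianPDFReal 0 1) (-x * gaussianPDFReal 0 1 x) x := by
    intro x
    have h1 : HasDerivAt (fun x : ℝ => -(x - 0) ^ 2 / (2 * ((1 : ℝ≥0) : ℝ))) (-x) x := by
      have := ((((hasDerivAt_id x).sub_const 0).pow 2).neg).div_const (2 * ((1 : ℝ≥0) : ℝ))
      convert! this using 1
      simp
      ring
    have h2 := h1.exp.const_mul ((√(2 * Real.pi * ((1 : ℝ≥0) : ℝ)))⁻¹)
    convert! h2 using 1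
    simp only [gaussianPDFReal]
    ring
  have hpos : ∀ x : ℝ, 0 < 1 + b * x ^ 2 := fun x => by positivity
  have hg : ∀ x, HasDerivAt (fun x : ℝ => x / (1 + b * x ^ 2))
      (2 * (1 / (1 + b * x ^ 2)) ^ 2 - 1 / (1 + b * x ^ 2)) x := by
    intro x
    have h1 : HasDerivAt (fun x : ℝ => 1 + b * x ^ 2) (b * (2 * x)) x := by
      have := ((hasDerivAt_pow 2 x).const_mul b).const_add 1
      simpa using this
    convert! (hasDerivAt_id x).div h1 (hpos x).ne' using 1
    have := (hpos x).ne'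
    simp only [id]
    field_simp
    ring
  -- Uses φ' = −xφ for the Gaussian density and x²/(1 + bx²) = (1 − 1/(1 + bx²))/b. The integral of
  -- this derivative vanishes, which is the claim.
  have hder : ∀ x, HasDerivAt (fun x => gaussianPDFReal 0 1 x * (x / (1 + b * x ^ 2)))
      (gaussianPDFReal 0 1 x * (2 * (1 / (1 + b * x ^ 2)) ^ 2 - 1 / (1 + b * x ^ 2) -
        1 / b * (1 - 1 / (1 + b * x ^ 2)))) x := by
    intro x
    convert! (hφ x).mul (hg x) using 1
    have := (hpos x).ne'
    field_simp
    ring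
  have hint : ∀ f : ℝ → ℝ, Measurable f → ∀ C : ℝ, (∀ x, |f x| ≤ C) →
      Integrable fun x => gaussianPDFReal 0 1 x * f x := by
    intro f hf C hC
    exact (integrable_gaussianPDFReal 0 1).mul_bdd hf.aestronglyMeasurable
      (Filter.Eventually.of_forall hC)
  have hbd : ∀ x : ℝ, |x / (1 + b * x ^ 2)| ≤ 1 + 1 / b := by
    intro x
    rw [abs_div, abs_of_pos (hpos x), div_le_iff₀ (hpos x)]
    have h1 : (1 + 1 / b) * (1 + b * x ^ 2) = 1 + 1 / b + b * x ^ 2 + x ^ 2 := by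
      field_simp
      ring
    have h2 : |x| ≤ 1 + x ^ 2 := by
      rw [← sq_abs]; nlinarith [sq_nonneg (|x| - 1), abs_nonneg x]
    have h3 : 0 ≤ 1 / b + b * x ^ 2 := by positivity
    rw [h1]
    linarith
  have hbd2 : ∀ x : ℝ, |2 * (1 / (1 + b * x ^ 2)) ^ 2 - 1 / (1 + b * x ^ 2) -
      1 / b * (1 - 1 / (1 + b * x ^ 2))| ≤ 3 + 1 / b := by
    intro x
    obtain ⟨h1, h2⟩ := inv_one_add_mem hb.le x
    set u := 1 / (1 + b * x ^ 2)
    have h3 : u ^ 2 ≤ 1 := pow_le_one₀ h1.le h2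
    have h4 : 0 < 1 / b := by positivity
    have h5 : 0 ≤ 1 / b * (1 - u) := mul_nonneg h4.le (by linarith)
    have h6 : 1 / b * (1 - u) ≤ 1 / b := by nlinarith
    have h7 := sq_nonneg u
    rw [abs_le]
    constructor <;> linarith
  have hzero := integral_eq_zero_of_hasDerivAt_of_integrable hder
    (hint _ (by fun_prop) _ hbd2) (hint _ (by fun_prop) _ hbd)
  have h1 := integral_gaussianReal_eq_integral_smul (μ := 0) (v := 1) one_ne_zero
    (f := fun x : ℝ => 2 * (1 / (1 + b * x ^ 2)) ^ 2 - 1 / (1 + b * x ^ 2) -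
        1 / b * (1 - 1 / (1 + b * x ^ 2)))
  simp only [smul_eq_mul] at h1
  rw [hzero] at h1
  have hI := integrable_meanInv hb.le
  have hJ := integrable_meanInvSq hb.le
  have hJI : Integrable (fun x : ℝ => 2 * (1 / (1 + b * x ^ 2)) ^ 2 - 1 / (1 + b * x ^ 2))
      (gaussianReal 0 1) := (hJ.const_mul 2).sub hI
  have hI1 : Integrable (fun x : ℝ => 1 / b * (1 - 1 / (1 + b * x ^ 2)))
      (gaussianReal 0 1) := ((integrable_const 1).sub hI).const_mul _
  rw [integral_sub hJI hI1, integral_sub (hJ.const_mul 2) hI, integral_const_mul,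
    integral_const_mul,
    integral_sub (integrable_const 1) hI] at h1
  simp only [integral_const, probReal_univ, smul_eq_mul, mul_one] at h1
  change 2 * meanInvSq b - meanInv b - 1 / b * (1 - meanInv b) = 0 at h1
  rw [div_eq_mul_one_div]
  linarith

/-- Jensen's inequality for t ↦ 1/t at t = 1 + bx², whose mean is 1 + b; the tangent at 1 + b is
written out. -/
lemma meanInv_ge {b : ℝ} (hb : 0 ≤ b) : 1 / (1 + b) ≤ meanInv b := by
  have hpt : ∀ x : ℝ, 2 * (1 / (1 + b)) - (1 / (1 + b)) ^ 2 * (1 + b * x ^ 2) ≤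
      1 / (1 + b * x ^ 2) := by
    intro x
    have hp : 0 < 1 + b * x ^ 2 := by positivity
    rw [le_div_iff₀ hp]
    nlinarith [sq_nonneg (1 / (1 + b) * (1 + b * x ^ 2) - 1)]
  have hi : Integrable (fun x : ℝ => (1 / (1 + b)) ^ 2 * (1 + b * x ^ 2)) (gaussianReal 0 1) :=
    ((integrable_const _).add (integrable_sq_gaussianReal.const_mul b)).const_mul _
  have h := integral_mono ((integrable_const _).sub hi) (integrable_meanInv hb) hpt
  have hi2 : ∫ x, (1 + b * x ^ 2) ∂gaussianReal 0 1 = 1 + b := by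
    rw [integral_add (integrable_const _) (integrable_sq_gaussianReal.const_mul b),
      integral_const_mul, integral_sq_gaussianReal]
    simp
  rw [integral_sub' (integrable_const _) hi, integral_const_mul ((1 / (1 + b)) ^ 2), hi2] at h
  simp only [integral_const, probReal_univ, smul_eq_mul, one_mul] at h
  refine le_trans (le_of_eq ?_) h
  field_simp
  ring

/-- The tangent of the square at 1/(1 + b) reduces this to the bound on `meanInv`. -/
lemma meanInvSq_ge {b : ℝ} (hb : 0 ≤ b) : (1 / (1 + b)) ^ 2 ≤ meanInvSq b := by
  have hI := integrable_meanInv hb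
  have h := integral_mono ((hI.const_mul (2 * (1 / (1 + b)))).sub
    (integrable_const ((1 / (1 + b)) ^ 2))) (integrable_meanInvSq hb) fun x => by
      simp only [Pi.sub_apply]
      nlinarith [sq_nonneg (1 / (1 + b * x ^ 2) - 1 / (1 + b))]
  simp only [Pi.sub_apply] at h
  rw [integral_sub (hI.const_mul _) (integrable_const _), integral_const_mul] at h
  simp only [integral_const, probReal_univ, smul_eq_mul, one_mul] at h
  change 2 * (1 / (1 + b)) * meanInv b - (1 / (1 + b)) ^ 2 ≤ meanInvSq b at h
  have h1 := meanInv_ge hb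
  have h2 : 0 < 1 / (1 + b) := by positivity
  nlinarith

lemma meanInvSq_le {b : ℝ} (hb : 0 ≤ b) : meanInvSq b ≤ meanInv b := by
  refine integral_mono (integrable_meanInvSq hb) (integrable_meanInv hb) fun x => ?_
  obtain ⟨h1, h2⟩ := inv_one_add_mem hb x
  nlinarith

lemma continuous_meanInv_comp {g : ℝ → ℝ} (hg : Continuous g) (hg0 : ∀ a, 0 ≤ g a) :
    Continuous fun a => meanInv (g a) := by
  refine continuous_of_dominated (bound := fun _ => 1)
    (fun a => Measurable.aestronglyMeasurable (by fun_prop)) (fun a => ?_)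
    (integrable_const 1) (Filter.Eventually.of_forall fun x => ?_)
  · refine Filter.Eventually.of_forall fun x => ?_
    rw [Real.norm_eq_abs, abs_of_pos (inv_one_add_mem (hg0 a) x).1]
    exact (inv_one_add_mem (hg0 a) x).2
  · refine continuous_const.div (by fun_prop) fun a => ?_
    have := hg0 a
    positivity

lemma continuous_meanInvSq_comp {g : ℝ → ℝ} (hg : Continuous g) (hg0 : ∀ a, 0 ≤ g a) :
    Continuous fun a => meanInvSq (g a) := by
  refine continuous_of_dominated (bound := fun _ => 1)
    (fun a => Measurable.aestronglyMeasurable (by fun_prop)) (fun a => ?_)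
    (integrable_const 1) (Filter.Eventually.of_forall fun x => ?_)
  · refine Filter.Eventually.of_forall fun x => ?_
    rw [Real.norm_eq_abs, abs_of_nonneg (sq_nonneg _)]
    exact pow_le_one₀ (inv_one_add_mem (hg0 a) x).1.le (inv_one_add_mem (hg0 a) x).2
  · refine (continuous_const.div (by fun_prop) fun a => ?_).pow 2
    have := hg0 a
    positivity

lemma tendsto_meanInv : Filter.Tendsto (fun j : ℕ => meanInv j) Filter.atTop (nhds 0) := by
  have h := tendsto_integral_of_dominated_convergence (μ := gaussianReal 0 1)
    (F := fun (j : ℕ) (x : ℝ) => 1 / (1 + (j : ℝ) * x ^ 2)) (f := fun _ => 0) (fun _ => 1)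
    (fun j => Measurable.aestronglyMeasurable (by fun_prop)) (integrable_const 1)
    (fun j => Filter.Eventually.of_forall fun x => by
      rw [Real.norm_eq_abs, abs_of_pos (inv_one_add_mem j.cast_nonneg x).1]
      exact (inv_one_add_mem j.cast_nonneg x).2) ?_
  · simpa [meanInv] using h
  · have := nullSingletonClass_gaussianReal (μ := 0) (v := 1) one_ne_zero
    have hne : ∀ᵐ x ∂gaussianReal 0 1, x ≠ 0 := by simp [ae_iff]
    filter_upwards [hne] with x hx
    have h1 : Filter.Tendsto (fun j : ℕ => (j : ℝ) * x ^ 2) Filter.atTop Filter.atTop :=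
      tendsto_natCast_atTop_atTop.atTop_mul_const (by positivity)
    exact tendsto_const_nhds.div_atTop (Filter.tendsto_atTop_add_const_left _ _ h1)

/-! ### The equation defining `α` -/

lemma sqrt_mul_rpow_quarter_sq {σ x : ℝ} (hσ : 0 ≤ σ) (hx : 0 ≤ x) :
    (√σ * x ^ (1 / 4 : ℝ)) ^ 2 = σ * √x := by
  rw [mul_pow, Real.sq_sqrt hσ, Real.sqrt_eq_rpow, ← Real.rpow_natCast, ← Real.rpow_mul hx]
  norm_num

lemma mul_sqrt_div_eq {σ c m : ℝ} (hc : 0 < c) (hm : 0 < m) :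
    σ * √(m / c) = m * (σ / √(c * m)) := by
  have h1 : √(m / c) * √(c * m) = m := by
    rw [← Real.sqrt_mul (by positivity)]
    have : m / c * (c * m) = m ^ 2 := by field_simp
    rw [this, Real.sqrt_sq hm.le]
  have h2 : √(c * m) ≠ 0 := by positivity
  rw [← mul_div_assoc, eq_div_iff h2, mul_assoc, h1, mul_comm]

/-- With y the argument of erfc and b = 1/(2y²), the erfc term is a multiple of the mean of 1/(1 +
bx²), and integration by parts introduces the mean of its square. What is left is the first-order
condition for the sample size, up to a nonzero factor. -/
lemma G_eq {σ c : ℝ} (hσ : 0 < σ) (hc : 0 < c) {m : ℕ} (hm : 4 < m) {a : ℝ} (ha : 0 < a) :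
    ∃ C : ℝ, C ≠ 0 ∧ G σ c m a = C * (((m : ℝ) - 4) / (m - 2) -
      (meanInv (4 * a ^ 2 / (m * (σ / √(c * m)))) +
        2 / m * meanInvSq (4 * a ^ 2 / (m * (σ / √(c * m)))))) := by
  have hm' : (4 : ℝ) < m := by exact_mod_cast hm
  set k : ℝ := σ / √(c * m) with hk
  have hkpos : 0 < k := by positivity
  set Q : ℝ := √σ * ((m : ℝ) / c) ^ (1 / 4 : ℝ) with hQ
  have hQpos : 0 < Q := by positivity
  have hmk : σ * √((m : ℝ) / c) = m * k := mul_sqrt_div_eq hc (by linarith)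
  have hQ2 : Q ^ 2 = m * k := by rw [hQ, sqrt_mul_rpow_quarter_sq hσ.le (by positivity), hmk]
  have hs2 : √2 ^ 2 = (2 : ℝ) := Real.sq_sqrt (by norm_num)
  have hs2' : √(2 : ℝ) ≠ 0 := by positivity
  set y : ℝ := Q / (2 * √2 * a) with hy
  have hypos : 0 < y := by positivity
  have hy2 : y ^ 2 = m * k / (8 * a ^ 2) := by
    rw [hy, div_pow, hQ2, mul_pow, mul_pow, hs2]; ring
  set b : ℝ := 4 * a ^ 2 / (m * k) with hb
  have hbpos : 0 < b := by positivity
  have hby : 1 / (2 * y ^ 2) = b := by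
    rw [hy2, hb]; field_simp; norm_num
  have hI := meanInv_eq_erfc hypos
  rw [hby] at hI
  have hJ := meanInvSq_eq hbpos
  have hJ' : meanInvSq b = (meanInv b + (1 - meanInv b) / b) / 2 := by linarith
  have hay : 4 * a / Q = √2 / y := by
    rw [hy]; field_simp; rw [hs2]; ring
  have herfc : √(2 * Real.pi) * Real.exp (y ^ 2) * erfc y = 4 * a / Q * meanInv b := by
    rw [hI, hay, Real.sqrt_mul (by norm_num)]
    field_simp
  refine ⟨4 * a / Q * (4 * a ^ 2 / k), by positivity, ?_⟩
  have hm2 : (m : ℝ) - 2 ≠ 0 := by linarith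
  have hm0 : (m : ℝ) ≠ 0 := by linarith
  rw [G, hmk, ← hk, ← hy2, ← hQ, ← hy, mul_assoc, mul_assoc, ← mul_assoc √(2 * Real.pi), herfc,
    hJ', hb]
  field_simp
  ring

lemma sqrt_mul_rpow_neg_quarter {σ x : ℝ} (hσ : 0 ≤ σ) (hx : 0 ≤ x) :
    √σ * x ^ (-(1 / 4) : ℝ) = √(σ / √x) := by
  rw [Real.sqrt_div hσ, Real.sqrt_eq_rpow x, Real.sqrt_eq_rpow (x ^ _), ← Real.rpow_mul hx,
    Real.rpow_neg hx, div_eq_mul_inv]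
  norm_num [div_eq_mul_inv]

/-- At the lower end of the admissible range the averages are too large. -/
lemma lt_meanInv_add_meanInvSq {m : ℝ} (hm : 4 < m) :
    (m - 4) / (m - 2) < meanInv (4 / m) + 2 / m * meanInvSq (4 / m) := by
  have h1 := meanInv_ge (b := 4 / m) (by positivity)
  have h2 := meanInvSq_ge (b := 4 / m) (by positivity)
  have h3 : 1 / (1 + 4 / m) = m / (m + 4) := by field_simp
  rw [h3] at h1 h2
  have h4 : 2 / m * (m / (m + 4)) ^ 2 ≤ 2 / m * meanInvSq (4 / m) := by gcongr
  have h5 : (m - 4) / (m - 2) < m / (m + 4) + 2 / m * (m / (m + 4)) ^ 2 := by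
    have h6 : m / (m + 4) + 2 / m * (m / (m + 4)) ^ 2 = m * (m + 6) / (m + 4) ^ 2 := by
      field_simp; ring
    rw [h6, div_lt_div_iff₀ (by linarith) (by positivity)]
    -- After cross-multiplication the two sides differ by 4m + 64.
    nlinarith
  linarith

lemma isLeast_admissibleRoots {σ c : ℝ} (hσ : 0 < σ) (hc : 0 < c) {m : ℕ} (hm : 4 < m) :
    IsLeast (admissibleRoots σ c m) (alpha σ c m) := by
  have hm' : (4 : ℝ) < m := by exact_mod_cast hm
  set k : ℝ := σ / √(c * m) with hk
  have hkpos : 0 < k := by positivity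
  have hsk : 0 < √k := Real.sqrt_pos.2 hkpos
  let H : ℝ → ℝ := fun a => meanInv (4 * a ^ 2 / (m * k)) + 2 / m * meanInvSq (4 * a ^ 2 / (m * k))
  have hH : Continuous H :=
    (continuous_meanInv_comp (by fun_prop) fun a => by positivity).add
      ((continuous_meanInvSq_comp (by fun_prop) fun a => by positivity).const_mul _)
  have hlow : ((m : ℝ) - 4) / (m - 2) < H √k := by
    have h1 : 4 * √k ^ 2 / (m * k) = 4 / m := by
      rw [Real.sq_sqrt hkpos.le]; field_simp
    simp only [H, h1]
    exact lt_meanInv_add_meanInvSq hm'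
  -- `H` is strictly above the target at √k, so √k is not a root and the open half-line may be
  -- replaced by the closed one. The set of roots is then closed and bounded below, and attains its
  -- infimum once it is nonempty.
  have hset : admissibleRoots σ c m = Set.Ici √k ∩ H ⁻¹' {((m : ℝ) - 4) / (m - 2)} := by
    ext a
    simp only [admissibleRoots, Set.mem_ofPred_eq, Set.mem_inter_iff, Set.mem_Ici,
      Set.mem_preimage, Set.mem_singleton_iff]
    rw [sqrt_mul_rpow_neg_quarter hσ.le (by positivity), ← hk]
    constructor
    · rintro ⟨h1, h2⟩
      obtain ⟨C, hC, hG⟩ := G_eq hσ hc hm (hsk.trans h1)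
      rw [hG, mul_eq_zero, or_iff_right hC, sub_eq_zero] at h2
      exact ⟨h1.le, h2.symm⟩
    · rintro ⟨h1, h2⟩
      have h3 : √k ≠ a := by
        rintro rfl
        exact hlow.ne' h2
      obtain ⟨C, hC, hG⟩ := G_eq hσ hc hm (hsk.trans_le h1)
      refine ⟨lt_of_le_of_ne h1 h3, ?_⟩
      rw [hG, mul_eq_zero, or_iff_right hC, sub_eq_zero]
      exact h2.symm
  have hne : (Set.Ici √k ∩ H ⁻¹' {((m : ℝ) - 4) / (m - 2)}).Nonempty := by
    -- Since `meanInvSq` is at most `meanInv`, `H` falls below the target as soon as (1 + 2/m)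
    -- `meanInv` does.
    have hε : 0 < ((m : ℝ) - 4) / (m - 2) / (1 + 2 / m) :=
      div_pos (div_pos (by linarith) (by linarith)) (by positivity)
    obtain ⟨j, hj1, hj2⟩ := ((tendsto_meanInv.eventually_lt_const hε).and
      (Filter.eventually_ge_atTop 1)).exists
    have hj : (1 : ℝ) ≤ j := by exact_mod_cast hj2
    -- The point at which the argument of `meanInv` in `H` equals `j`.
    have h1 : 4 * √(j * (m * k) / 4) ^ 2 / (m * k) = j := by
      rw [Real.sq_sqrt (by positivity)]; field_simp
    have h2 : √k ≤ √(j * (m * k) / 4) := by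
      refine Real.sqrt_le_sqrt ?_
      rw [le_div_iff₀ (by norm_num)]
      have : 4 * k ≤ m * k := by gcongr
      nlinarith
    have hup : H √(j * (m * k) / 4) ≤ ((m : ℝ) - 4) / (m - 2) := by
      simp only [H, h1]
      rw [lt_div_iff₀ (by positivity)] at hj1
      have h3 : 2 / (m : ℝ) * meanInvSq j ≤ 2 / m * meanInv j := by
        gcongr
        exact meanInvSq_le j.cast_nonneg
      linarith
    obtain ⟨a, ha, hHa⟩ := intermediate_value_Icc' h2 hH.continuousOn ⟨hup, hlow.le⟩
    exact ⟨a, ha.1, hHa⟩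
  rw [alpha, hset]
  exact (isClosed_Ici.inter (isClosed_singleton.preimage hH)).isLeast_csInf hne
    ⟨√k, fun a ha => ha.1⟩

lemma alpha_pos {σ c : ℝ} (hσ : 0 < σ) (hc : 0 < c) {m : ℕ} (hm : 4 < m) : 0 < alpha σ c m := by
  have h := (isLeast_admissibleRoots hσ hc hm).1.1
  exact lt_of_le_of_lt (by positivity) h

lemma alpha_equation {σ c : ℝ} (hσ : 0 < σ) (hc : 0 < c) {m : ℕ} (hm : 4 < m) :
    meanInv (4 * alpha σ c m ^ 2 / (m * (σ / √(c * m)))) +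
      2 / m * meanInvSq (4 * alpha σ c m ^ 2 / (m * (σ / √(c * m)))) =
        ((m : ℝ) - 4) / (m - 2) := by
  obtain ⟨C, hC, hG⟩ := G_eq hσ hc hm (alpha_pos hσ hc hm)
  rw [(isLeast_admissibleRoots hσ hc hm).1.2] at hG
  have h := (mul_eq_zero.1 hG.symm).resolve_left hC
  linarith

/-! ### Optimality of the recommended sample size -/

/-- The posterior variance is convex in the sample size: it lies above its tangent at the
recommended size. Here `s` is the ratio of the sample size to the recommended one. -/
lemma tangent_le_posterior {M W s : ℝ} (hM : 2 ≤ M) (hW : 0 ≤ W) (hs : 0 < s) :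
    (1 / 2 - (M - 2) / (2 * M) * (1 / (1 + 4 * W / M))) -
      (1 / 4 - (M - 2) / (4 * M) * (1 / (1 + 4 * W / M)) -
        (M - 2) / (2 * M ^ 2) * (1 / (1 + 4 * W / M)) ^ 2) * (s - 1) ≤
      1 / (s + 1 + (M - 2) / (1 + W * (1 + 1 / s))) := by
  have hM0 : 0 < M := by linarith
  have hM2 : 0 ≤ M - 2 := by linarith
  have hq1 : 0 < 2 + (M - 2) / (1 + 2 * W) := by positivity
  have hq : 0 < s + 1 + (M - 2) / (1 + W * (1 + 1 / s)) := by positivity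
  have hy : 0 < M + 4 * W := by positivity
  -- Value and slope at s = 1 are expressed through 1/(1 + 4W/M), because the Gaussian means of this
  -- quantity and of its square are the ones controlled by the equation for α.
  have h1 : 1 / 2 - (M - 2) / (2 * M) * (1 / (1 + 4 * W / M)) =
      1 / (2 + (M - 2) / (1 + 2 * W)) := by
    have e : 2 + (M - 2) / (1 + 2 * W) = (M + 4 * W) / (1 + 2 * W) := by field_simp; ring
    rw [e, one_div_div]
    field_simp
    ring
  have h2 : 1 / 4 - (M - 2) / (4 * M) * (1 / (1 + 4 * W / M)) -
        (M - 2) / (2 * M ^ 2) * (1 / (1 + 4 * W / M)) ^ 2 =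
      (1 + (M - 2) * (W / (1 + 2 * W) ^ 2)) / (2 + (M - 2) / (1 + 2 * W)) ^ 2 := by
    have e : 2 + (M - 2) / (1 + 2 * W) = (M + 4 * W) / (1 + 2 * W) := by field_simp; ring
    rw [e]
    field_simp
    ring
  -- The precision contributed by the corrupted data is concave in s, hence below its tangent.
  have hconc : 1 / (1 + W * (1 + 1 / s)) ≤ 1 / (1 + 2 * W) + W / (1 + 2 * W) ^ 2 * (s - 1) := by
    have hd : 0 < s + W * (s + 1) := by positivity
    have e : 1 / (1 + 2 * W) + W / (1 + 2 * W) ^ 2 * (s - 1) - 1 / (1 + W * (1 + 1 / s)) =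
        W * (1 + W) * (s - 1) ^ 2 / ((1 + 2 * W) ^ 2 * (s + W * (s + 1))) := by
      field_simp
      ring
    have : 0 ≤ W * (1 + W) * (s - 1) ^ 2 / ((1 + 2 * W) ^ 2 * (s + W * (s + 1))) := by positivity
    linarith
  rw [h1, h2]
  set q1 := 2 + (M - 2) / (1 + 2 * W) with hq1def
  set q := s + 1 + (M - 2) / (1 + W * (1 + 1 / s)) with hqdef
  have hqle : q ≤ q1 + (1 + (M - 2) * (W / (1 + 2 * W) ^ 2)) * (s - 1) := by
    have h := mul_le_mul_of_nonneg_left hconc hM2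
    rw [hqdef, hq1def, div_eq_mul_one_div (M - 2) (1 + W * (1 + 1 / s)),
      div_eq_mul_one_div (M - 2) (1 + 2 * W)]
    linarith
  -- The other half of the argument: 1/q is decreasing and lies above its tangent (2q₁ − q)/q₁² at
  -- q₁.
  have h3 : 1 / q1 - (1 + (M - 2) * (W / (1 + 2 * W) ^ 2)) / q1 ^ 2 * (s - 1) ≤
      (2 * q1 - q) / q1 ^ 2 := by
    rw [le_div_iff₀ (by positivity)]
    have e : (1 / q1 - (1 + (M - 2) * (W / (1 + 2 * W) ^ 2)) / q1 ^ 2 * (s - 1)) * q1 ^ 2 =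
        q1 - (1 + (M - 2) * (W / (1 + 2 * W) ^ 2)) * (s - 1) := by
      field_simp
    rw [e]
    linarith
  refine h3.trans ?_
  rw [div_le_div_iff₀ (by positivity) hq]
  nlinarith [sq_nonneg (q - q1)]

/-- The penalty under the recommended profile when there are more than four agents. -/
def recommendedPenalty (σ c : ℝ) (m : ℕ) (k : ℝ) : ℝ :=
  σ ^ 2 / k * (1 / 2 - ((m : ℝ) - 2) / (2 * m) * meanInv (4 * alpha σ c m ^ 2 / (m * k))) + c * k

lemma size_pos_of_many {σ c : ℝ} (hσ : 0 < σ) (hc : 0 < c) {m : ℕ} (hm : 4 < m) {k : ℕ}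
    (hk : σ / √(c * m) = k) : (0 : ℝ) < k := by
  have hm' : (4 : ℝ) < m := by exact_mod_cast hm
  rw [← hk]
  positivity

lemma sigma_sq_eq {σ c : ℝ} (hσ : 0 < σ) (hc : 0 < c) {m : ℕ} (hm : 4 < m) {k : ℕ}
    (hk : σ / √(c * m) = k) : σ ^ 2 = m * c * (k : ℝ) ^ 2 := by
  have hm' : (4 : ℝ) < m := by exact_mod_cast hm
  have h1 : σ = k * √(c * m) := by
    rw [← hk]; field_simp
  rw [h1, mul_pow, Real.sq_sqrt (by positivity)]
  ring

lemma integral_posterior_recommended {σ c : ℝ} (hσ : 0 < σ) (hc : 0 < c) {m : ℕ} (hm : 4 < m)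
    {k : ℕ} (hk : σ / √(c * m) = k) :
    ∫⁻ x, ENNReal.ofReal (1 / (2 * k / σ ^ 2 + ((m - 2) * k : ℕ) / (σ ^ 2 + alpha σ c m ^ 2 *
        ((2 * σ ^ 2 / k) * x ^ 2)))) ∂gaussianReal 0 1 + ENNReal.ofReal (c * k) =
      ENNReal.ofReal (recommendedPenalty σ c m k) := by
  have hk0 := size_pos_of_many hσ hc hm hk
  have hm' : (4 : ℝ) < m := by exact_mod_cast hm
  set a := alpha σ c m
  have hb : 0 ≤ 4 * a ^ 2 / (m * k) := by positivity
  have hq : (((m - 2) * k : ℕ) : ℝ) = (m - 2) * k := by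
    rw [Nat.cast_mul, Nat.cast_sub (by omega)]; norm_num
  have hm2 : (0 : ℝ) ≤ (m : ℝ) - 2 := by linarith
  have h1 : ∀ x : ℝ, 1 / (2 * k / σ ^ 2 + ((m - 2) * k : ℕ) / (σ ^ 2 + a ^ 2 *
      ((2 * σ ^ 2 / k) * x ^ 2))) = σ ^ 2 / k * (1 / 2 - ((m : ℝ) - 2) / (2 * m) *
        (1 / (1 + 4 * a ^ 2 / (m * k) * x ^ 2))) := by
    intro x
    rw [hq]
    have e1 : (2 : ℝ) * k / σ ^ 2 + (m - 2) * k / (σ ^ 2 + a ^ 2 * ((2 * σ ^ 2 / k) * x ^ 2)) =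
        k * (m * k + 4 * a ^ 2 * x ^ 2) / (σ ^ 2 * (k + 2 * a ^ 2 * x ^ 2)) := by
      have e0 : σ ^ 2 + a ^ 2 * ((2 * σ ^ 2 / k) * x ^ 2) =
          σ ^ 2 * (k + 2 * a ^ 2 * x ^ 2) / k := by field_simp
      have e2 : 0 < (k : ℝ) + 2 * a ^ 2 * x ^ 2 := by positivity
      rw [e0]
      field_simp
      ring
    have e3 : 0 < (m : ℝ) * k + 4 * a ^ 2 * x ^ 2 := by positivity
    rw [e1, one_div_div]
    field_simp
    ring
  have hI := integrable_meanInv hb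
  have hint : Integrable (fun x : ℝ => σ ^ 2 / k * (1 / 2 - ((m : ℝ) - 2) / (2 * m) *
        (1 / (1 + 4 * a ^ 2 / (m * k) * x ^ 2)))) (gaussianReal 0 1) :=
    ((integrable_const _).sub (hI.const_mul _)).const_mul _
  have hnn : ∀ x : ℝ, 0 ≤ σ ^ 2 / k * (1 / 2 - ((m : ℝ) - 2) / (2 * m) *
        (1 / (1 + 4 * a ^ 2 / (m * k) * x ^ 2))) := by
    intro x
    rw [← h1 x]
    positivity
  have hval : ∫ x, σ ^ 2 / k * (1 / 2 - ((m : ℝ) - 2) / (2 * m) *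
        (1 / (1 + 4 * a ^ 2 / (m * k) * x ^ 2))) ∂gaussianReal 0 1 =
      σ ^ 2 / k * (1 / 2 - ((m : ℝ) - 2) / (2 * m) * meanInv (4 * a ^ 2 / (m * k))) := by
    rw [integral_const_mul, integral_sub (integrable_const _) (hI.const_mul _),
      integral_const_mul (((m : ℝ) - 2) / (2 * m))]
    simp [meanInv]
  simp only [h1]
  rw [← ofReal_integral_eq_lintegral_ofReal hint (Filter.Eventually.of_forall hnn),
    ← ENNReal.ofReal_add (integral_nonneg hnn) (by positivity), hval]
  rfl

/-- Averaging the tangent bound over x leaves an affine function of n. Its slope is −c by the choice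
of α, so adding the cost cn gives a constant, the recommended penalty. -/
lemma recommendedPenalty_le_posterior {σ c : ℝ} (hσ : 0 < σ) (hc : 0 < c) {m : ℕ} (hm : 4 < m)
    {k : ℕ} (hk : σ / √(c * m) = k) {n : ℕ} (hn : n ≠ 0) :
    ENNReal.ofReal (recommendedPenalty σ c m k) ≤
      ∫⁻ x, ENNReal.ofReal (1 / (n / σ ^ 2 + k / σ ^ 2 + ((m - 2) * k : ℕ) /
        (σ ^ 2 + alpha σ c m ^ 2 * ((σ ^ 2 / n + σ ^ 2 / k) * x ^ 2)))) ∂gaussianReal 0 1 +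
      ENNReal.ofReal (c * n) := by
  have hk0 := size_pos_of_many hσ hc hm hk
  have hm' : (4 : ℝ) < m := by exact_mod_cast hm
  have hn0 : (0 : ℝ) < n := by positivity
  have hα := alpha_equation hσ hc hm
  rw [hk] at hα
  have hσ2 := sigma_sq_eq hσ hc hm hk
  set a := alpha σ c m with ha
  set b := 4 * a ^ 2 / (m * k) with hb
  have hb0 : 0 ≤ b := by positivity
  have hq : (((m - 2) * k : ℕ) : ℝ) = (m - 2) * k := by
    rw [Nat.cast_mul, Nat.cast_sub (by omega)]; norm_num
  have hm2 : (0 : ℝ) ≤ (m : ℝ) - 2 := by linarith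
  have hm20 : (m : ℝ) - 2 ≠ 0 := by linarith
  let f : ℝ → ℝ := fun x => 1 / (n / σ ^ 2 + k / σ ^ 2 + ((m - 2) * k : ℕ) /
        (σ ^ 2 + a ^ 2 * ((σ ^ 2 / n + σ ^ 2 / k) * x ^ 2)))
  let g : ℝ → ℝ := fun x => σ ^ 2 / k * ((1 / 2 - ((m : ℝ) - 2) / (2 * m) * (1 / (1 + b * x ^ 2))) -
      (1 / 4 - ((m : ℝ) - 2) / (4 * m) * (1 / (1 + b * x ^ 2)) -
        ((m : ℝ) - 2) / (2 * m ^ 2) * (1 / (1 + b * x ^ 2)) ^ 2) * (n / k - 1))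
  have hgf : ∀ x, g x ≤ f x := by
    intro x
    have h := tangent_le_posterior (M := m) (W := a ^ 2 * x ^ 2 / k) (s := n / k)
      (by linarith) (by positivity) (by positivity)
    have e1 : 4 * (a ^ 2 * x ^ 2 / k) / m = b * x ^ 2 := by rw [hb]; field_simp
    rw [e1] at h
    have e2 : f x = σ ^ 2 / k * (1 / ((n : ℝ) / k + 1 + (m - 2) /
        (1 + a ^ 2 * x ^ 2 / k * (1 + 1 / (n / k))))) := by
      simp only [f]
      rw [hq, mul_one_div, div_eq_div_iff (by positivity) (by positivity)]
      have e3 : σ ^ 2 + a ^ 2 * ((σ ^ 2 / n + σ ^ 2 / k) * x ^ 2) =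
          σ ^ 2 * (1 + a ^ 2 * x ^ 2 / k * (1 + 1 / (n / k))) := by
        field_simp
        ring
      rw [e3]
      set Z := 1 + a ^ 2 * x ^ 2 / k * (1 + 1 / ((n : ℝ) / k)) with hZ
      have hZ0 : 0 < Z := by positivity
      field_simp
    rw [e2]
    exact mul_le_mul_of_nonneg_left h (by positivity)
  have hI := integrable_meanInv hb0
  have hJ := integrable_meanInvSq hb0
  have hi1 : Integrable (fun x : ℝ => 1 / 2 - ((m : ℝ) - 2) / (2 * m) * (1 / (1 + b * x ^ 2)))
      (gaussianReal 0 1) := (integrable_const _).sub (hI.const_mul _)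
  have hi2 : Integrable (fun x : ℝ => 1 / 4 - ((m : ℝ) - 2) / (4 * m) * (1 / (1 + b * x ^ 2)))
      (gaussianReal 0 1) := (integrable_const _).sub (hI.const_mul _)
  have hi3 : Integrable (fun x : ℝ => 1 / 4 - ((m : ℝ) - 2) / (4 * m) * (1 / (1 + b * x ^ 2)) -
        ((m : ℝ) - 2) / (2 * m ^ 2) * (1 / (1 + b * x ^ 2)) ^ 2) (gaussianReal 0 1) :=
    hi2.sub (hJ.const_mul _)
  have hgint : Integrable g (gaussianReal 0 1) := (hi1.sub (hi3.mul_const _)).const_mul _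
  have hv1 : ∫ x, (1 / 2 - ((m : ℝ) - 2) / (2 * m) * (1 / (1 + b * x ^ 2))) ∂gaussianReal 0 1 =
      1 / 2 - ((m : ℝ) - 2) / (2 * m) * meanInv b := by
    rw [integral_sub (integrable_const _) (hI.const_mul _), integral_const_mul]
    simp [meanInv]
  -- The equation for α enters here. The factor 1/m becomes the marginal cost because σ² = mck².
  have hv2 : ∫ x, (1 / 4 - ((m : ℝ) - 2) / (4 * m) * (1 / (1 + b * x ^ 2)) -
        ((m : ℝ) - 2) / (2 * m ^ 2) * (1 / (1 + b * x ^ 2)) ^ 2) ∂gaussianReal 0 1 =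
      1 / (m : ℝ) := by
    have e1 : ∫ x, (1 / 4 - ((m : ℝ) - 2) / (4 * m) * (1 / (1 + b * x ^ 2)) -
        ((m : ℝ) - 2) / (2 * m ^ 2) * (1 / (1 + b * x ^ 2)) ^ 2) ∂gaussianReal 0 1 =
        1 / 4 - ((m : ℝ) - 2) / (4 * m) * meanInv b -
          ((m : ℝ) - 2) / (2 * m ^ 2) * meanInvSq b := by
      rw [integral_sub hi2 (hJ.const_mul _), integral_sub (integrable_const _) (hI.const_mul _),
        integral_const_mul, integral_const_mul]
      simp [meanInv, meanInvSq]
    have e2 : meanInv b = ((m : ℝ) - 4) / (m - 2) - 2 / m * meanInvSq b := by linarith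
    rw [e1, e2]
    field_simp
    ring
  have hgval : ∫ x, g x ∂gaussianReal 0 1 = recommendedPenalty σ c m k - c * n := by
    simp only [g]
    rw [integral_const_mul, integral_sub hi1 (hi3.mul_const _), integral_mul_const, hv1, hv2,
      recommendedPenalty, ← ha, ← hb, hσ2]
    field_simp
    ring
  have hfnn : ∀ x, 0 ≤ f x := fun x => by simp only [f]; positivity
  have hfint : Integrable f (gaussianReal 0 1) := by
    refine integrable_of_bounded (by fun_prop) (C := 1 / (n / σ ^ 2)) fun x => ?_
    rw [abs_of_nonneg (hfnn x)]
    refine one_div_le_one_div_of_le (by positivity) ?_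
    rw [add_assoc]
    exact le_add_of_nonneg_right (by positivity)
  have hle := integral_mono hgint hfint hgf
  rw [hgval] at hle
  change _ ≤ ∫⁻ x, ENNReal.ofReal (f x) ∂gaussianReal 0 1 + _
  rw [← ofReal_integral_eq_lintegral_ofReal hfint (Filter.Eventually.of_forall hfnn),
    ← ENNReal.ofReal_add (integral_nonneg hfnn) (by positivity)]
  exact ENNReal.ofReal_le_ofReal (by linarith)

/-- As the mean square is at most the mean, the equation for α forces `meanInv` to be at least m(m −
4)/((m − 2)(m + 2)). The risk is then at most 3mck/(m + 2) ≤ 3ck. -/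
lemma recommendedPenalty_le {σ c : ℝ} (hσ : 0 < σ) (hc : 0 < c) {m : ℕ} (hm : 4 < m) {k : ℕ}
    (hk : σ / √(c * m) = k) : recommendedPenalty σ c m k ≤ 4 * (c * k) := by
  have hk0 := size_pos_of_many hσ hc hm hk
  have hm' : (4 : ℝ) < m := by exact_mod_cast hm
  have hα := alpha_equation hσ hc hm
  rw [hk] at hα
  have hb0 : 0 ≤ 4 * alpha σ c m ^ 2 / (m * k) := by positivity
  rw [recommendedPenalty, sigma_sq_eq hσ hc hm hk]
  have hJ := meanInvSq_le hb0
  set I := meanInv (4 * alpha σ c m ^ 2 / (m * k))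
  set J := meanInvSq (4 * alpha σ c m ^ 2 / (m * k))
  have h1 : ((m : ℝ) - 4) / (m - 2) ≤ I * ((m + 2) / m) := by
    have : 2 / (m : ℝ) * J ≤ 2 / m * I := by gcongr
    have e : I * (((m : ℝ) + 2) / m) = I + 2 / m * I := by field_simp
    linarith
  rw [div_le_iff₀ (by linarith)] at h1
  have h2 : ((m : ℝ) - 4) / (2 * (m + 2)) ≤ ((m : ℝ) - 2) / (2 * m) * I := by
    rw [div_le_iff₀ (by positivity)]
    have e : ((m : ℝ) - 2) / (2 * m) * I * (2 * (m + 2)) = I * ((m + 2) / m) * (m - 2) := by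
      field_simp
    rw [e]
    exact h1
  have h3 : 1 / 2 - ((m : ℝ) - 4) / (2 * (m + 2)) ≤ 3 / m := by
    have e : 1 / 2 - ((m : ℝ) - 4) / (2 * (m + 2)) = 3 / (m + 2) := by field_simp; ring
    rw [e]
    exact div_le_div_of_nonneg_left (by norm_num) (by linarith) (by linarith)
  have h4 : (m : ℝ) * c * k ^ 2 / k * (1 / 2 - ((m : ℝ) - 2) / (2 * m) * I) ≤
      m * c * k ^ 2 / k * (3 / m) := by
    refine mul_le_mul_of_nonneg_left (by linarith) (by positivity)
  have e : (m : ℝ) * c * k ^ 2 / k * (3 / m) = 3 * (c * k) := by field_simp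
  linarith

/-! ### Penalties in CCCD -/

lemma penalty_CCCD_update (σ c : ℝ) (m : ℕ) (i : Fin m) (t : Strategy (CCCD σ c m).Alloc) :
    penalty σ c (CCCD σ c m) (Function.update (recommendedProfile σ c m) i t) i =
      (⨆ μ : ℝ, ∫⁻ x, ∫⁻ y, ∫⁻ A : Allocation,
        ENNReal.ofReal ((t.estimate x (t.submit x) A - μ) ^ 2)
          ∂poolLaw σ c m (t.submit x) y
          ∂gaussData μ (Real.toNNReal (σ ^ 2)) ((m - 1) * ⌊recommendedSize σ c m⌋₊)
          ∂gaussData μ (Real.toNNReal (σ ^ 2)) t.n) + ENNReal.ofReal (c * t.n) := by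
  rw [penalty]
  congr 1
  · exact iSup_congr fun μ => lintegral_CCCD_update σ c m i t μ
  · rw [Function.update_self]

lemma update_recommendedProfile (σ c : ℝ) (m : ℕ) (i : Fin m) :
    Function.update (recommendedProfile σ c m) i (recommendedStrategy σ c m) =
      recommendedProfile σ c m :=
  Function.update_eq_self i (recommendedProfile σ c m)

lemma sum_update_size (σ c : ℝ) (m : ℕ) (i : Fin m) (t : Strategy (CCCD σ c m).Alloc) :
    ∑ j, (Function.update (recommendedProfile σ c m) i t j).n =
      t.n + (m - 1) * ⌊recommendedSize σ c m⌋₊ := by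
  rw [← Finset.add_sum_erase _ _ (Finset.mem_univ i), Function.update_self,
    Finset.sum_congr rfl fun j hj => show _ = ⌊recommendedSize σ c m⌋₊ by
      rw [Function.update_of_ne (Finset.ne_of_mem_erase hj)]
      rfl,
    Finset.sum_const, Finset.card_erase_of_mem (Finset.mem_univ i), Finset.card_univ,
    Fintype.card_fin, smul_eq_mul]

lemma measurable_sq_error {A : Type*} [MeasurableSpace A] (t : Strategy A) (x : Dataset) (μ : ℝ) :
    Measurable fun a : A => ENNReal.ofReal ((t.estimate x (t.submit x) a - μ) ^ 2) := by
  have h : Measurable fun a : A => ((x, t.submit x, a) : Dataset × Dataset × A) := by fun_prop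
  have h1 := t.measurable_estimate.comp h
  exact ((h1.sub_const μ).pow_const 2).ennreal_ofReal

/-! ### At most four agents -/

lemma penalty_CCCD_of_le_four {σ c : ℝ} (hσ : 0 < σ) {m : ℕ} (hm : 1 < m) (hm4 : m ≤ 4)
    {k : ℕ} (hk0 : 0 < k) (hk : recommendedSize σ c m = k) (hc : 0 < c) (i : Fin m) :
    penalty σ c (CCCD σ c m) (recommendedProfile σ c m) i =
      ENNReal.ofReal (σ ^ 2 / (m * k) + c * k) := by
  have hm0 : (0 : ℝ) < m := by positivity
  have hk0' : (0 : ℝ) < k := by exact_mod_cast hk0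
  rw [← update_recommendedProfile σ c m i, penalty_CCCD_update,
    ENNReal.ofReal_add (by positivity) (by positivity)]
  have hfl : ⌊recommendedSize σ c m⌋₊ = k := by rw [hk, Nat.floor_natCast]
  have hn : (recommendedStrategy σ c m).n = k := hfl
  rw [hn, hfl]
  congr 1
  have hrisk : ∀ μ : ℝ, ∫⁻ x, ∫⁻ y, ∫⁻ A : Allocation,
      ENNReal.ofReal (((recommendedStrategy σ c m).estimate x
        ((recommendedStrategy σ c m).submit x) A - μ) ^ 2)
        ∂poolLaw σ c m ((recommendedStrategy σ c m).submit x) y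
        ∂gaussData μ (Real.toNNReal (σ ^ 2)) ((m - 1) * k)
        ∂gaussData μ (Real.toNNReal (σ ^ 2)) k = ENNReal.ofReal (σ ^ 2 / (m * k)) := by
    intro μ
    have h : ∀ x y : Dataset, ∫⁻ A : Allocation,
        ENNReal.ofReal (((recommendedStrategy σ c m).estimate x
          ((recommendedStrategy σ c m).submit x) A - μ) ^ 2)
          ∂poolLaw σ c m ((recommendedStrategy σ c m).submit x) y =
        ENNReal.ofReal ((weightedAverage σ x y Dataset.empty 0 - μ) ^ 2) := by
      intro x y
      rw [poolLaw, if_pos hm4]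
      exact lintegral_dirac' ((y, Dataset.empty, 0) : Allocation)
        (measurable_sq_error (recommendedStrategy σ c m) x μ)
    simp only [h]
    rw [risk_weightedAverage_pooled hσ μ hk0, Nat.cast_mul, Nat.cast_sub hm.le]
    congr 2
    push_cast
    ring
  simp only [hrisk, ciSup_const]

/-- Even with access to all N = n + (m − 1)k points the risk is at least σ²/N. Since the others'
data are fixed, minimising over n amounts to minimising σ²/N + cN, which AM-GM settles at N = σ/√c =
mk. -/
lemma penalty_CCCD_update_ge_of_le_four {σ c : ℝ} (hσ : 0 < σ) (hc : 0 < c) {m : ℕ} (hm : 1 < m)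
    {k : ℕ} (hk0 : 0 < k) (hk : recommendedSize σ c m = k) (hσk : σ = m * k * √c)
    (i : Fin m) (t : Strategy (CCCD σ c m).Alloc) :
    ENNReal.ofReal (σ ^ 2 / (m * k) + c * k) ≤
      penalty σ c (CCCD σ c m) (Function.update (recommendedProfile σ c m) i t) i := by
  have hm1 : (1 : ℝ) < m := by exact_mod_cast hm
  have hk0' : (0 : ℝ) < k := by exact_mod_cast hk0
  have hfl : ⌊recommendedSize σ c m⌋₊ = k := by rw [hk, Nat.floor_natCast]
  have hsum := sum_update_size σ c m i t
  rw [hfl] at hsum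
  have hN : 0 < t.n + (m - 1) * k := Nat.add_pos_right _ (Nat.mul_pos (by omega) hk0)
  have h := penalty_ge hσ hc.le (CCCD σ c m) (Function.update (recommendedProfile σ c m) i t) i
    (by rw [hsum]; exact hN)
  refine le_trans (ENNReal.ofReal_le_ofReal ?_) h
  rw [hsum, Function.update_self]
  have hN' : (0 : ℝ) < (t.n + (m - 1) * k : ℕ) := by exact_mod_cast hN
  have hx := two_mul_sqrt_mul_le (a := σ ^ 2) (b := c) (by positivity) hc.le hN'
  have hcast : ((t.n + (m - 1) * k : ℕ) : ℝ) = t.n + (m - 1) * k := by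
    rw [Nat.cast_add, Nat.cast_mul, Nat.cast_sub hm.le, Nat.cast_one]
  have hsq : √c * √c = c := Real.mul_self_sqrt hc.le
  have h1 : √(σ ^ 2) * √c = m * k * c := by
    rw [Real.sqrt_sq hσ.le, hσk]
    linear_combination (m * k : ℝ) * hsq
  have h2 : σ ^ 2 / (m * k) = m * k * c := by
    rw [hσk, mul_pow, Real.sq_sqrt hc.le]
    field_simp
  rw [h1] at hx
  rw [h2]
  have h3 : c * ((t.n + (m - 1) * k : ℕ) : ℝ) = c * t.n + c * ((m - 1) * k) := by
    rw [hcast]; ring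
  rw [h3] at hx
  linarith

/-! ### More than four agents -/

/-- The risk of an agent in CCCD with more than four agents, in terms of her own data, the clean
sample and the noisy sample. -/
lemma risk_CCCD_of_four_lt {σ c : ℝ} {m : ℕ} (hm : 4 < m) {k : ℕ} (hk : σ / √(c * m) = k)
    (t : Strategy (CCCD σ c m).Alloc) (μ : ℝ) :
    ∫⁻ x, ∫⁻ y, ∫⁻ A : Allocation, ENNReal.ofReal ((t.estimate x (t.submit x) A - μ) ^ 2)
        ∂poolLaw σ c m (t.submit x) y
        ∂gaussData μ (Real.toNNReal (σ ^ 2)) ((m - 1) * ⌊recommendedSize σ c m⌋₊)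
        ∂gaussData μ (Real.toNNReal (σ ^ 2)) t.n =
      ∫⁻ x, ∫⁻ z, ∫⁻ z', ENNReal.ofReal ((t.estimate x (t.submit x)
          (z, z', noiseVar (alpha σ c m) (t.submit x) z) - μ) ^ 2)
        ∂gaussData μ (Real.toNNReal (σ ^ 2) + noiseVar (alpha σ c m) (t.submit x) z) ((m - 2) * k)
        ∂gaussData μ (Real.toNNReal (σ ^ 2)) k ∂gaussData μ (Real.toNNReal (σ ^ 2)) t.n := by
  have hsize : recommendedSize σ c m = k := by rw [recommendedSize, if_neg (by omega), hk]
  rw [hsize, Nat.floor_natCast]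
  -- The pool holds (m − 1)k ≥ k points, so the clean sample has its full size and (m − 2)k points
  -- are corrupted.
  have hmin : min ((m - 1) * k) k = k := min_eq_right (Nat.le_mul_of_pos_left k (by omega))
  have hsub : (m - 1) * k - k = (m - 2) * k := by
    rw [← Nat.sub_one_mul, Nat.sub_sub]
  refine lintegral_congr fun x => ?_
  have h := lintegral_sampleCorruptLaw_gaussData (alpha σ c m) k (t.submit x) μ
    (Real.toNNReal (σ ^ 2)) ((m - 1) * k) (measurable_sq_error t x μ)
  rw [hmin, hsub] at h
  simp only [poolLaw, if_neg (not_le.2 hm), hk, Nat.floor_natCast]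
  exact h

lemma penalty_CCCD_of_four_lt {σ c : ℝ} (hσ : 0 < σ) (hc : 0 < c) {m : ℕ} (hm : 4 < m) {k : ℕ}
    (hk : σ / √(c * m) = k) (i : Fin m) :
    penalty σ c (CCCD σ c m) (recommendedProfile σ c m) i =
      ENNReal.ofReal (recommendedPenalty σ c m k) := by
  have hk0 : 0 < k := by exact_mod_cast size_pos_of_many hσ hc hm hk
  have hsize : recommendedSize σ c m = k := by rw [recommendedSize, if_neg (by omega), hk]
  have hn : (recommendedStrategy σ c m).n = k := by
    change ⌊recommendedSize σ c m⌋₊ = k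
    rw [hsize, Nat.floor_natCast]
  rw [← update_recommendedProfile σ c m i, penalty_CCCD_update]
  simp only [risk_CCCD_of_four_lt hm hk]
  rw [hn, ← integral_posterior_recommended hσ hc hm hk]
  congr 1
  have h := fun μ => risk_weightedAverage_corrupted hσ (alpha σ c m) μ hk0 ((m - 2) * k)
  refine (iSup_congr h).trans ?_
  rw [ciSup_const]

lemma penalty_CCCD_update_ge_of_four_lt {σ c : ℝ} (hσ : 0 < σ) (hc : 0 < c) {m : ℕ} (hm : 4 < m)
    {k : ℕ} (hk : σ / √(c * m) = k) (i : Fin m) (t : Strategy (CCCD σ c m).Alloc) :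
    ENNReal.ofReal (recommendedPenalty σ c m k) ≤
      penalty σ c (CCCD σ c m) (Function.update (recommendedProfile σ c m) i t) i := by
  have hk0' := size_pos_of_many hσ hc hm hk
  have hk0 : k ≠ 0 := by
    rintro rfl
    simp at hk0'
  have hv : Real.toNNReal (σ ^ 2) ≠ 0 := by simpa using hσ.ne'
  have hvv : (Real.toNNReal (σ ^ 2) : ℝ) = σ ^ 2 := Real.coe_toNNReal _ (sq_nonneg σ)
  rw [penalty_CCCD_update]
  simp only [risk_CCCD_of_four_lt hm hk]
  by_cases hn : t.n = 0
  -- The tangent argument needs n > 0. An agent without data has risk at least σ²/k = mck, which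
  -- exceeds the bound 4ck on the recommended penalty.
  · have h := risk_corrupted_ge_no_data hv (alpha_pos hσ hc hm).ne' hk0 ((m - 2) * k)
      t.measurable_submit t.measurable_estimate
    rw [hvv] at h
    rw [hn]
    refine le_trans ?_ (le_add_of_le_of_nonneg h zero_le)
    refine ENNReal.ofReal_le_ofReal ((recommendedPenalty_le hσ hc hm hk).trans ?_)
    have hm' : (4 : ℝ) < m := by exact_mod_cast hm
    rw [sigma_sq_eq hσ hc hm hk, le_div_iff₀ hk0']
    have : (4 : ℝ) * (c * k * k) ≤ m * (c * k * k) := by gcongr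
    linarith
  · have h := risk_corrupted_ge_limit hv (alpha σ c m) hn hk0 ((m - 2) * k)
      t.measurable_submit t.measurable_estimate
    rw [hvv] at h
    exact (recommendedPenalty_le_posterior hσ hc hm hk hn).trans (add_le_add_left h _)

/-! ### Efficiency -/

/-- The two thresholds are the lower bound for a solitary agent and twice the lower bound for the
social penalty. -/
lemma efficiency_of_penalty_le {σ c : ℝ} (hσ : 0 < σ) (hc : 0 < c) {m : ℕ} (hm : 0 < m)
    {M : Mechanism.{u} m} {s : Fin m → Strategy M.Alloc} {p : ℝ}
    (h : ∀ i, penalty σ c M s i = ENNReal.ofReal p) (h1 : p ≤ 2 * (σ * √c))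
    (h2 : m * p ≤ 4 * (σ * √(c * m))) :
    IsIndividuallyRational σ c M s ∧ PoS.{u, v} σ c M s ≤ 2 := by
  constructor
  · intro i
    rw [h i]
    exact (ENNReal.ofReal_le_ofReal h1).trans (soloPenalty_ge hσ hc.le)
  · refine ENNReal.div_le_of_le_mul ?_
    rw [socialPenalty, Finset.sum_congr rfl fun i _ => h i, Finset.sum_const, Finset.card_univ,
      Fintype.card_fin, nsmul_eq_mul, ← ENNReal.ofReal_natCast,
      ← ENNReal.ofReal_mul (by positivity)]
    calc ENNReal.ofReal (m * p) ≤ ENNReal.ofReal (2 * (2 * (σ * √(c * m)))) :=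
          ENNReal.ofReal_le_ofReal (by linarith)
      _ = 2 * ENNReal.ofReal (2 * (σ * √(c * m))) := by
          rw [ENNReal.ofReal_mul (by norm_num), ENNReal.ofReal_ofNat]
      _ ≤ 2 * minSocialPenalty.{v} σ c m := by
          gcongr
          exact minSocialPenalty_ge hσ hc.le hm

end MeanEstimation

end

theorem theorem1 (m : ℕ) (hm : 1 < m) (σ c : ℝ) (hσ : 0 < σ) (hc : 0 < c)
    (hint : ∃ k : ℕ, MeanEstimation.recommendedSize σ c m = k) :
    (4 < m → IsLeast (MeanEstimation.admissibleRoots σ c m) (MeanEstimation.alpha σ c m)) ∧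
    MeanEstimation.IsNashEquilibrium σ c (MeanEstimation.CCCD σ c m)
      (MeanEstimation.recommendedProfile σ c m) ∧
    MeanEstimation.IsIndividuallyRational σ c (MeanEstimation.CCCD σ c m)
      (MeanEstimation.recommendedProfile σ c m) ∧
    MeanEstimation.PoS.{0, u} σ c (MeanEstimation.CCCD σ c m)
      (MeanEstimation.recommendedProfile σ c m) ≤ 2 := by
  refine ⟨fun h => MeanEstimation.isLeast_admissibleRoots hσ hc h, ?_⟩
  obtain ⟨k, hsize⟩ := hint
  have hm0 : 0 < m := by omega
  have hm1 : (1 : ℝ) < m := by exact_mod_cast hm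
  have hsc : √c * √c = c := Real.mul_self_sqrt hc.le
  have hsm : √(m : ℝ) * √(m : ℝ) = m := Real.mul_self_sqrt m.cast_nonneg
  rcases Nat.lt_or_ge 4 m with hm4 | hm4
  · have hk : σ / √(c * m) = k := by
      rwa [MeanEstimation.recommendedSize, if_neg (by omega)] at hsize
    have hk0 := MeanEstimation.size_pos_of_many hσ hc hm4 hk
    have hp := MeanEstimation.penalty_CCCD_of_four_lt hσ hc hm4 hk
    have hle := MeanEstimation.recommendedPenalty_le hσ hc hm4 hk
    have hσk : σ = k * (√c * √m) := by
      rw [← Real.sqrt_mul hc.le, ← hk]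
      field_simp
    -- Here σ√c = ck√m, and √m ≥ 2.
    have h1 : 4 * (c * k) ≤ 2 * (σ * √c) := by
      have h2 : 2 ≤ √(m : ℝ) := Real.le_sqrt_of_sq_le (by
        have : (4 : ℝ) < m := by exact_mod_cast hm4
        linarith)
      have h3 : σ * √c = c * k * √m := by
        rw [hσk]; linear_combination (k * √m : ℝ) * hsc
      rw [h3]
      have : c * k * 2 ≤ c * k * √m := by gcongr
      linarith
    have h2 : m * (4 * (c * k)) = 4 * (σ * √(c * m)) := by
      rw [Real.sqrt_mul hc.le, hσk]
      linear_combination (-4 * k * m : ℝ) * hsc - (4 * k * (√c * √c)) * hsm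
    refine ⟨fun i t => ?_, MeanEstimation.efficiency_of_penalty_le hσ hc hm0 hp (hle.trans h1) ?_⟩
    · rw [hp i]
      exact MeanEstimation.penalty_CCCD_update_ge_of_four_lt hσ hc hm4 hk i t
    · rw [← h2]
      gcongr
  · have hk : σ / (m * √c) = k := by
      rwa [MeanEstimation.recommendedSize, if_pos hm4] at hsize
    have hk0' : (0 : ℝ) < k := by rw [← hk]; positivity
    have hk0 : 0 < k := by exact_mod_cast hk0'
    have hσk : σ = m * k * √c := by
      rw [← hk]; field_simp
    have hp := fun i => MeanEstimation.penalty_CCCD_of_le_four hσ hm hm4 hk0 hsize hc i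
    have hval : σ ^ 2 / (m * k) + c * k = (m + 1) * (c * k) := by
      rw [hσk, mul_pow, Real.sq_sqrt hc.le]
      field_simp
    refine ⟨fun i t => ?_, MeanEstimation.efficiency_of_penalty_le hσ hc hm0 hp ?_ ?_⟩
    · rw [hp i]
      exact MeanEstimation.penalty_CCCD_update_ge_of_le_four hσ hc hm hk0 hsize hσk i t
    · have h3 : σ * √c = m * (c * k) := by
        rw [hσk]; linear_combination (m * k : ℝ) * hsc
      rw [hval, h3]
      have : 0 < c * k := by positivity
      nlinarith
    · have h3 : σ * √(c * m) = m * (c * k) * √m := by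
        rw [Real.sqrt_mul hc.le, hσk]; linear_combination (m * k * √m : ℝ) * hsc
      -- Equivalent to m² − 14m + 1 ≤ 0, which holds for 1 < m ≤ 4.
      have h4 : ((m : ℝ) + 1) / 4 ≤ √m := Real.le_sqrt_of_sq_le (by
        have : (m : ℝ) ≤ 4 := by exact_mod_cast hm4
        nlinarith)
      rw [hval, h3]
      have : m * (c * k) * (((m : ℝ) + 1) / 4) ≤ m * (c * k) * √m := by gcongr
      linarith
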